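/- Let $\mathcal{G}\rightrightarrows M$ be a Lie groupoid over a (Hausdorff, second countable) smooth manifold $M$, with source $s$, target $t$ and source fibres of constant dimension, and let $A=\ker(ds)|_{M}$ be its Lie algebroid, with anchor $\rho=dt|_A$ and with the bracket induced by right invariant vector fields. Assume that $\mathcal{G}$ is $s$-connected, i.e. that all fibres $s^{-1}(x)$, $x\in M$, are connected. Let $\mathcal{D}_A^{\mathrm{tr}}=\mathcal{D}_{A^*}\otimes\mathcal{D}_{TM}$ be the transverse density bundle, where $\mathcal{D}_E$ denotes the line bundle of densities of a vector bundle $E$ (the functions $\xi$ on frames with $\xi(e\cdot B)=|\det B|\,\xi(e)$). An arrow $g:x\to y$ acts by the isomorphism $g_*:\mathcal{D}^{\mathrm{tr}}_{A,x}\to\mathcal{D}^{\mathrm{tr}}_{A,y}$ induced by the isomorphisms $$\mathcal{D}(A_y)\otimes\mathcal{D}(T_xM)\cong\mathcal{D}(T_g\mathcal{G})\cong\mathcal{D}(T_{g^{-1}}\mathcal{G})\cong\mathcal{D}(A_x)\otimes\mathcal{D}(T_yM)$$ that come from the exact sequences $0\to A_y\to T_g\mathcal{G}\xrightarrow{ds}T_xM\to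 0$ (right translation and $ds$) at $g$ and at $g^{-1}$ and from the differential of the inversion. A transverse density of $\mathcal{G}$ is a smooth section $\sigma$ of $\mathcal{D}_A^{\mathrm{tr}}$ with $g_*\sigma(x)=\sigma(y)$ for all arrows $g:x\to y$. The Lie algebroid $A$ acts on $\mathcal{D}_A^{\mathrm{tr}}$ by $\nabla_\alpha(\xi\otimes\eta)=L_\alpha\xi\otimes\eta+\xi\otimes L_{\rho(\alpha)}\eta$. If $\sigma$ is a nowhere vanishing smooth section of $\mathcal{D}_A^{\mathrm{tr}}$ and $\nabla_\alpha\sigma=c_\sigma(\alpha)\,\sigma$ for all $\alpha\in\Gamma(A)$, then $c_\sigma$ is a closed $1$-form of $A$, and its class in the Lie algebroid cohomology $H^1(A)$ (closed $A$-forms of degree one modulo the forms $\alpha\mapsto\rho(\alpha)(f)$, $f\in C^\infty(M)$) is the modular class $\mathrm{mod}(A)$. Then $\mathrm{mod}(A)$ is well defined (such $\sigma$ exist and the class does not depend on the choice), and $\mathrm{mod}(A)=0$ in $H^1(A)$ if and only if $\mathcal{G}$ admits a strictly positive transverse density. -/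

import Mathlib

open scoped Manifold ContDiff TensorProduct

noncomputable section

/-- The space of densities of a vector space `V`: the functions `ξ` on frames of `V` (indexed by `ι`)
such that `ξ (e · A) = |det A| ξ e`. For frames `e`, `f`, the number `e.det f` is the determinant of
the matrix `A` with `f = e · A`. -/
def DensitySpace (ι : Type*) [Fintype ι] [DecidableEq ι] (V : Type*) [AddCommGroup V] [Module ℝ V] :
    Submodule ℝ (Module.Basis ι ℝ V → ℝ) where
  carrier := {ξ | ∀ e f : Module.Basis ι ℝ V, ξ f = |e.det f| * ξ e}
  add_mem' := by
    intro ξ η hξ hη e f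
    simp only [Pi.add_apply]
    rw [hξ e f, hη e f]
    ring
  zero_mem' := by
    intro e f
    simp
  smul_mem' := by
    intro c ξ hξ e f
    simp only [Pi.smul_apply, smul_eq_mul]
    rw [hξ e f]
    ring

/-- Evaluation of densities at a frame. -/
def DensitySpace.eval {ι : Type*} [Fintype ι] [DecidableEq ι] {V : Type*} [AddCommGroup V]
    [Module ℝ V] (e : Module.Basis ι ℝ V) : DensitySpace ι V →ₗ[ℝ] ℝ :=
  (LinearMap.proj (R := ℝ) (φ := fun _ : Module.Basis ι ℝ V => ℝ) e) ∘ₗ (DensitySpace ι V).subtype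

/-- A Lie groupoid `G ⇉ M` whose base has dimension `n` and whose source fibres have dimension `r`
(so that `G` has dimension `n + r`). The product `mul g h` is meaningful only for composable arrows,
`src g = tgt h`; the values of `mul` on other pairs play no role. Smoothness of the product is
smoothness on the submanifold of composable pairs in `G × G`. -/
structure LieGroupoid (n r : ℕ) (M G : Type*)
    [TopologicalSpace M] [ChartedSpace (EuclideanSpace ℝ (Fin n)) M] [IsManifold (𝓡 n) ∞ M]
    [TopologicalSpace G] [ChartedSpace (EuclideanSpace ℝ (Fin (n + r))) G]
    [IsManifold (𝓡 (n + r)) ∞ G] where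
  src : G → M
  tgt : G → M
  unit : M → G
  inv : G → G
  mul : G → G → G
  src_unit : ∀ x, src (unit x) = x
  tgt_unit : ∀ x, tgt (unit x) = x
  src_mul : ∀ g h, src g = tgt h → src (mul g h) = src h
  tgt_mul : ∀ g h, src g = tgt h → tgt (mul g h) = tgt g
  mul_assoc : ∀ g h k, src g = tgt h → src h = tgt k → mul (mul g h) k = mul g (mul h k)
  unit_mul : ∀ g, mul (unit (tgt g)) g = g
  mul_unit : ∀ g, mul g (unit (src g)) = g
  src_inv : ∀ g, src (inv g) = tgt g
  tgt_inv : ∀ g, tgt (inv g) = src g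
  mul_inv : ∀ g, mul g (inv g) = unit (tgt g)
  inv_mul : ∀ g, mul (inv g) g = unit (src g)
  src_submersion : Manifold.IsSubmersion (𝓡 (n + r)) (𝓡 n) ∞ src
  contMDiff_tgt : ContMDiff (𝓡 (n + r)) (𝓡 n) ∞ tgt
  contMDiff_unit : ContMDiff (𝓡 n) (𝓡 (n + r)) ∞ unit
  contMDiff_inv : ContMDiff (𝓡 (n + r)) (𝓡 (n + r)) ∞ inv
  contMDiffOn_mul : ContMDiffOn ((𝓡 (n + r)).prod (𝓡 (n + r))) (𝓡 (n + r)) ∞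
    (fun p : G × G => mul p.1 p.2) {p | src p.1 = tgt p.2}

namespace LieGroupoid

section

variable {n r : ℕ} {M G : Type*}
  [TopologicalSpace M] [ChartedSpace (EuclideanSpace ℝ (Fin n)) M] [IsManifold (𝓡 n) ∞ M]
  [TopologicalSpace G] [ChartedSpace (EuclideanSpace ℝ (Fin (n + r))) G]
  [IsManifold (𝓡 (n + r)) ∞ G]

/-- A Lie groupoid is `s`-connected if all its source fibres are connected. -/
def IsSConnected (𝒢 : LieGroupoid n r M G) : Prop :=
  ∀ x : M, IsConnected {g : G | 𝒢.src g = x}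

/-! ### The Lie algebroid -/

/-- The fibre at `x` of the Lie algebroid: the kernel of the differential of the source map at the
unit `1_x`. -/
def algebroid (𝒢 : LieGroupoid n r M G) (x : M) :
    Submodule ℝ (TangentSpace (𝓡 (n + r)) (𝒢.unit x)) :=
  LinearMap.ker (mfderiv (𝓡 (n + r)) (𝓡 n) 𝒢.src (𝒢.unit x)).toLinearMap

/-- The anchor `A_x → T_x M`, the restriction of the differential of the target map at `1_x`
(recall that `t (1_x) = x`). -/
def anchor (𝒢 : LieGroupoid n r M G) (x : M) : 𝒢.algebroid x →ₗ[ℝ] TangentSpace (𝓡 n) x :=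
  LinearMap.comp (M₃ := TangentSpace (𝓡 n) x)
    (mfderiv (𝓡 (n + r)) (𝓡 n) 𝒢.tgt (𝒢.unit x)).toLinearMap (𝒢.algebroid x).subtype

/-- The differential at `1_{t(g)}` of the right translation `h ↦ h g`, which is defined on the source
fibre of `t(g)`. It is meaningful on vectors tangent to that source fibre, that is, on `A_{t(g)}`. -/
def rightTranslation (𝒢 : LieGroupoid n r M G) (g : G) :
    𝒢.algebroid (𝒢.tgt g) →ₗ[ℝ] TangentSpace (𝓡 (n + r)) g :=
  LinearMap.comp (M₃ := TangentSpace (𝓡 (n + r)) g)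
    (mfderivWithin (𝓡 (n + r)) (𝓡 (n + r)) (fun h => 𝒢.mul h g)
      {h | 𝒢.src h = 𝒢.tgt g} (𝒢.unit (𝒢.tgt g))).toLinearMap
    (𝒢.algebroid (𝒢.tgt g)).subtype

/-- A section of the Lie algebroid is smooth on `U` if it is smooth as a map to the tangent bundle
of `G`. -/
def SmoothSectionOn (𝒢 : LieGroupoid n r M G) (α : ∀ x, 𝒢.algebroid x) (U : Set M) : Prop :=
  ContMDiffOn (𝓡 n) (𝓡 (n + r)).tangent ∞
    (fun x => (⟨𝒢.unit x, (α x : TangentSpace (𝓡 (n + r)) (𝒢.unit x))⟩ :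
      TangentBundle (𝓡 (n + r)) G)) U

/-- The right invariant vector field on `G` determined by a section of the Lie algebroid. -/
def rightInvariantField (𝒢 : LieGroupoid n r M G) (α : ∀ x, 𝒢.algebroid x) (g : G) :
    TangentSpace (𝓡 (n + r)) g :=
  𝒢.rightTranslation g (α (𝒢.tgt g))

/-- `γ ∈ A_x` is the value at `x` of the Lie bracket `[α, β]` of sections of the Lie algebroid, i.e.
the value at `1_x` of the Lie bracket of the corresponding right invariant vector fields. For `α` and
`β` smooth near `x` there is exactly one such `γ`, because the Lie bracket of vector fields that are
tangent to the source fibres is again tangent to them. -/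
def IsBracketAt (𝒢 : LieGroupoid n r M G) (α β : ∀ x, 𝒢.algebroid x) (x : M)
    (γ : 𝒢.algebroid x) : Prop :=
  (γ : TangentSpace (𝓡 (n + r)) (𝒢.unit x)) =
    VectorField.mlieBracket (𝓡 (n + r)) (𝒢.rightInvariantField α) (𝒢.rightInvariantField β)
      (𝒢.unit x)

/-! ### Lie algebroid cohomology in degree one -/

/-- The derivative of the function `f` at `x` in the direction of the anchor of `a ∈ A_x`. -/
def anchorDeriv (𝒢 : LieGroupoid n r M G) (f : M → ℝ) (x : M) : 𝒢.algebroid x →ₗ[ℝ] ℝ :=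
  LinearMap.comp (M₃ := ℝ) (mfderiv (𝓡 n) 𝓘(ℝ, ℝ) f x).toLinearMap (𝒢.anchor x)

lemma anchorDeriv_add (𝒢 : LieGroupoid n r M G) {f g : M → ℝ}
    (hf : ContMDiff (𝓡 n) 𝓘(ℝ, ℝ) ∞ f) (hg : ContMDiff (𝓡 n) 𝓘(ℝ, ℝ) ∞ g) (x : M) :
    𝒢.anchorDeriv (fun y => f y + g y) x = 𝒢.anchorDeriv f x + 𝒢.anchorDeriv g x := by
  have hf' := ((hf x).mdifferentiableAt (by simp)).hasMFDerivAt
  have hg' := ((hg x).mdifferentiableAt (by simp)).hasMFDerivAt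
  have h := (hf'.add hg').mfderiv
  ext a
  exact congrArg (fun L : EuclideanSpace ℝ (Fin n) →L[ℝ] ℝ => L (𝒢.anchor x a)) h

lemma anchorDeriv_smul (𝒢 : LieGroupoid n r M G) {f : M → ℝ}
    (hf : ContMDiff (𝓡 n) 𝓘(ℝ, ℝ) ∞ f) (c : ℝ) (x : M) :
    𝒢.anchorDeriv (fun y => c * f y) x = c • 𝒢.anchorDeriv f x := by
  have hf' := ((hf x).mdifferentiableAt (by simp)).hasMFDerivAt
  have h := (hf'.const_smul c).mfderiv
  ext a
  exact congrArg (fun L : EuclideanSpace ℝ (Fin n) →L[ℝ] ℝ => L (𝒢.anchor x a)) h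

lemma anchorDeriv_zero (𝒢 : LieGroupoid n r M G) (x : M) :
    𝒢.anchorDeriv (fun _ => 0) x = 0 := by
  have h := (hasMFDerivAt_const (I := 𝓡 n) (I' := 𝓘(ℝ, ℝ)) (0 : ℝ) x).mfderiv
  ext a
  exact congrArg (fun L : EuclideanSpace ℝ (Fin n) →L[ℝ] ℝ => L (𝒢.anchor x a)) h

/-- The vector space of all (not necessarily smooth) sections of the dual of the Lie algebroid. -/
def DualSections (𝒢 : LieGroupoid n r M G) : Type _ :=
  ∀ x, Module.Dual ℝ (𝒢.algebroid x)

instance (𝒢 : LieGroupoid n r M G) : AddCommGroup 𝒢.DualSections :=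
  inferInstanceAs (AddCommGroup (∀ x, Module.Dual ℝ (𝒢.algebroid x)))

instance (𝒢 : LieGroupoid n r M G) : Module ℝ 𝒢.DualSections :=
  inferInstanceAs (Module ℝ (∀ x, Module.Dual ℝ (𝒢.algebroid x)))

lemma DualSections.add_apply (𝒢 : LieGroupoid n r M G) (θ η : 𝒢.DualSections) (x : M) :
    (θ + η) x = θ x + η x := rfl

lemma DualSections.smul_apply (𝒢 : LieGroupoid n r M G) (c : ℝ) (θ : 𝒢.DualSections) (x : M) :
    (c • θ) x = c • θ x := rfl

lemma DualSections.zero_apply (𝒢 : LieGroupoid n r M G) (x : M) :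
    (0 : 𝒢.DualSections) x = 0 := rfl

/-- `Ω¹(A)`: the smooth sections of the dual of the Lie algebroid. -/
def oneForms (𝒢 : LieGroupoid n r M G) : Submodule ℝ 𝒢.DualSections where
  carrier := {θ | ∀ α, 𝒢.SmoothSectionOn α Set.univ →
    ContMDiff (𝓡 n) 𝓘(ℝ, ℝ) ∞ (fun x => θ x (α x))}
  add_mem' := by
    intro θ η hθ hη α hα
    exact (hθ α hα).add (hη α hα)
  zero_mem' := by
    intro α _
    exact contMDiff_const
  smul_mem' := by
    intro c θ hθ α hα
    exact (contDiff_const_smul (𝕜 := ℝ) (n := ∞) c).contMDiff.comp (hθ α hα)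

/-- The closed `1`-forms: those `θ ∈ Ω¹(A)` with
`(dθ)(α, β) = ρ(α)(θ(β)) - ρ(β)(θ(α)) - θ([α, β]) = 0`. -/
def closedForms (𝒢 : LieGroupoid n r M G) : Submodule ℝ 𝒢.DualSections where
  carrier := {θ | θ ∈ 𝒢.oneForms ∧
    ∀ α β γ : (∀ x, 𝒢.algebroid x), 𝒢.SmoothSectionOn α Set.univ → 𝒢.SmoothSectionOn β Set.univ →
      (∀ x, 𝒢.IsBracketAt α β x (γ x)) → ∀ x,
        𝒢.anchorDeriv (fun y => θ y (β y)) x (α x) - 𝒢.anchorDeriv (fun y => θ y (α y)) x (β x)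
          - θ x (γ x) = 0}
  add_mem' := by
    rintro θ η ⟨hθ, hθ'⟩ ⟨hη, hη'⟩
    refine ⟨Submodule.add_mem _ hθ hη, fun α β γ hα hβ hγ x => ?_⟩
    have h1 := 𝒢.anchorDeriv_add (hθ β hβ) (hη β hβ) x
    have h2 := 𝒢.anchorDeriv_add (hθ α hα) (hη α hα) x
    have h3 := hθ' α β γ hα hβ hγ x
    have h4 := hη' α β γ hα hβ hγ x
    simp only [DualSections.add_apply, LinearMap.add_apply]
    rw [h1, h2, LinearMap.add_apply, LinearMap.add_apply]
    linarith
  zero_mem' := by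
    refine ⟨Submodule.zero_mem _, fun α β γ _ _ _ x => ?_⟩
    simp [anchorDeriv_zero, DualSections.zero_apply]
  smul_mem' := by
    rintro c θ ⟨hθ, hθ'⟩
    refine ⟨Submodule.smul_mem _ c hθ, fun α β γ hα hβ hγ x => ?_⟩
    have h1 := 𝒢.anchorDeriv_smul (hθ β hβ) c x
    have h2 := 𝒢.anchorDeriv_smul (hθ α hα) c x
    have h3 := hθ' α β γ hα hβ hγ x
    simp only [DualSections.smul_apply, LinearMap.smul_apply, smul_eq_mul]
    rw [h1, h2, LinearMap.smul_apply, LinearMap.smul_apply, smul_eq_mul, smul_eq_mul,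
      ← mul_sub, ← mul_sub, h3, mul_zero]

/-- The exact `1`-forms `d f`, `(d f)(α) = ρ(α)(f)`, with `f ∈ C^∞(M)`. -/
def exactForms (𝒢 : LieGroupoid n r M G) : Submodule ℝ 𝒢.DualSections where
  carrier := {θ | ∃ f : M → ℝ, ContMDiff (𝓡 n) 𝓘(ℝ, ℝ) ∞ f ∧ ∀ x, θ x = 𝒢.anchorDeriv f x}
  add_mem' := by
    rintro θ η ⟨f, hf, hθ⟩ ⟨g, hg, hη⟩
    refine ⟨fun y => f y + g y, hf.add hg, fun x => ?_⟩
    rw [𝒢.anchorDeriv_add hf hg x, DualSections.add_apply, hθ x, hη x]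
  zero_mem' := ⟨fun _ => 0, contMDiff_const, fun x => (𝒢.anchorDeriv_zero x).symm⟩
  smul_mem' := by
    rintro c θ ⟨f, hf, hθ⟩
    refine ⟨fun y => c * f y, (contDiff_const_smul (𝕜 := ℝ) (n := ∞) c).contMDiff.comp hf, fun x => ?_⟩
    rw [𝒢.anchorDeriv_smul hf c x, DualSections.smul_apply, hθ x]

/-- `H¹(A)`, the first Lie algebroid cohomology: closed `1`-forms modulo exact ones. -/
abbrev H1 (𝒢 : LieGroupoid n r M G) : Type _ :=
  𝒢.closedForms ⧸ 𝒢.exactForms.submoduleOf 𝒢.closedForms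

/-! ### The transverse density bundle -/

/-- The fibre at `x` of the transverse density bundle, `D(A_x^*) ⊗ D(T_x M)`. -/
abbrev TransverseDensityFibre (𝒢 : LieGroupoid n r M G) (x : M) : Type _ :=
  DensitySpace (Fin r) (Module.Dual ℝ (𝒢.algebroid x)) ⊗[ℝ]
    DensitySpace (Fin n) (TangentSpace (𝓡 n) x)

/-- The number that represents an element of `D(A_x^*) ⊗ D(T_x M)` with respect to a frame `a` of
`A_x` and a frame `v` of `T_x M`: it sends `ξ ⊗ η` to `ξ(a^*) η(v)`, with `a^*` the dual frame. -/
def evalFrame (𝒢 : LieGroupoid n r M G) {x : M} (a : Module.Basis (Fin r) ℝ (𝒢.algebroid x))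
    (v : Module.Basis (Fin n) ℝ (TangentSpace (𝓡 n) x)) :
    𝒢.TransverseDensityFibre x →ₗ[ℝ] ℝ :=
  LinearMap.mul' ℝ ℝ ∘ₗ
    TensorProduct.map (DensitySpace.eval a.dualBasis) (DensitySpace.eval v)

/-- `a`, `v` are frames of `A` and of `TM` which are smooth on `U`. -/
def SmoothFramesOn (𝒢 : LieGroupoid n r M G) (a : ∀ x, Module.Basis (Fin r) ℝ (𝒢.algebroid x))
    (v : ∀ x : M, Module.Basis (Fin n) ℝ (TangentSpace (𝓡 n) x)) (U : Set M) : Prop :=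
  (∀ i, 𝒢.SmoothSectionOn (fun x => a x i) U) ∧
    ∀ j, ContMDiffOn (𝓡 n) (𝓡 n).tangent ∞
      (fun x => (⟨x, v x j⟩ : TangentBundle (𝓡 n) M)) U

/-- Smooth sections of the transverse density bundle: smooth with respect to all smooth local frames
of `A` and of `TM`. -/
def IsSmoothDensity (𝒢 : LieGroupoid n r M G) (σ : ∀ x, 𝒢.TransverseDensityFibre x) : Prop :=
  ∀ U : Set M, IsOpen U → ∀ a v, 𝒢.SmoothFramesOn a v U →
    ContMDiffOn (𝓡 n) 𝓘(ℝ, ℝ) ∞ (fun x => 𝒢.evalFrame (a x) (v x) (σ x)) U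

/-- `b` is a frame of `T_g G` that is adapted, along the exact sequence
`0 → A_{t(g)} → T_g G → T_{s(g)} M → 0` given by right translation and by the differential of the
source map, to a frame `a` of `A_{t(g)}` and a frame `v` of `T_{s(g)} M`. The isomorphism
`D(A_{t(g)}) ⊗ D(T_{s(g)} M) ≅ D(T_g G)` is characterised by `(ξ ⊗ η)(b) = ξ(a) η(v)` for such
frames. -/
def IsAdapted (𝒢 : LieGroupoid n r M G) (g : G)
    (a : Module.Basis (Fin r) ℝ (𝒢.algebroid (𝒢.tgt g)))
    (v : Module.Basis (Fin n) ℝ (TangentSpace (𝓡 n) (𝒢.src g)))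
    (b : Module.Basis (Fin r ⊕ Fin n) ℝ (TangentSpace (𝓡 (n + r)) g)) : Prop :=
  (∀ i, b (Sum.inl i) = 𝒢.rightTranslation g (a i)) ∧
    ∀ j, mfderiv (𝓡 (n + r)) (𝓡 n) 𝒢.src g (b (Sum.inr j)) = v j

/-- The differential of the inversion at `g⁻¹`, as a map `T_{g⁻¹} G → T_g G`. -/
def invDeriv (𝒢 : LieGroupoid n r M G) (g : G) :
    TangentSpace (𝓡 (n + r)) (𝒢.inv g) →ₗ[ℝ] TangentSpace (𝓡 (n + r)) g :=
  LinearMap.comp (M₃ := TangentSpace (𝓡 (n + r)) g)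
    (mfderiv (𝓡 (n + r)) (𝓡 (n + r)) 𝒢.inv (𝒢.inv g)).toLinearMap LinearMap.id

/-- The graph of the linear action `g_* : D(A_x^*) ⊗ D(T_x M) → D(A_y^*) ⊗ D(T_y M)` of an arrow
`g : x → y` (so `z' = g_* z`). For a frame `w` of a vector space write `δ_w` for the density with
`δ_w(w) = 1`. The isomorphisms
`D(A_y) ⊗ D(T_x M) ≅ D(T_g G) ≅ D(T_{g⁻¹} G) ≅ D(A_x) ⊗ D(T_y M)` send `δ_{a_y} ⊗ δ_{v_x}` to
`|det_b (di(b'))| δ_{a_x} ⊗ δ_{v_y}`, where `a_x`, `a_y` are frames of `A_x`, `A_y`, where `v_x`, `v_y`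
are frames of `T_x M`, `T_y M`, and where `b`, `b'` are adapted frames of `T_g G`, `T_{g⁻¹} G`. After
moving `D(A_x)` and `D(A_y)` to the other sides, `g_*` becomes the multiplication by this number in the
frames `(a_x, v_x)` and `(a_y, v_y)`. Adapted frames `b`, `b'` exist for all frames, and the result does
not depend on any of the choices. -/
def IsActionOf (𝒢 : LieGroupoid n r M G) (g : G) (z : 𝒢.TransverseDensityFibre (𝒢.src g))
    (z' : 𝒢.TransverseDensityFibre (𝒢.tgt g)) : Prop :=
  ∀ (a : ∀ x, Module.Basis (Fin r) ℝ (𝒢.algebroid x))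
    (v : ∀ x : M, Module.Basis (Fin n) ℝ (TangentSpace (𝓡 n) x))
    (b : Module.Basis (Fin r ⊕ Fin n) ℝ (TangentSpace (𝓡 (n + r)) g))
    (b' : Module.Basis (Fin r ⊕ Fin n) ℝ (TangentSpace (𝓡 (n + r)) (𝒢.inv g))),
    𝒢.IsAdapted g (a (𝒢.tgt g)) (v (𝒢.src g)) b →
    𝒢.IsAdapted (𝒢.inv g) (a (𝒢.tgt (𝒢.inv g))) (v (𝒢.src (𝒢.inv g))) b' →
      𝒢.evalFrame (a (𝒢.tgt g)) (v (𝒢.tgt g)) z' =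
        |b.det (fun k => 𝒢.invDeriv g (b' k))| * 𝒢.evalFrame (a (𝒢.src g)) (v (𝒢.src g)) z

/-- A transverse density: a smooth section `σ` of the transverse density bundle which is invariant,
`g_* (σ (s g)) = σ (t g)` for all arrows `g`. -/
def IsTransverseDensity (𝒢 : LieGroupoid n r M G) (σ : ∀ x, 𝒢.TransverseDensityFibre x) : Prop :=
  𝒢.IsSmoothDensity σ ∧ ∀ g : G, 𝒢.IsActionOf g (σ (𝒢.src g)) (σ (𝒢.tgt g))

/-- Strict positivity of a section of the transverse density bundle: at every point it is positive in
all frames. -/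
def IsStrictlyPositive (𝒢 : LieGroupoid n r M G) (σ : ∀ x, 𝒢.TransverseDensityFibre x) : Prop :=
  ∀ x (a : Module.Basis (Fin r) ℝ (𝒢.algebroid x))
    (v : Module.Basis (Fin n) ℝ (TangentSpace (𝓡 n) x)), 0 < 𝒢.evalFrame a v (σ x)

/-! ### The modular class of the Lie algebroid -/

/-- `τ = ∇_α σ`, for the canonical representation `∇` of the Lie algebroid `A` on
`D(A^*) ⊗ D(TM) = |Λ^top A| ⊗ |Λ^top T^*M|`, given by Lie derivatives:
`∇_α (ξ ⊗ η) = L_α ξ ⊗ η + ξ ⊗ L_{ρ(α)} η`. If `(a, v)` is a smooth local frame, if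
`[α, a_j] = ∑_i B_{ij} a_i` and `[ρ(α), v_j] = ∑_i C_{ij} v_i`, and if the function `f` represents `σ`
in this frame, then `∇_α σ` is represented by `ρ(α)(f) + (tr B - tr C) f`. -/
def IsLieDerivative (𝒢 : LieGroupoid n r M G) (α : ∀ x, 𝒢.algebroid x)
    (σ τ : ∀ x, 𝒢.TransverseDensityFibre x) : Prop :=
  ∀ U : Set M, IsOpen U → ∀ a v, 𝒢.SmoothFramesOn a v U → ∀ x ∈ U,
    ∀ γ : Fin r → 𝒢.algebroid x, (∀ j, 𝒢.IsBracketAt α (fun y => a y j) x (γ j)) →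
      𝒢.evalFrame (a x) (v x) (τ x) =
        𝒢.anchorDeriv (fun y => 𝒢.evalFrame (a y) (v y) (σ y)) x (α x)
        + ((∑ j, (a x).repr (γ j) j)
            - ∑ j, (v x).repr (VectorField.mlieBracket (𝓡 n) (fun y => 𝒢.anchor y (α y))
                (fun y => v y j) x) j)
          * 𝒢.evalFrame (a x) (v x) (σ x)

/-- `c` is the modular class `mod(A) ∈ H¹(A)`, the characteristic class of the representation of `A` on
the transverse density bundle: the class of the closed `1`-form `θ` determined by
`∇_α σ = θ(α) σ` for all `α ∈ Γ(A)`, where `σ` is a nowhere vanishing section. -/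
def IsModularClass (𝒢 : LieGroupoid n r M G) (c : 𝒢.H1) : Prop :=
  ∃ σ : ∀ x, 𝒢.TransverseDensityFibre x, 𝒢.IsSmoothDensity σ ∧ (∀ x, σ x ≠ 0) ∧
    ∃ θ : 𝒢.closedForms, c = Submodule.Quotient.mk θ ∧
      ∀ α, 𝒢.SmoothSectionOn α Set.univ →
        𝒢.IsLieDerivative α σ (fun x => θ.1 x (α x) • σ x)

end

end LieGroupoid

end

/-!
Let `σ` be a nowhere vanishing smooth section of the transverse density bundle, not necessarily
invariant. The failure of invariance is measured by the function
`F(g) = log |g_* σ(src g) / σ(tgt g)|` on the groupoid, `modularCocycle` below, and the proof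
compares it with the connection form `θ` determined by `∇_α σ = θ(α) σ`.

*The differential of `F` along the units is `-θ`.* In charts of the groupoid and of the base in which
the source map is a projection and the units are straight (`AdaptedChart`), `F` has an explicit
expression in terms of the first derivatives of the product and of the target map
(`localLogCocycle`, `AdaptedChart.eventually_modularCocycle_eq`). The differential of its logarithmic
determinants at a unit is a difference of traces of second derivatives, and these are the traces of
`[α, ·]` and `[ρ(α), ·]` in the definition of `∇` (`hasFDerivAt_localLogCocycle`). Hence the form
`modularForm σ`, minus the differential of `F` along the units, satisfies the equation that
characterizes `θ` (`isLieDerivative_modularForm`); it is the only solution because every vector of `A`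
extends to a section and brackets exist (`eq_modularForm_of_isLieDerivative`).

*`F` is multiplicative near the units.* Left translation by an arrow `h` is defined on a target fibre
only, so it cannot be differentiated on the whole tangent space. A local bisection through `h` extends
it to a local diffeomorphism that is compatible with the sequences `0 → A → TG → TM → 0`, which gives
`F(h g) = F(h) + F(g)` (`LocalBisection.modularCocycle_mul`). In an adapted chart the subsets given by
a constant fibre coordinate are bisections near the units (`eventually_nonempty_localBisection`), so
multiplicativity holds for all `h` near a unit, and this is all that is needed.

*Consequences.* The derivative of `F` along the right invariant vector field of `α` at `g` is
`-θ(α)` at `tgt g` (`mfderiv_modularCocycle_rightTranslation`). As right invariant vector fields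
compute the bracket of `A`, the identity `XYF - YXF = [X, Y]F` shows that `θ` is closed
(`modularForm_closed`). If `σ` is multiplied by `exp f`, then `F` changes by `f ∘ src - f ∘ tgt` and
`θ` by the exact form of `f` (`modularForm_change`). Positive sections exist by a partition of unity
(`exists_smooth_strictlyPositive`), so the modular class exists and is unique.

*The equivalence.* A positive `σ` is invariant if and only if `F = 0`
(`isActionOf_iff_modularCocycle_eq_zero`), and `F = 0` implies `θ = 0`. Conversely, if the class
vanishes, then a positive section can be rescaled to one with `θ = 0` (`exists_rescaling`). Then the
derivative of `F` along the source fibres vanishes near the units, so `F` vanishes near the units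
(`eventually_modularCocycle_eq_zero`); by multiplicativity `F` is locally constant on the source
fibres, and these are connected and contain units (`modularCocycle_eq_zero`).
-/

noncomputable section

/-! ### Densities and determinants -/

lemma DensitySpace.eval_change {ι : Type*} [Fintype ι] [DecidableEq ι] {V : Type*} [AddCommGroup V]
    [Module ℝ V] (e f : Module.Basis ι ℝ V) (ξ : DensitySpace ι V) :
    DensitySpace.eval f ξ = |e.det f| * DensitySpace.eval e ξ :=
  ξ.2 e f

/-- The density `δ_e` which takes the value `1` on the frame `e`. -/
def DensitySpace.ofFrame {ι : Type*} [Fintype ι] [DecidableEq ι] {V : Type*} [AddCommGroup V]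
    [Module ℝ V] (e : Module.Basis ι ℝ V) : DensitySpace ι V :=
  ⟨fun f => |e.det f|, fun f g => by
    rw [← abs_mul, mul_comm, e.det_mul_det]⟩

lemma DensitySpace.eval_ofFrame {ι : Type*} [Fintype ι] [DecidableEq ι] {V : Type*}
    [AddCommGroup V] [Module ℝ V] (e f : Module.Basis ι ℝ V) :
    DensitySpace.eval f (DensitySpace.ofFrame e) = |e.det f| := rfl

lemma DensitySpace.eq_eval_smul_ofFrame {ι : Type*} [Fintype ι] [DecidableEq ι] {V : Type*}
    [AddCommGroup V] [Module ℝ V] (e : Module.Basis ι ℝ V) (ξ : DensitySpace ι V) :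
    ξ = DensitySpace.eval e ξ • DensitySpace.ofFrame e := by
  apply Subtype.ext
  funext f
  have := DensitySpace.eval_change e f ξ
  rw [mul_comm] at this
  exact this

lemma abs_det_pos {ι : Type*} [Fintype ι] [DecidableEq ι] {V : Type*} [AddCommGroup V]
    [Module ℝ V] (e f : Module.Basis ι ℝ V) : 0 < |e.det f| :=
  abs_pos.2 (e.isUnit_det f).ne_zero

/-- Passing to dual frames inverts the determinant of a change of frames. -/
lemma det_dualBasis {ι : Type*} [Fintype ι] [DecidableEq ι] {V : Type*} [AddCommGroup V]
    [Module ℝ V] (e f : Module.Basis ι ℝ V) : e.dualBasis.det f.dualBasis = f.det e := by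
  rw [Module.Basis.det_apply, Module.Basis.det_apply, ← Matrix.det_transpose]
  congr 1
  ext i j
  simp [Module.Basis.toMatrix_apply, Matrix.transpose_apply, Module.Basis.dualBasis_repr]

/-- The determinant relating two frames of `V` which are adapted to an exact sequence
`0 → A → V → T → 0`. -/
lemma det_of_adapted {ι κ : Type*} [Fintype ι] [DecidableEq ι] [Fintype κ] [DecidableEq κ]
    {A V T : Type*} [AddCommGroup A] [Module ℝ A] [AddCommGroup V] [Module ℝ V] [AddCommGroup T]
    [Module ℝ T] (R : A →ₗ[ℝ] V) (S : V →ₗ[ℝ] T) (hSR : ∀ x, S (R x) = 0)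
    {a a' : Module.Basis ι ℝ A} {v v' : Module.Basis κ ℝ T} {b b' : Module.Basis (ι ⊕ κ) ℝ V}
    (hb : ∀ i, b (Sum.inl i) = R (a i)) (hbv : ∀ j, S (b (Sum.inr j)) = v j)
    (hb' : ∀ i, b' (Sum.inl i) = R (a' i)) (hbv' : ∀ j, S (b' (Sum.inr j)) = v' j) :
    b.det b' = a.det a' * v.det v' := by
  have hS : ∀ x k, v.repr (S x) k = b.repr x (Sum.inr k) := by
    intro x k
    conv_lhs => rw [← b.sum_repr x]
    rw [Fintype.sum_sum_type]
    simp [hb, hbv, hSR, Finsupp.single_apply]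
  have hR : ∀ x i, b.repr (R x) (Sum.inl i) = a.repr x i := by
    intro x k
    conv_lhs => rw [← a.sum_repr x]
    rw [map_sum]
    simp only [map_smul, ← hb, map_sum, Module.Basis.repr_self]
    simp [Finsupp.single_apply]
  have hM : b.toMatrix b' = Matrix.fromBlocks (a.toMatrix a')
      (Matrix.of fun i j => b.repr (b' (Sum.inr j)) (Sum.inl i)) 0 (v.toMatrix v') := by
    ext i j
    rcases i with i | i <;> rcases j with j | j
    · simp [Module.Basis.toMatrix_apply, hb', hR]
    · simp [Module.Basis.toMatrix_apply]
    · simp [Module.Basis.toMatrix_apply, hb', ← hS, hSR]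
    · simp [Module.Basis.toMatrix_apply, ← hS, hbv']
  rw [Module.Basis.det_apply, hM, Matrix.det_fromBlocks_zero₂₁, Module.Basis.det_apply,
    Module.Basis.det_apply]

/-! ### The logarithmic derivative of a determinant -/

section LogDet

variable {ι : Type*} [Fintype ι] [DecidableEq ι] {V : Type*} [NormedAddCommGroup V]
  [NormedSpace ℝ V] [FiniteDimensional ℝ V] {X : Type*} [NormedAddCommGroup X] [NormedSpace ℝ X]

/-- The determinant in a frame, as a continuous multilinear map. -/
def detContinuousMultilinear (e : Module.Basis ι ℝ V) :
    ContinuousMultilinearMap ℝ (fun _ : ι => V) ℝ :=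
  { e.det.toMultilinearMap with
    cont := by
      change Continuous fun v : ι → V => e.det v
      simp only [Module.Basis.det_apply]
      refine Continuous.matrix_det (continuous_matrix fun i j => ?_)
      exact (LinearMap.continuous_of_finiteDimensional (e.coord i)).comp (continuous_apply j) }

lemma contDiffAt_det (e : Module.Basis ι ℝ V) {A : X → ι → V} {x : X} {k : ℕ∞ω}
    (hA : ∀ j, ContDiffAt ℝ k (fun y => A y j) x) :
    ContDiffAt ℝ k (fun y => e.det (A y)) x :=
  (detContinuousMultilinear e).contDiff.contDiffAt.comp x (contDiffAt_pi.2 hA)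

lemma contDiffAt_log_abs_det (e : Module.Basis ι ℝ V) {A : X → ι → V} {x : X} {k : ℕ∞ω}
    (hA : ∀ j, ContDiffAt ℝ k (fun y => A y j) x) (hx : e.det (A x) ≠ 0) :
    ContDiffAt ℝ k (fun y => Real.log |e.det (A y)|) x := by
  simp only [Real.log_abs]
  exact (contDiffAt_det e hA).log hx

/-- The logarithmic derivative of the determinant of a moving frame is the trace of the derivative
of the frame, expressed in the frame itself. -/
lemma hasFDerivAt_log_abs_det (e e' : Module.Basis ι ℝ V) {A : X → ι → V} {A' : ι → X →L[ℝ] V}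
    {x : X} (hA : ∀ j, HasFDerivAt (fun y => A y j) (A' j) x) (he' : ∀ j, A x j = e' j) :
    HasFDerivAt (fun y => Real.log |e.det (A y)|)
      (∑ j, (LinearMap.toContinuousLinearMap (e'.coord j)) ∘L A' j) x := by
  simp only [Real.log_abs]
  have h1 := HasFDerivAt.multilinear_comp (detContinuousMultilinear e) hA
  have hAx : A x = e' := funext he'
  have hne : e.det e' ≠ 0 := (e.isUnit_det e').ne_zero
  have h2 := h1.log (by change e.det (A x) ≠ 0; rwa [hAx])
  refine h2.congr_fderiv ?_
  ext h
  have key : ∀ j, e.det (Function.update e' j (A' j h)) = e.det e' * e'.repr (A' j h) j := by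
    intro j
    have := e.det_smul_mk_coord_eq_det_update e'.linearIndependent e'.span_eq.ge j
    have := LinearMap.congr_fun this (A' j h)
    simp only [LinearMap.smul_apply, smul_eq_mul, MultilinearMap.toLinearMap_apply] at this
    rw [AlternatingMap.coe_multilinearMap] at this
    rw [← this]
    congr 2
    have : Module.Basis.mk e'.linearIndependent e'.span_eq.ge = e' := by
      ext; simp
    rw [this]; rfl
  simp only [smul_apply, sum_apply,
    ContinuousLinearMap.comp_apply]
  change (e.det (A x))⁻¹ • ∑ i, e.det (Function.update (A x) i (A' i h)) = _
  rw [hAx]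
  simp only [key, ← Finset.mul_sum, smul_eq_mul]
  rw [inv_mul_cancel_left₀ hne]
  rfl

end LogDet

/-! ### The modular cocycle in coordinates -/

lemma trace_eq_sum_repr {ι V : Type*} [Fintype ι] [AddCommGroup V] [Module ℝ V]
    (b : Module.Basis ι ℝ V) (f : V →ₗ[ℝ] V) :
    LinearMap.trace ℝ V f = ∑ j, b.repr (f (b j)) j := by
  classical
  rw [LinearMap.trace_eq_matrix_trace ℝ b, Matrix.trace]
  simp [LinearMap.toMatrix_apply]

lemma two_le_infty : (2 : ℕ∞ω) ≤ ∞ := WithTop.coe_le_coe.2 le_top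

lemma ContDiffAt.hasFDerivAt_fderiv {E E' : Type*} [NormedAddCommGroup E] [NormedSpace ℝ E]
    [NormedAddCommGroup E'] [NormedSpace ℝ E'] {f : E → E'} {x : E} (h : ContDiffAt ℝ ∞ f x) :
    HasFDerivAt f (fderiv ℝ f x) x :=
  (h.differentiableAt (by simp)).hasFDerivAt

section LocalCocycle

variable {ι κ : Type*} [Fintype ι] [DecidableEq ι] [Fintype κ] [DecidableEq κ]
  {V W : Type*} [NormedAddCommGroup V] [NormedSpace ℝ V] [FiniteDimensional ℝ V]
  [NormedAddCommGroup W] [NormedSpace ℝ W] [FiniteDimensional ℝ W]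

/-- In coordinates `(u, y)` in which the source map is `(u, y) ↦ y` and the units are the points
`(0, y)`, let `T` be the target map and let `(m (w, u, y), y)` be the product of `(w, T (u, y))` and
`(u, y)`. For frames `a` of the algebroid and `v` of the base, this is the logarithm of the factor by
which the arrow `(u, y)` acts on transverse densities in these frames. -/
def localLogCocycle (e : Module.Basis ι ℝ V) (e' : Module.Basis κ ℝ W) (m : V × V × W → V)
    (T : V × W → W) (a : W → ι → V) (v : W → κ → W) (z : V × W) : ℝ :=
  Real.log |e.det fun i => fderiv ℝ m (z.1, 0, z.2) (0, a z.2 i, 0)|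
    + Real.log |e'.det fun j => v (T z) j|
    - Real.log |e'.det fun j => fderiv ℝ T z (0, e' j)|
    - Real.log |e.det fun i => fderiv ℝ m (0, z.1, z.2) (a (T z) i, 0, 0)|
    - Real.log |e'.det fun j => v z.2 j|

/-- The local form of the right invariant vector field determined by a section `α` of the
algebroid. -/
def localRightInvariant (m : V × V × W → V) (T : V × W → W) (α : W → V) (z : V × W) : V × W :=
  (fderiv ℝ m (0, z.1, z.2) (α (T z), 0, 0), 0)

/-- The local form of the image of a section `α` of the algebroid under the anchor. -/
def localAnchor (T : V × W → W) (α : W → V) (y : W) : W :=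
  fderiv ℝ T (0, y) (α y, 0)

variable {m : V × V × W → V} {T : V × W → W} {y₀ : W}

omit [FiniteDimensional ℝ V] [FiniteDimensional ℝ W] in
lemma contDiffAt_fderiv_one {c : V × W → V} (hm : ContDiffAt ℝ ∞ m (0, 0, y₀))
    (hc : ContDiffAt ℝ ∞ c (0, y₀)) :
    ContDiffAt ℝ ∞ (fun z : V × W => fderiv ℝ m (0, z.1, z.2) (c z, 0, 0)) (0, y₀) := by
  have h1 : ContDiffAt ℝ ∞ (fderiv ℝ m) (0, 0, y₀) := hm.fderiv_right (by simp)
  have h2 : ContDiffAt ℝ ∞ (fun z : V × W => fderiv ℝ m ((0 : V), z.1, z.2)) (0, y₀) :=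
    h1.comp (0, y₀) (f := fun z : V × W => ((0 : V), z.1, z.2)) (by fun_prop)
  exact h2.clm_apply (by fun_prop)

omit [FiniteDimensional ℝ V] [FiniteDimensional ℝ W] in
lemma contDiffAt_fderiv_two {c : V × W → V} (hm : ContDiffAt ℝ ∞ m (0, 0, y₀))
    (hc : ContDiffAt ℝ ∞ c (0, y₀)) :
    ContDiffAt ℝ ∞ (fun z : V × W => fderiv ℝ m (z.1, 0, z.2) (0, c z, 0)) (0, y₀) := by
  have h1 : ContDiffAt ℝ ∞ (fderiv ℝ m) (0, 0, y₀) := hm.fderiv_right (by simp)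
  have h2 : ContDiffAt ℝ ∞ (fun z : V × W => fderiv ℝ m (z.1, (0 : V), z.2)) (0, y₀) :=
    h1.comp (0, y₀) (f := fun z : V × W => (z.1, (0 : V), z.2)) (by fun_prop)
  exact h2.clm_apply (by fun_prop)

omit [FiniteDimensional ℝ V] [FiniteDimensional ℝ W] in
lemma contDiffAt_comp_target {E : Type*} [NormedAddCommGroup E] [NormedSpace ℝ E] {c : W → E}
    (hT : ContDiffAt ℝ ∞ T (0, y₀)) (hT0 : T (0, y₀) = y₀) (hc : ContDiffAt ℝ ∞ c y₀) :
    ContDiffAt ℝ ∞ (fun z => c (T z)) (0, y₀) :=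
  ContDiffAt.comp (0, y₀) (by rwa [hT0]) hT

omit [FiniteDimensional ℝ V] [FiniteDimensional ℝ W] in
lemma hasFDerivAt_fderiv_one {c : V × W → V} {c' : V × W →L[ℝ] V}
    (hm : ContDiffAt ℝ ∞ m (0, 0, y₀)) (hc : HasFDerivAt c c' (0, y₀)) :
    HasFDerivAt (fun z : V × W => fderiv ℝ m (0, z.1, z.2) (c z, 0, 0))
      ((ContinuousLinearMap.apply ℝ V (c (0, y₀), (0 : V), (0 : W))) ∘L
          (fderiv ℝ (fderiv ℝ m) (0, 0, y₀)) ∘L (ContinuousLinearMap.inr ℝ V (V × W))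
        + fderiv ℝ m (0, 0, y₀) ∘L (ContinuousLinearMap.inl ℝ V (V × W)) ∘L c') (0, y₀) := by
  have h1 : HasFDerivAt (fderiv ℝ m) _ (0, 0, y₀) :=
    (hm.fderiv_right (m := ∞) (by simp)).hasFDerivAt_fderiv
  have h2 := h1.comp (0, y₀) (ContinuousLinearMap.inr ℝ V (V × W)).hasFDerivAt
  have h3 := (ContinuousLinearMap.inl ℝ V (V × W)).hasFDerivAt.comp (0, y₀) hc
  refine (h2.clm_apply h3).congr_fderiv ?_
  ext h <;> simp [add_comm] <;> rfl

omit [FiniteDimensional ℝ V] [FiniteDimensional ℝ W] in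
lemma hasFDerivAt_fderiv_two {c : V × W → V} {c' : V × W →L[ℝ] V}
    (hm : ContDiffAt ℝ ∞ m (0, 0, y₀)) (hc : HasFDerivAt c c' (0, y₀)) :
    HasFDerivAt (fun z : V × W => fderiv ℝ m (z.1, 0, z.2) (0, c z, 0))
      ((ContinuousLinearMap.apply ℝ V ((0 : V), c (0, y₀), (0 : W))) ∘L
          (fderiv ℝ (fderiv ℝ m) (0, 0, y₀)) ∘L
            ((ContinuousLinearMap.fst ℝ V W).prod ((ContinuousLinearMap.inr ℝ V W) ∘L
              (ContinuousLinearMap.snd ℝ V W)))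
        + fderiv ℝ m (0, 0, y₀) ∘L (ContinuousLinearMap.inr ℝ V (V × W)) ∘L
            (ContinuousLinearMap.inl ℝ V W) ∘L c') (0, y₀) := by
  have h1 : HasFDerivAt (fderiv ℝ m) _ (0, 0, y₀) :=
    (hm.fderiv_right (m := ∞) (by simp)).hasFDerivAt_fderiv
  have h2 := HasFDerivAt.comp (0, y₀) (f := fun z : V × W => (z.1, (0 : V), z.2)) h1 ((ContinuousLinearMap.fst ℝ V W).prod
    ((ContinuousLinearMap.inr ℝ V W) ∘L (ContinuousLinearMap.snd ℝ V W))).hasFDerivAt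
  have h3 := ((ContinuousLinearMap.inr ℝ V (V × W)) ∘L
    (ContinuousLinearMap.inl ℝ V W)).hasFDerivAt.comp (0, y₀) hc
  refine (h2.clm_apply h3).congr_fderiv ?_
  ext h <;> simp [add_comm]

omit [FiniteDimensional ℝ V] [FiniteDimensional ℝ W] in
lemma hasFDerivAt_comp_target {E : Type*} [NormedAddCommGroup E] [NormedSpace ℝ E] {c : W → E}
    {c' : W →L[ℝ] E} (hT : ContDiffAt ℝ ∞ T (0, y₀)) (hT0 : T (0, y₀) = y₀)
    (hc : HasFDerivAt c c' y₀) :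
    HasFDerivAt (fun z => c (T z)) (c' ∘L fderiv ℝ T (0, y₀)) (0, y₀) :=
  HasFDerivAt.comp (0, y₀) (by rwa [hT0]) hT.hasFDerivAt_fderiv

omit [FiniteDimensional ℝ V] [FiniteDimensional ℝ W] in
/-- At a unit, the bracket of right invariant vector fields is computed from the second derivative of
the product and the derivatives of the sections along their anchors. -/
lemma lieBracket_localRightInvariant {α β : W → V}
    (hm : ContDiffAt ℝ ∞ m (0, 0, y₀)) (hT : ContDiffAt ℝ ∞ T (0, y₀)) (hT0 : T (0, y₀) = y₀)
    (hm1 : ∀ w, fderiv ℝ m (0, 0, y₀) (w, 0, 0) = w)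
    (hα : ContDiffAt ℝ ∞ α y₀) (hβ : ContDiffAt ℝ ∞ β y₀) :
    VectorField.lieBracket ℝ (localRightInvariant m T α) (localRightInvariant m T β) (0, y₀) =
      (fderiv ℝ (fderiv ℝ m) (0, 0, y₀) (0, α y₀, 0) (β y₀, 0, 0)
        - fderiv ℝ (fderiv ℝ m) (0, 0, y₀) (0, β y₀, 0) (α y₀, 0, 0)
        + fderiv ℝ β y₀ (fderiv ℝ T (0, y₀) (α y₀, 0))
        - fderiv ℝ α y₀ (fderiv ℝ T (0, y₀) (β y₀, 0)), 0) := by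
  have key : ∀ {γ : W → V}, ContDiffAt ℝ ∞ γ y₀ →
      HasFDerivAt (localRightInvariant m T γ) _ (0, y₀) := fun hγ =>
    (ContinuousLinearMap.inl ℝ V W).hasFDerivAt.comp (0, y₀)
      (hasFDerivAt_fderiv_one hm (hasFDerivAt_comp_target hT hT0 hγ.hasFDerivAt_fderiv))
  rw [VectorField.lieBracket, (key hα).fderiv, (key hβ).fderiv]
  ext
  · have hm1' : ∀ w, fderiv ℝ m (0, 0, y₀) (w, (0 : V × W)) = w := hm1
    simp [localRightInvariant, hT0, hm1, hm1']
    abel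
  · simp

omit [FiniteDimensional ℝ V] [FiniteDimensional ℝ W] in
lemma hasFDerivAt_localAnchor {α : W → V} (hT : ContDiffAt ℝ ∞ T (0, y₀))
    (hα : ContDiffAt ℝ ∞ α y₀) :
    HasFDerivAt (localAnchor T α)
      ((ContinuousLinearMap.apply ℝ W (α y₀, (0 : W))) ∘L (fderiv ℝ (fderiv ℝ T) (0, y₀)) ∘L
          (ContinuousLinearMap.inr ℝ V W)
        + fderiv ℝ T (0, y₀) ∘L (ContinuousLinearMap.inl ℝ V W) ∘L fderiv ℝ α y₀) y₀ := by
  have h1 : HasFDerivAt (fderiv ℝ T) _ (0, y₀) :=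
    (hT.fderiv_right (m := ∞) (by simp)).hasFDerivAt_fderiv
  have h2 := HasFDerivAt.comp y₀ (f := fun y : W => ((0 : V), y)) h1
    (ContinuousLinearMap.inr ℝ V W).hasFDerivAt
  have h3 := (ContinuousLinearMap.inl ℝ V W).hasFDerivAt.comp y₀ hα.hasFDerivAt_fderiv
  refine (h2.clm_apply h3).congr_fderiv ?_
  ext h; simp [add_comm]

omit [FiniteDimensional ℝ V] [FiniteDimensional ℝ W] in
lemma lieBracket_localAnchor {α : W → V} {v : W → W} (hT : ContDiffAt ℝ ∞ T (0, y₀))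
    (hα : ContDiffAt ℝ ∞ α y₀) :
    VectorField.lieBracket ℝ (localAnchor T α) v y₀ =
      fderiv ℝ v y₀ (fderiv ℝ T (0, y₀) (α y₀, 0))
        - fderiv ℝ (fderiv ℝ T) (0, y₀) (0, v y₀) (α y₀, 0)
        - fderiv ℝ T (0, y₀) (fderiv ℝ α y₀ (v y₀), 0) := by
  rw [VectorField.lieBracket, (hasFDerivAt_localAnchor hT hα).fderiv]
  simp [localAnchor, sub_sub]

lemma contDiffAt_localLogCocycle {e ea : Module.Basis ι ℝ V} {e' ev : Module.Basis κ ℝ W}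
    {a : W → ι → V} {v : W → κ → W} (hm : ContDiffAt ℝ ∞ m (0, 0, y₀))
    (hT : ContDiffAt ℝ ∞ T (0, y₀)) (hT0 : T (0, y₀) = y₀)
    (hm1 : ∀ w, fderiv ℝ m (0, 0, y₀) (w, 0, 0) = w)
    (hm2 : ∀ w, fderiv ℝ m (0, 0, y₀) (0, w, 0) = w) (hT1 : ∀ η, fderiv ℝ T (0, y₀) (0, η) = η)
    (ha : ∀ i, ContDiffAt ℝ ∞ (fun y => a y i) y₀) (hv : ∀ j, ContDiffAt ℝ ∞ (fun y => v y j) y₀)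
    (ha0 : ∀ i, a y₀ i = ea i) (hv0 : ∀ j, v y₀ j = ev j) :
    ContDiffAt ℝ ∞ (localLogCocycle e e' m T a v) (0, y₀) := by
  have hne : e.det (fun i => ea i) ≠ 0 := (e.isUnit_det ea).ne_zero
  have hne' : e'.det (fun i => ev i) ≠ 0 := (e'.isUnit_det ev).ne_zero
  have hT' : ContDiffAt ℝ ∞ (fderiv ℝ T) (0, y₀) := hT.fderiv_right (by simp)
  have hsnd : ContDiffAt ℝ ∞ (fun z : V × W => z.2) (0, y₀) := contDiffAt_snd
  refine ((((?_ : ContDiffAt ℝ ∞ _ _).add ?_).sub ?_).sub ?_).sub ?_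
  · exact contDiffAt_log_abs_det e
      (fun i => contDiffAt_fderiv_two hm (ContDiffAt.comp (0, y₀) (g := fun y => a y i) (ha i) hsnd))
      (by simpa only [hm2, ha0] using hne)
  · exact contDiffAt_log_abs_det e' (fun j => contDiffAt_comp_target hT hT0 (hv j))
      (by simpa only [hT0, hv0] using hne')
  · exact contDiffAt_log_abs_det e' (fun j => hT'.clm_apply contDiffAt_const)
      (by simp only [hT1]; exact (e'.isUnit_det e').ne_zero)
  · exact contDiffAt_log_abs_det e
      (fun i => contDiffAt_fderiv_one hm (contDiffAt_comp_target hT hT0 (ha i)))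
      (by simpa only [hm1, hT0, ha0] using hne)
  · exact contDiffAt_log_abs_det e' (fun j => ContDiffAt.comp (0, y₀) (g := fun y => v y j) (hv j) hsnd)
      (by simpa only [hv0] using hne')

/-- The determinants in `localLogCocycle` do not vanish near the units, so that the junk value
`log 0 = 0` plays no role there. -/
lemma eventually_det_ne_zero {e ea : Module.Basis ι ℝ V} {e' ev : Module.Basis κ ℝ W}
    {a : W → ι → V} {v : W → κ → W} (hm : ContDiffAt ℝ ∞ m (0, 0, y₀))
    (hT : ContDiffAt ℝ ∞ T (0, y₀)) (hT0 : T (0, y₀) = y₀)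
    (hm1 : ∀ w, fderiv ℝ m (0, 0, y₀) (w, 0, 0) = w)
    (hm2 : ∀ w, fderiv ℝ m (0, 0, y₀) (0, w, 0) = w) (hT1 : ∀ η, fderiv ℝ T (0, y₀) (0, η) = η)
    (ha : ∀ i, ContDiffAt ℝ ∞ (fun y => a y i) y₀) (hv : ∀ j, ContDiffAt ℝ ∞ (fun y => v y j) y₀)
    (ha0 : ∀ i, a y₀ i = ea i) (hv0 : ∀ j, v y₀ j = ev j) :
    ∀ᶠ z : V × W in nhds (0, y₀),
      e.det (fun i => fderiv ℝ m (z.1, 0, z.2) (0, a z.2 i, 0)) ≠ 0 ∧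
      e'.det (fun j => v (T z) j) ≠ 0 ∧
      e'.det (fun j => fderiv ℝ T z (0, e' j)) ≠ 0 ∧
      e.det (fun i => fderiv ℝ m (0, z.1, z.2) (a (T z) i, 0, 0)) ≠ 0 ∧
      e'.det (fun j => v z.2 j) ≠ 0 := by
  have hne : e.det (fun i => ea i) ≠ 0 := (e.isUnit_det ea).ne_zero
  have hne' : e'.det (fun i => ev i) ≠ 0 := (e'.isUnit_det ev).ne_zero
  have hT' : ContDiffAt ℝ ∞ (fderiv ℝ T) (0, y₀) := hT.fderiv_right (by simp)
  have hsnd : ContDiffAt ℝ ∞ (fun z : V × W => z.2) (0, y₀) := contDiffAt_snd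
  have key : ∀ {f : V × W → ℝ}, ContDiffAt ℝ ∞ f (0, y₀) → f (0, y₀) ≠ 0 →
      ∀ᶠ z in nhds (0, y₀), f z ≠ 0 := fun hf h0 => hf.continuousAt.eventually_ne h0
  refine (key (contDiffAt_det e fun i => contDiffAt_fderiv_two hm
      (ContDiffAt.comp (0, y₀) (g := fun y => a y i) (ha i) hsnd))
      (by simpa only [Function.comp_apply, hm2, ha0] using hne)).and <|
    (key (contDiffAt_det e' fun j => contDiffAt_comp_target hT hT0 (hv j))
      (by simpa only [hT0, hv0] using hne')).and <|
    (key (contDiffAt_det e' fun j => hT'.clm_apply contDiffAt_const)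
      (by simp only [hT1]; exact (e'.isUnit_det e').ne_zero)).and <|
    (key (contDiffAt_det e fun i => contDiffAt_fderiv_one hm
      (contDiffAt_comp_target hT hT0 (ha i)))
      (by simpa only [hm1, hT0, ha0] using hne)).and <|
    key (contDiffAt_det e' fun j =>
      ContDiffAt.comp (0, y₀) (g := fun y => v y j) (hv j) hsnd)
      (by simpa only [Function.comp_apply, hv0] using hne')

omit [FiniteDimensional ℝ V] [FiniteDimensional ℝ W] in
lemma localLogCocycle_unit {e : Module.Basis ι ℝ V} {e' : Module.Basis κ ℝ W}
    {a : W → ι → V} {v : W → κ → W} (hT0 : T (0, y₀) = y₀)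
    (hm1 : ∀ w, fderiv ℝ m (0, 0, y₀) (w, 0, 0) = w)
    (hm2 : ∀ w, fderiv ℝ m (0, 0, y₀) (0, w, 0) = w) (hT1 : ∀ η, fderiv ℝ T (0, y₀) (0, η) = η) :
    localLogCocycle e e' m T a v (0, y₀) = 0 := by
  have : e'.det (fun j => e' j) = 1 := e'.det_self
  simp [localLogCocycle, hT0, hm1, hm2, hT1, this]

/-- The derivative of the modular cocycle at a unit, in the direction of a section `α` of the
algebroid, is `tr C - tr B`, where `B` and `C` are the matrices of `[α, ·]` and `[ρ(α), ·]` in the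
given frames. Both sides reduce to traces of the second derivatives of the product and of the target
map, which are symmetric. -/
lemma hasFDerivAt_localLogCocycle {e ea : Module.Basis ι ℝ V} {e' ev : Module.Basis κ ℝ W}
    {a : W → ι → V} {v : W → κ → W} {α : W → V} (hm : ContDiffAt ℝ ∞ m (0, 0, y₀))
    (hT : ContDiffAt ℝ ∞ T (0, y₀)) (hT0 : T (0, y₀) = y₀)
    (hm1 : ∀ w, fderiv ℝ m (0, 0, y₀) (w, 0, 0) = w)
    (hm2 : ∀ w, fderiv ℝ m (0, 0, y₀) (0, w, 0) = w) (hT1 : ∀ η, fderiv ℝ T (0, y₀) (0, η) = η)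
    (ha : ∀ i, ContDiffAt ℝ ∞ (fun y => a y i) y₀) (hv : ∀ j, ContDiffAt ℝ ∞ (fun y => v y j) y₀)
    (hα : ContDiffAt ℝ ∞ α y₀)
    (ha0 : ∀ i, a y₀ i = ea i) (hv0 : ∀ j, v y₀ j = ev j) :
    fderiv ℝ (localLogCocycle e e' m T a v) (0, y₀) (α y₀, 0) =
      ∑ j, ev.repr (VectorField.lieBracket ℝ (localAnchor T α) (fun y => v y j) y₀) j
      - ∑ i, ea.repr (VectorField.lieBracket ℝ (localRightInvariant m T α)
          (localRightInvariant m T fun y => a y i) (0, y₀)).1 i := by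
  have hT' : HasFDerivAt (fderiv ℝ T) (fderiv ℝ (fderiv ℝ T) (0, y₀)) (0, y₀) :=
    (hT.fderiv_right (m := ∞) (by simp)).hasFDerivAt_fderiv
  have symm_m : ∀ x y, fderiv ℝ (fderiv ℝ m) (0, 0, y₀) x y =
      fderiv ℝ (fderiv ℝ m) (0, 0, y₀) y x := fun x y =>
    (hm.isSymmSndFDerivAt (by simpa using two_le_infty)) x y
  have symm_T : ∀ x y, fderiv ℝ (fderiv ℝ T) (0, y₀) x y =
      fderiv ℝ (fderiv ℝ T) (0, y₀) y x := fun x y =>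
    (hT.isSymmSndFDerivAt (by simpa using two_le_infty)) x y
  have hm1' : ∀ w, fderiv ℝ m (0, 0, y₀) (w, (0 : V × W)) = w := hm1
  have h1 := hasFDerivAt_log_abs_det e ea
    (fun i => hasFDerivAt_fderiv_two hm (((ha i).hasFDerivAt_fderiv).comp (0, y₀)
      (hasFDerivAt_snd (𝕜 := ℝ) (E := V) (F := W)))) (fun i => by simp [hm2, ha0])
  have h2 := hasFDerivAt_log_abs_det e' ev
    (fun j => hasFDerivAt_comp_target hT hT0 (hv j).hasFDerivAt_fderiv)
    (fun j => by simp [hT0, hv0])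
  have h3 := hasFDerivAt_log_abs_det e' e'
    (fun j => hT'.clm_apply (hasFDerivAt_const ((0 : V), e' j) _)) (fun j => by simp [hT1])
  have h4 := hasFDerivAt_log_abs_det e ea
    (fun i => hasFDerivAt_fderiv_one hm (hasFDerivAt_comp_target hT hT0 (ha i).hasFDerivAt_fderiv))
    (fun i => by simp only [hT0, ha0]; exact hm1 _)
  have h5 := hasFDerivAt_log_abs_det e' ev
    (fun j => ((hv j).hasFDerivAt_fderiv).comp (0, y₀)
      (hasFDerivAt_snd (𝕜 := ℝ) (E := V) (F := W))) (fun j => by simp [hv0])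
  have hΦ := congrArg (fun L => L (α y₀, (0 : W))) ((((h1.add h2).sub h3).sub h4).sub h5).fderiv
  have hX := fun i => lieBracket_localRightInvariant hm hT hT0 hm1 hα (ha i)
  have hY := fun j => lieBracket_localAnchor (v := fun y => v y j) hT hα
  change fderiv ℝ (localLogCocycle e e' m T a v) (0, y₀) (α y₀, 0) = _ at hΦ
  rw [hΦ]
  simp only [hX, hY]
  -- the two traces of `Dα ∘ ρ` and `ρ ∘ Dα` agree
  have htr := LinearMap.trace_comp_comm' (R := ℝ) (fderiv ℝ α y₀).toLinearMap
    ((fderiv ℝ T (0, y₀)).toLinearMap ∘ₗ LinearMap.inl ℝ V W)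
  rw [trace_eq_sum_repr ea, trace_eq_sum_repr ev] at htr
  -- the trace of a second derivative of `T` does not depend on the frame
  have htr2 : ∑ j, e'.repr (fderiv ℝ (fderiv ℝ T) (0, y₀) (α y₀, 0) (0, e' j)) j =
      ∑ j, ev.repr (fderiv ℝ (fderiv ℝ T) (0, y₀) (0, ev j) (α y₀, 0)) j := by
    have h := trace_eq_sum_repr e' ((fderiv ℝ (fderiv ℝ T) (0, y₀) (α y₀, 0)).toLinearMap ∘ₗ
      LinearMap.inr ℝ V W)
    rw [trace_eq_sum_repr ev] at h
    simp only [LinearMap.comp_apply, LinearMap.inr_apply, ContinuousLinearMap.coe_coe] at h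
    rw [← h]
    simp only [symm_T (0, _)]
  have hsm : ∀ i, fderiv ℝ (fderiv ℝ m) (0, 0, y₀) (0, ea i, 0) (α y₀, 0, 0) =
      fderiv ℝ (fderiv ℝ m) (0, 0, y₀) (α y₀, 0, 0) (0, ea i, 0) := fun i => symm_m _ _
  simp only [LinearMap.comp_apply, LinearMap.inl_apply, ContinuousLinearMap.coe_coe] at htr
  simp only [ha0, hv0, hsm]
  simp [hm1', hm2, hT0, ha0, Finset.sum_add_distrib, Finset.sum_sub_distrib, htr, htr2]
  ring

end LocalCocycle

/-! ### Smooth charts with values in a vector space -/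

section SmoothChart

variable {E F F' : Type*} [NormedAddCommGroup E] [NormedSpace ℝ E]
  [NormedAddCommGroup F] [NormedSpace ℝ F] [NormedAddCommGroup F'] [NormedSpace ℝ F']
  {N : Type*} [TopologicalSpace N] [ChartedSpace E N]

/-- A partial homeomorphism from a manifold to a vector space is a smooth chart if it and its
inverse are smooth. The vector space need not be the model space of the manifold. -/
def IsSmoothChart (φ : OpenPartialHomeomorph N F) : Prop :=
  ContMDiffOn 𝓘(ℝ, E) 𝓘(ℝ, F) ∞ φ φ.source ∧ ContMDiffOn 𝓘(ℝ, F) 𝓘(ℝ, E) ∞ φ.symm φ.target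

variable {φ : OpenPartialHomeomorph N F}

lemma IsSmoothChart.contMDiffAt (hφ : IsSmoothChart (E := E) φ) {g : N} (hg : g ∈ φ.source) :
    ContMDiffAt 𝓘(ℝ, E) 𝓘(ℝ, F) ∞ φ g :=
  hφ.1.contMDiffAt (φ.open_source.mem_nhds hg)

lemma IsSmoothChart.contMDiffAt_symm (hφ : IsSmoothChart (E := E) φ) {y : F} (hy : y ∈ φ.target) :
    ContMDiffAt 𝓘(ℝ, F) 𝓘(ℝ, E) ∞ φ.symm y :=
  hφ.2.contMDiffAt (φ.open_target.mem_nhds hy)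

lemma IsSmoothChart.mdifferentiable (hφ : IsSmoothChart (E := E) φ) :
    φ.MDifferentiable 𝓘(ℝ, E) 𝓘(ℝ, F) :=
  ⟨hφ.1.mdifferentiableOn (by simp), hφ.2.mdifferentiableOn (by simp)⟩

lemma IsSmoothChart.restr (hφ : IsSmoothChart (E := E) φ) {s : Set N} (hs : IsOpen s) :
    IsSmoothChart (E := E) (φ.restrOpen s hs) :=
  ⟨hφ.1.mono (by simp), hφ.2.mono fun y hy => hy.1⟩

lemma IsSmoothChart.trans (hφ : IsSmoothChart (E := E) φ) {ψ : OpenPartialHomeomorph F F'}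
    (hψ : IsSmoothChart (E := F) ψ) : IsSmoothChart (E := E) (φ.trans ψ) := by
  refine ⟨hψ.1.comp (hφ.1.mono fun x hx => ?_) fun x hx => ?_,
    hφ.2.comp (hψ.2.mono fun x hx => ?_) fun x hx => ?_⟩
  · simpa using ((φ.trans_source ψ) ▸ hx).1
  · exact ((φ.trans_source ψ) ▸ hx).2
  · exact ((φ.trans_target ψ) ▸ hx).1
  · exact ((φ.trans_target ψ) ▸ hx).2

lemma isSmoothChart_of_mem_maximalAtlas {φ : OpenPartialHomeomorph N E}
    (h : φ ∈ IsManifold.maximalAtlas 𝓘(ℝ, E) ∞ N) : IsSmoothChart (E := E) φ :=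
  ⟨contMDiffOn_of_mem_maximalAtlas h, contMDiffOn_symm_of_mem_maximalAtlas h⟩

lemma isSmoothChart_of_contDiffOn {ψ : OpenPartialHomeomorph F F'}
    (h : ContDiffOn ℝ ∞ ψ ψ.source) (h' : ContDiffOn ℝ ∞ ψ.symm ψ.target) :
    IsSmoothChart (E := F) ψ :=
  ⟨h.contMDiffOn, h'.contMDiffOn⟩

end SmoothChart

namespace LieGroupoid

variable {n r : ℕ} {M G : Type*}
  [TopologicalSpace M] [ChartedSpace (EuclideanSpace ℝ (Fin n)) M] [IsManifold (𝓡 n) ∞ M]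
  [TopologicalSpace G] [ChartedSpace (EuclideanSpace ℝ (Fin (n + r))) G]
  [IsManifold (𝓡 (n + r)) ∞ G]

/-! ### Charts adapted to the units and to the source map -/

lemma contMDiff_src (𝒢 : LieGroupoid n r M G) : ContMDiff (𝓡 (n + r)) (𝓡 n) ∞ 𝒢.src :=
  𝒢.src_submersion.contMDiff

/-- In suitable charts around `g` and `src g`, the source map is the projection
`(u, y) ↦ y`. -/
lemma exists_submersion_chart (𝒢 : LieGroupoid n r M G) (g : G) :
    ∃ (p : OpenPartialHomeomorph G (EuclideanSpace ℝ (Fin r) × EuclideanSpace ℝ (Fin n)))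
      (q : OpenPartialHomeomorph M (EuclideanSpace ℝ (Fin n))),
      IsSmoothChart (E := EuclideanSpace ℝ (Fin (n + r))) p ∧
      IsSmoothChart (E := EuclideanSpace ℝ (Fin n)) q ∧ g ∈ p.source ∧
      ∀ h ∈ p.source, 𝒢.src h ∈ q.source ∧ (p h).2 = q (𝒢.src h) := by
  have H := 𝒢.src_submersion.isSubmersionAt g
  have hfin : FiniteDimensional ℝ H.complement :=
    FiniteDimensional.of_surjective
      (LinearMap.snd ℝ (EuclideanSpace ℝ (Fin n)) H.complement ∘ₗ H.equiv.toLinearMap)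
      (Prod.snd_surjective.comp H.equiv.surjective)
  have hdim : Module.finrank ℝ H.complement = Module.finrank ℝ (EuclideanSpace ℝ (Fin r)) := by
    have := H.equiv.toLinearEquiv.finrank_eq
    rw [Module.finrank_prod] at this
    simp only [finrank_euclideanSpace, Fintype.card_fin] at this ⊢
    omega
  let A : EuclideanSpace ℝ (Fin (n + r)) ≃L[ℝ]
      EuclideanSpace ℝ (Fin r) × EuclideanSpace ℝ (Fin n) :=
    (H.equiv.trans ((ContinuousLinearEquiv.refl ℝ _).prodCongr
      (ContinuousLinearEquiv.ofFinrankEq hdim))).trans (ContinuousLinearEquiv.prodComm ℝ _ _)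
  refine ⟨H.domChart.trans A.toHomeomorph.toOpenPartialHomeomorph, H.codChart,
    (isSmoothChart_of_mem_maximalAtlas H.domChart_mem_maximalAtlas).trans
      (isSmoothChart_of_contDiffOn A.contDiff.contDiffOn A.symm.contDiff.contDiffOn),
    isSmoothChart_of_mem_maximalAtlas H.codChart_mem_maximalAtlas, ?_, ?_⟩
  · simpa using H.mem_domChart_source
  · intro h hh
    have hh' : h ∈ H.domChart.source := by simpa using hh
    refine ⟨H.source_subset_preimage_source hh', ?_⟩
    have := H.writtenInCharts
      (show H.domChart h ∈ (H.domChart.extend (𝓡 (n + r))).target by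
        simpa using H.domChart.map_source hh')
    simp only [Function.comp_apply] at this
    simp [hh'] at this
    rw [this]
    rfl

/-- Charts `p` of the groupoid and `q` of the base near the unit of `x₀`, in which the source map is
`(u, y) ↦ y` and the units are the points `(0, y)`. -/
structure AdaptedChart (𝒢 : LieGroupoid n r M G) (x₀ : M) where
  /-- the chart of the groupoid -/
  p : OpenPartialHomeomorph G (EuclideanSpace ℝ (Fin r) × EuclideanSpace ℝ (Fin n))
  /-- the chart of the base -/
  q : OpenPartialHomeomorph M (EuclideanSpace ℝ (Fin n))
  smooth_p : IsSmoothChart (E := EuclideanSpace ℝ (Fin (n + r))) p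
  smooth_q : IsSmoothChart (E := EuclideanSpace ℝ (Fin n)) q
  mem : x₀ ∈ q.source
  src_mem : ∀ g ∈ p.source, 𝒢.src g ∈ q.source
  tgt_mem : ∀ g ∈ p.source, 𝒢.tgt g ∈ q.source
  snd_p : ∀ g ∈ p.source, (p g).2 = q (𝒢.src g)
  unit_mem : ∀ x ∈ q.source, 𝒢.unit x ∈ p.source
  p_unit : ∀ x ∈ q.source, p (𝒢.unit x) = (0, q x)

/-- The shear `(u, y) ↦ (u - f y, y)` over an open set. -/
def shear {E F : Type*} [NormedAddCommGroup E] [NormedAddCommGroup F] (f : F → E) {s : Set F}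
    (hs : IsOpen s) (hf : ContinuousOn f s) : OpenPartialHomeomorph (E × F) (E × F) where
  toFun z := (z.1 - f z.2, z.2)
  invFun z := (z.1 + f z.2, z.2)
  source := {z | z.2 ∈ s}
  target := {z | z.2 ∈ s}
  map_source' := fun _ h => h
  map_target' := fun _ h => h
  left_inv' := fun _ _ => by simp
  right_inv' := fun _ _ => by simp
  open_source := hs.preimage continuous_snd
  open_target := hs.preimage continuous_snd
  continuousOn_toFun := (continuousOn_fst.sub
    (hf.comp continuousOn_snd fun _ h => h)).prodMk continuousOn_snd
  continuousOn_invFun := (continuousOn_fst.add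
    (hf.comp continuousOn_snd fun _ h => h)).prodMk continuousOn_snd

/-- A chart in which the source map is a projection becomes adapted after a shear that straightens the
units, and after shrinking so that sources and targets stay in the chart of the base. -/
theorem nonempty_adaptedChart (𝒢 : LieGroupoid n r M G) (x₀ : M) :
    Nonempty (𝒢.AdaptedChart x₀) := by
  obtain ⟨p, q, hp, hq, hmem, hpq⟩ := 𝒢.exists_submersion_chart (𝒢.unit x₀)
  have hunit : IsOpen (𝒢.unit ⁻¹' p.source) := p.open_source.preimage 𝒢.contMDiff_unit.continuous
  set q₁ := q.restrOpen _ hunit with hq₁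
  have hq₁s : ∀ x, x ∈ q₁.source ↔ x ∈ q.source ∧ 𝒢.unit x ∈ p.source := fun x => by
    rw [hq₁, OpenPartialHomeomorph.restrOpen_source]; rfl
  have hq₁' : IsSmoothChart (E := EuclideanSpace ℝ (Fin n)) q₁ := hq.restr hunit
  let f : EuclideanSpace ℝ (Fin n) → EuclideanSpace ℝ (Fin r) :=
    fun y => (p (𝒢.unit (q₁.symm y))).1
  have hf : ContDiffOn ℝ ∞ f q₁.target := by
    rw [← contMDiffOn_iff_contDiffOn]
    intro y hy
    have h1 : ContMDiffAt 𝓘(ℝ, EuclideanSpace ℝ (Fin n)) (𝓡 n) ∞ q₁.symm y :=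
      hq₁'.contMDiffAt_symm hy
    have h2 := 𝒢.contMDiff_unit.contMDiffAt.comp y h1
    have h3 := (hp.contMDiffAt ((hq₁s _).1 (q₁.map_target hy)).2).comp y h2
    exact ((contMDiffAt_prod_module_iff _).1 h3).1.contMDiffWithinAt
  have hsh : IsSmoothChart (E := EuclideanSpace ℝ (Fin r) × EuclideanSpace ℝ (Fin n))
      (shear f q₁.open_target hf.continuousOn) := by
    refine isSmoothChart_of_contDiffOn ?_ ?_
    · exact (contDiffOn_fst.sub (hf.comp contDiffOn_snd fun _ h => h)).prodMk contDiffOn_snd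
    · exact (contDiffOn_fst.add (hf.comp contDiffOn_snd fun _ h => h)).prodMk contDiffOn_snd
  have hopen : IsOpen (𝒢.src ⁻¹' q₁.source ∩ 𝒢.tgt ⁻¹' q₁.source) :=
    (q₁.open_source.preimage 𝒢.contMDiff_src.continuous).inter
      (q₁.open_source.preimage 𝒢.contMDiff_tgt.continuous)
  set p₁ := (p.trans (shear f q₁.open_target hf.continuousOn)).restrOpen _ hopen with hp₁
  have hp₁s : ∀ g, g ∈ p₁.source ↔ (g ∈ p.source ∧ (p g).2 ∈ q₁.target) ∧
      (𝒢.src g ∈ q₁.source ∧ 𝒢.tgt g ∈ q₁.source) := fun g => by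
    rw [hp₁, OpenPartialHomeomorph.restrOpen_source, OpenPartialHomeomorph.trans_source]; rfl
  have hpu : ∀ x ∈ q₁.source, (p (𝒢.unit x)).2 = q x := fun x hx => by
    rw [(hpq _ ((hq₁s x).1 hx).2).2, 𝒢.src_unit]
  refine ⟨⟨p₁, q₁, (hp.trans hsh).restr hopen, hq₁', ?_, ?_, ?_, ?_, ?_, ?_⟩⟩
  · refine (hq₁s _).2 ⟨?_, hmem⟩
    have := (hpq _ hmem).1
    rwa [𝒢.src_unit] at this
  · exact fun g hg => ((hp₁s g).1 hg).2.1
  · exact fun g hg => ((hp₁s g).1 hg).2.2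
  · exact fun g hg => (hpq _ ((hp₁s g).1 hg).1.1).2
  · intro x hx
    refine (hp₁s _).2 ⟨⟨((hq₁s x).1 hx).2, ?_⟩, ?_, ?_⟩
    · rw [hpu x hx]; exact q₁.map_source hx
    · rwa [𝒢.src_unit]
    · rwa [𝒢.tgt_unit]
  · intro x hx
    have h1 : q₁.symm (q x) = x := q₁.left_inv hx
    change ((p (𝒢.unit x)).1 - (p (𝒢.unit (q₁.symm (p (𝒢.unit x)).2))).1, (p (𝒢.unit x)).2) = _
    rw [hpu x hx, h1, sub_self]
    rfl

end LieGroupoid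

section SmoothChart

variable {E F : Type*} [NormedAddCommGroup E] [NormedSpace ℝ E]
  [NormedAddCommGroup F] [NormedSpace ℝ F]
  {N : Type*} [TopologicalSpace N] [ChartedSpace E N]
  {φ : OpenPartialHomeomorph N F}

/-- The Lie bracket of vector fields may be computed in any smooth chart. -/
lemma IsSmoothChart.mfderiv_mlieBracket [CompleteSpace E] [CompleteSpace F]
    [IsManifold 𝓘(ℝ, E) ∞ N]
    (hφ : IsSmoothChart (E := E) φ) {V W : ∀ g : N, TangentSpace 𝓘(ℝ, E) g} {V' W' : F → F} {g : N}
    (hg : g ∈ φ.source)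
    (hV : ∀ᶠ h in nhds g, mfderiv 𝓘(ℝ, E) 𝓘(ℝ, F) φ h (V h) = V' (φ h))
    (hW : ∀ᶠ h in nhds g, mfderiv 𝓘(ℝ, E) 𝓘(ℝ, F) φ h (W h) = W' (φ h))
    (hV' : ContDiffAt ℝ ∞ V' (φ g)) (hW' : ContDiffAt ℝ ∞ W' (φ g)) :
    mfderiv 𝓘(ℝ, E) 𝓘(ℝ, F) φ g (VectorField.mlieBracket 𝓘(ℝ, E) V W g) =
      VectorField.lieBracket ℝ V' W' (φ g) := by
  have hinv : ∀ h ∈ φ.source, (mfderiv 𝓘(ℝ, E) 𝓘(ℝ, F) φ h).IsInvertible := fun h hh =>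
    ⟨hφ.mdifferentiable.mfderiv hh, rfl⟩
  have hpull : ∀ {X : ∀ g : N, TangentSpace 𝓘(ℝ, E) g} {X' : F → F},
      (∀ᶠ h in nhds g, mfderiv 𝓘(ℝ, E) 𝓘(ℝ, F) φ h (X h) = X' (φ h)) →
      X =ᶠ[nhds g] VectorField.mpullback 𝓘(ℝ, E) 𝓘(ℝ, F) φ X' := by
    intro X X' hX
    filter_upwards [hX, φ.open_source.mem_nhds hg] with h hh hs
    have h1 : (mfderiv 𝓘(ℝ, E) 𝓘(ℝ, F) φ h).inverse (mfderiv 𝓘(ℝ, E) 𝓘(ℝ, F) φ h (X h)) = X h := by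
      obtain ⟨A, hA⟩ := hinv h hs
      rw [← hA]
      simp
    exact h1.symm.trans (congrArg (mfderiv 𝓘(ℝ, E) 𝓘(ℝ, F) φ h).inverse hh)
  have hmd : ∀ {X' : F → F}, ContDiffAt ℝ ∞ X' (φ g) →
      MDifferentiableAt 𝓘(ℝ, F) (𝓘(ℝ, F)).tangent
        (fun y => (⟨y, X' y⟩ : TangentBundle 𝓘(ℝ, F) F)) (φ g) := fun hX' =>
    (contMDiffAt_vectorSpace_iff_contDiffAt.2 hX').mdifferentiableAt (by simp)
  have h2 : minSmoothness ℝ 2 ≤ (∞ : ℕ∞ω) := by simpa using two_le_infty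
  have : IsManifold 𝓘(ℝ, E) (minSmoothness ℝ 3) N := by
    have : minSmoothness ℝ 3 ≤ (∞ : ℕ∞ω) := by
      simpa using (WithTop.coe_le_coe.2 le_top : (3 : ℕ∞ω) ≤ ∞)
    exact IsManifold.of_le this
  rw [(hpull hV).mlieBracket_vectorField_eq (hpull hW),
    ← VectorField.mpullback_mlieBracket (hmd hV') (hmd hW') (hφ.contMDiffAt hg) h2,
    VectorField.mpullback_apply]
  have h3 := congrFun (VectorField.mlieBracketWithin_eq_lieBracketWithin (𝕜 := ℝ) (V := V') (W := W')
    (s := Set.univ)) (φ g)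
  rw [VectorField.lieBracketWithin_univ] at h3
  refine Eq.trans ?_ h3
  obtain ⟨A, hA⟩ := hinv g hg
  rw [← hA]
  simp
  rfl

variable {E' H B : Type*} [NormedAddCommGroup E'] [NormedSpace ℝ E'] [TopologicalSpace H]
  {J : ModelWithCorners ℝ E' H} [TopologicalSpace B] [ChartedSpace H B]

/-- Smoothness of a family of tangent vectors may be checked in any smooth chart. -/
lemma IsSmoothChart.contMDiffAt_tangentBundle_iff [IsManifold 𝓘(ℝ, E) ∞ N]
    (hφ : IsSmoothChart (E := E) φ) {s : B → TangentBundle 𝓘(ℝ, E) N} {x : B}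
    (hs : ContMDiffAt J 𝓘(ℝ, E) ∞ (fun y => (s y).1) x) (hx : (s x).1 ∈ φ.source) :
    ContMDiffAt J (𝓘(ℝ, E)).tangent ∞ s x ↔
      ContMDiffAt J 𝓘(ℝ, F) ∞ (fun y => (mfderiv 𝓘(ℝ, E) 𝓘(ℝ, F) φ (s y).1 (s y).2 : F)) x := by
  have hev : ∀ᶠ y in nhds x, (s y).1 ∈ φ.source :=
    hs.continuousAt.eventually_mem (φ.open_source.mem_nhds hx)
  have key1 : ContMDiffAt (𝓘(ℝ, E)).tangent (𝓘(ℝ, F)).tangent ∞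
      (tangentMap 𝓘(ℝ, E) 𝓘(ℝ, F) φ) (s x) := by
    have h1 := hφ.1.contMDiffOn_tangentMapWithin (m := ∞) (by simp)
      φ.open_source.uniqueMDiffOn
    have hn : Bundle.TotalSpace.proj ⁻¹' φ.source ∈ nhds (s x) :=
      (φ.open_source.preimage (FiberBundle.continuous_proj _ _)).mem_nhds hx
    refine (h1.contMDiffAt hn).congr_of_eventuallyEq ?_
    filter_upwards [hn] with y hy
    exact (tangentMapWithin_eq_tangentMap (φ.open_source.uniqueMDiffWithinAt hy)
      ((hφ.contMDiffAt hy).mdifferentiableAt (by simp))).symm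
  constructor
  · intro h
    exact ((contMDiff_snd_tangentBundle_modelSpace F 𝓘(ℝ, F)).contMDiffAt.comp _ key1).comp x h
  · intro h
    have h1 : ContMDiffAt J (𝓘(ℝ, F)).tangent ∞ (fun y => tangentMap 𝓘(ℝ, E) 𝓘(ℝ, F) φ (s y)) x := by
      have h2 : ContMDiffAt J 𝓘(ℝ, F) ∞ (fun y => φ (s y).1) x := (hφ.contMDiffAt hx).comp x hs
      refine Bundle.contMDiffAt_totalSpace.2 ⟨h2, ?_⟩
      refine ContMDiffAt.congr_of_eventuallyEq h (Filter.Eventually.of_forall fun y => ?_)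
      simp
      rfl
    have hmem : φ (s x).1 ∈ φ.target := φ.map_source hx
    have key2 : ContMDiffAt (𝓘(ℝ, F)).tangent (𝓘(ℝ, E)).tangent ∞
        (tangentMapWithin 𝓘(ℝ, F) 𝓘(ℝ, E) φ.symm φ.target)
        (tangentMap 𝓘(ℝ, E) 𝓘(ℝ, F) φ (s x)) := by
      have h1 := hφ.2.contMDiffOn_tangentMapWithin (m := ∞) (by simp)
        φ.open_target.uniqueMDiffOn
      exact h1.contMDiffAt
        ((φ.open_target.preimage (FiberBundle.continuous_proj _ _)).mem_nhds hmem)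
    refine (key2.comp x h1).congr_of_eventuallyEq ?_
    filter_upwards [hev] with y hy
    have hu := φ.open_source.uniqueMDiffWithinAt (I := 𝓘(ℝ, E)) hy
    have hut := φ.open_target.uniqueMDiffWithinAt (I := 𝓘(ℝ, F)) (φ.map_source hy)
    have hd := (hφ.contMDiffAt hy).mdifferentiableAt (n := ∞) (by simp)
    have hd' := (hφ.contMDiffAt_symm (φ.map_source hy)).mdifferentiableAt (n := ∞) (by simp)
    have e1 := tangentMapWithin_comp_at (s y) (hd'.mdifferentiableWithinAt (s := φ.target))
      (hd.mdifferentiableWithinAt (s := φ.source)) (fun z hz => φ.map_source hz) hu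
    rw [tangentMapWithin_congr (f := φ.symm ∘ φ) (f₁ := id) (fun z hz => φ.left_inv hz) _ hy,
      tangentMapWithin_id hu, tangentMapWithin_eq_tangentMap hu hd] at e1
    exact e1

end SmoothChart

/-- The model vector space of dimension `k`. -/
abbrev Euc (k : ℕ) : Type := EuclideanSpace ℝ (Fin k)

namespace LieGroupoid

variable {n r : ℕ} {M G : Type*}
  [TopologicalSpace M] [ChartedSpace (EuclideanSpace ℝ (Fin n)) M] [IsManifold (𝓡 n) ∞ M]
  [TopologicalSpace G] [ChartedSpace (EuclideanSpace ℝ (Fin (n + r))) G]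
  [IsManifold (𝓡 (n + r)) ∞ G] (𝒢 : LieGroupoid n r M G)

/-! ### Algebra of arrows -/

lemma eq_inv_of_mul_eq_unit {g h : G} (hgh : 𝒢.src g = 𝒢.tgt h)
    (h1 : 𝒢.mul g h = 𝒢.unit (𝒢.tgt g)) : h = 𝒢.inv g := by
  calc h = 𝒢.mul (𝒢.unit (𝒢.tgt h)) h := (𝒢.unit_mul h).symm
    _ = 𝒢.mul (𝒢.mul (𝒢.inv g) g) h := by rw [𝒢.inv_mul, hgh]
    _ = 𝒢.mul (𝒢.inv g) (𝒢.mul g h) := 𝒢.mul_assoc _ _ _ (𝒢.src_inv g) hgh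
    _ = 𝒢.mul (𝒢.inv g) (𝒢.unit (𝒢.src (𝒢.inv g))) := by rw [h1, 𝒢.src_inv]
    _ = 𝒢.inv g := 𝒢.mul_unit _

lemma inv_inv (g : G) : 𝒢.inv (𝒢.inv g) = g :=
  (𝒢.eq_inv_of_mul_eq_unit (𝒢.src_inv g) (by rw [𝒢.inv_mul, 𝒢.tgt_inv])).symm

lemma mul_mul_inv_cancel {g h : G} (hgh : 𝒢.src g = 𝒢.tgt h) :
    𝒢.mul (𝒢.mul g h) (𝒢.inv h) = g := by
  rw [𝒢.mul_assoc _ _ _ hgh (𝒢.tgt_inv h).symm, 𝒢.mul_inv, ← hgh, 𝒢.mul_unit]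

lemma inv_mul_mul_cancel {g h : G} (hgh : 𝒢.src g = 𝒢.tgt h) :
    𝒢.mul (𝒢.inv g) (𝒢.mul g h) = h := by
  rw [← 𝒢.mul_assoc _ _ _ (𝒢.src_inv g) hgh, 𝒢.inv_mul, hgh, 𝒢.unit_mul]

lemma mul_inv_mul_cancel {g h : G} (hgh : 𝒢.src g = 𝒢.src h) :
    𝒢.mul (𝒢.mul g (𝒢.inv h)) h = g := by
  rw [𝒢.mul_assoc _ _ _ (by rw [hgh, 𝒢.tgt_inv]) (𝒢.src_inv h), 𝒢.inv_mul, ← hgh, 𝒢.mul_unit]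

lemma inv_mul_rev {g h : G} (hgh : 𝒢.src g = 𝒢.tgt h) :
    𝒢.inv (𝒢.mul g h) = 𝒢.mul (𝒢.inv h) (𝒢.inv g) := by
  have h1 : 𝒢.src (𝒢.inv h) = 𝒢.tgt (𝒢.inv g) := by rw [𝒢.src_inv, 𝒢.tgt_inv, hgh]
  refine (𝒢.eq_inv_of_mul_eq_unit ?_ ?_).symm
  · rw [𝒢.src_mul _ _ hgh, 𝒢.tgt_mul _ _ h1, 𝒢.tgt_inv]
  · rw [← 𝒢.mul_assoc _ _ _ (by rw [𝒢.src_mul _ _ hgh, 𝒢.tgt_inv]) h1,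
      𝒢.mul_mul_inv_cancel hgh, 𝒢.mul_inv, 𝒢.tgt_mul _ _ hgh]

/-! ### Differentiating products of arrows -/

section

variable {E H X : Type*} [NormedAddCommGroup E] [NormedSpace ℝ E] [TopologicalSpace H]
  {J : ModelWithCorners ℝ E H} [TopologicalSpace X] [ChartedSpace H X]

variable {𝒢} in
lemma contMDiffAt_mul {f k : X → G} {x : X} (hf : ContMDiffAt J (𝓡 (n + r)) ∞ f x)
    (hk : ContMDiffAt J (𝓡 (n + r)) ∞ k x) (hx : 𝒢.src (f x) = 𝒢.tgt (k x))
    (hfk : ∀ᶠ y in nhds x, 𝒢.src (f y) = 𝒢.tgt (k y)) :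
    ContMDiffAt J (𝓡 (n + r)) ∞ (fun y => 𝒢.mul (f y) (k y)) x := by
  have h := 𝒢.contMDiffOn_mul (f x, k x) hx
  exact (ContMDiffWithinAt.comp (f := fun y => (f y, k y)) x h
    ((hf.prodMk hk).contMDiffWithinAt (s := {y | 𝒢.src (f y) = 𝒢.tgt (k y)}))
    (fun y hy => hy)).contMDiffAt hfk

/-- The chain rule for a function that is only differentiable within a set. -/
lemma mfderiv_comp_mfderivWithin_apply {E₁ H₁ X₁ E₂ H₂ X₂ : Type*}
    [NormedAddCommGroup E₁] [NormedSpace ℝ E₁] [TopologicalSpace H₁] {J₁ : ModelWithCorners ℝ E₁ H₁}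
    [TopologicalSpace X₁] [ChartedSpace H₁ X₁]
    [NormedAddCommGroup E₂] [NormedSpace ℝ E₂] [TopologicalSpace H₂] {J₂ : ModelWithCorners ℝ E₂ H₂}
    [TopologicalSpace X₂] [ChartedSpace H₂ X₂] {f : X₁ → X₂} {S : Set X₁} {y : X₁}
    (hf : MDifferentiableWithinAt J₁ J₂ f S y) {c : X → X₁} {x : X}
    (hc : MDifferentiableAt J J₁ c x) (hcx : c x = y) (hS : ∀ᶠ z in nhds x, c z ∈ S) (v : E) :
    (mfderiv J J₂ (fun z => f (c z)) x v : E₂) =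
      mfderivWithin J₁ J₂ f S y (mfderiv J J₁ c x v : E₁) := by
  subst hcx
  have h1 := hf.hasMFDerivWithinAt
  have h2 := hc.hasMFDerivAt.hasMFDerivWithinAt (s := {z | c z ∈ S})
  have h3 := (h1.comp x h2 (fun z hz => hz)).hasMFDerivAt hS
  exact congrArg (fun L : E →L[ℝ] E₂ => L v) h3.mfderiv

/-- The chain rule, applied to a vector, with the image of the base point given up to an equation. The
values are compared in the model space, because the tangent spaces at `c x` and `y` are different
types. -/
lemma mfderiv_comp_apply' {E₁ H₁ X₁ E₂ H₂ X₂ : Type*}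
    [NormedAddCommGroup E₁] [NormedSpace ℝ E₁] [TopologicalSpace H₁] {J₁ : ModelWithCorners ℝ E₁ H₁}
    [TopologicalSpace X₁] [ChartedSpace H₁ X₁]
    [NormedAddCommGroup E₂] [NormedSpace ℝ E₂] [TopologicalSpace H₂] {J₂ : ModelWithCorners ℝ E₂ H₂}
    [TopologicalSpace X₂] [ChartedSpace H₂ X₂] {f : X₁ → X₂} {y : X₁}
    (hf : MDifferentiableAt J₁ J₂ f y) {c : X → X₁} {x : X}
    (hc : MDifferentiableAt J J₁ c x) (hcx : c x = y) (v : E) :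
    (mfderiv J J₂ (fun z => f (c z)) x v : E₂) =
      mfderiv J₁ J₂ f y (mfderiv J J₁ c x v : E₁) := by
  subst hcx
  have h3 := hf.hasMFDerivAt.comp x hc.hasMFDerivAt
  exact congrArg (fun L : E →L[ℝ] E₂ => L v) h3.mfderiv

lemma mfderiv_eq_of_eventuallyEq {E₁ H₁ X₁ : Type*}
    [NormedAddCommGroup E₁] [NormedSpace ℝ E₁] [TopologicalSpace H₁] {J₁ : ModelWithCorners ℝ E₁ H₁}
    [TopologicalSpace X₁] [ChartedSpace H₁ X₁] {f f' : X → X₁} {x : X} (h : ∀ᶠ z in nhds x, f z = f' z)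
    (v : E) : (mfderiv J J₁ f x v : E₁) = (mfderiv J J₁ f' x v : E₁) := by
  have : f =ᶠ[nhds x] f' := h
  exact congrArg (fun L : E →L[ℝ] E₁ => L v) this.mfderiv_eq

lemma mfderiv_add_sub_apply {A B D F : X → ℝ} {x : X} (hA : MDifferentiableAt J 𝓘(ℝ, ℝ) A x)
    (hB : MDifferentiableAt J 𝓘(ℝ, ℝ) B x) (hD : MDifferentiableAt J 𝓘(ℝ, ℝ) D x)
    (hF : ∀ᶠ z in nhds x, F z = A z + B z - D z) (v : E) {a b d : ℝ}
    (ha : (mfderiv J 𝓘(ℝ, ℝ) A x v : ℝ) = a) (hb : (mfderiv J 𝓘(ℝ, ℝ) B x v : ℝ) = b)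
    (hd : (mfderiv J 𝓘(ℝ, ℝ) D x v : ℝ) = d) :
    (mfderiv J 𝓘(ℝ, ℝ) F x v : ℝ) = a + b - d := by
  have h4 := ((hA.hasMFDerivAt.add hB.hasMFDerivAt).sub hD.hasMFDerivAt).mfderiv
  rw [mfderiv_eq_of_eventuallyEq hF, ← ha, ← hb, ← hd]
  exact congrArg (fun L : E →L[ℝ] ℝ => L v) h4

lemma mfderiv_eq_zero_of_eventually_const {E₁ H₁ X₁ : Type*}
    [NormedAddCommGroup E₁] [NormedSpace ℝ E₁] [TopologicalSpace H₁] {J₁ : ModelWithCorners ℝ E₁ H₁}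
    [TopologicalSpace X₁] [ChartedSpace H₁ X₁] {f : X → X₁} {x : X} {y : X₁}
    (h : ∀ᶠ z in nhds x, f z = y) (v : E) : (mfderiv J J₁ f x v : E₁) = 0 := by
  rw [mfderiv_eq_of_eventuallyEq (f' := fun _ => y) h]
  exact congrArg (fun L : E →L[ℝ] E₁ => L v) (hasMFDerivAt_const y x).mfderiv

variable {𝒢} in
lemma mdifferentiableWithinAt_mul_right {g h : G} (hgh : 𝒢.src h = 𝒢.tgt g) :
    MDifferentiableWithinAt (𝓡 (n + r)) (𝓡 (n + r)) (fun k => 𝒢.mul k g)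
      {k | 𝒢.src k = 𝒢.tgt g} h := by
  have h1 := 𝒢.contMDiffOn_mul (h, g) hgh
  have h2 : ContMDiffWithinAt (𝓡 (n + r)) ((𝓡 (n + r)).prod (𝓡 (n + r))) ∞ (fun k : G => (k, g))
      {k | 𝒢.src k = 𝒢.tgt g} h := contMDiffWithinAt_id.prodMk contMDiffWithinAt_const
  exact (ContMDiffWithinAt.comp (f := fun k : G => (k, g)) h h1 h2
    (fun k hk => hk)).mdifferentiableWithinAt (by simp)

variable {𝒢} in
/-- Right translation in terms of curves, or more generally maps, into the source fibre. -/
lemma mfderiv_mul_const {g : G} {c : X → G} {x : X} (hc : MDifferentiableAt J (𝓡 (n + r)) c x)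
    (hcx : c x = 𝒢.unit (𝒢.tgt g)) (hsrc : ∀ᶠ z in nhds x, 𝒢.src (c z) = 𝒢.tgt g) (v : E)
    (a : 𝒢.algebroid (𝒢.tgt g)) (ha : (a.1 : Euc (n + r)) = mfderiv J (𝓡 (n + r)) c x v) :
    (mfderiv J (𝓡 (n + r)) (fun z => 𝒢.mul (c z) g) x v : Euc (n + r)) =
      𝒢.rightTranslation g a := by
  rw [mfderiv_comp_mfderivWithin_apply (mdifferentiableWithinAt_mul_right (𝒢.src_unit _)) hc hcx
    hsrc v, ← ha]
  rfl

end

end LieGroupoid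

/-! ### Frames adapted to an exact sequence -/

/-- Vectors adapted to an exact sequence `0 → A → V → T` and to frames of `A` and `T` form a frame
of `V`. -/
lemma exists_basis_of_exact {ι κ : Type*} [Fintype ι] [Fintype κ]
    {A V T : Type*} [AddCommGroup A] [Module ℝ A] [AddCommGroup V] [Module ℝ V]
    [FiniteDimensional ℝ V] [AddCommGroup T]
    [Module ℝ T] (R : A →ₗ[ℝ] V) (S : V →ₗ[ℝ] T) (hSR : ∀ x, S (R x) = 0)
    (hR : Function.Injective R) (hdim : Fintype.card (ι ⊕ κ) = Module.finrank ℝ V)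
    (a : Module.Basis ι ℝ A) (v : Module.Basis κ ℝ T) (w : κ → V) (hw : ∀ j, S (w j) = v j) :
    ∃ b : Module.Basis (ι ⊕ κ) ℝ V, ∀ k, b k = Sum.elim (fun i => R (a i)) w k := by
  have hli : LinearIndependent ℝ (Sum.elim (fun i => R (a i)) w) := by
    rw [Fintype.linearIndependent_iff]
    intro c hc
    rw [Fintype.sum_sum_type] at hc
    simp only [Sum.elim_inl, Sum.elim_inr] at hc
    have h1 : ∀ j, c (Sum.inr j) = 0 := by
      have h2 := congrArg S hc
      simp only [map_add, map_sum, map_smul, hSR, hw, smul_zero, Finset.sum_const_zero, zero_add,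
        map_zero] at h2
      exact Fintype.linearIndependent_iff.1 v.linearIndependent _ h2
    have h2 : ∀ i, c (Sum.inl i) = 0 := by
      simp only [h1, zero_smul, Finset.sum_const_zero, add_zero, ← map_smul, ← map_sum] at hc
      exact Fintype.linearIndependent_iff.1 a.linearIndependent _
        (hR (hc.trans (map_zero R).symm))
    rintro (i | j)
    · exact h2 i
    · exact h1 j
  exact ⟨basisOfLinearIndependentOfCardEqFinrank' _ hli hdim, fun k => by simp⟩

namespace LieGroupoid

variable {n r : ℕ} {M G : Type*}
  [TopologicalSpace M] [ChartedSpace (EuclideanSpace ℝ (Fin n)) M] [IsManifold (𝓡 n) ∞ M]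
  [TopologicalSpace G] [ChartedSpace (EuclideanSpace ℝ (Fin (n + r))) G]
  [IsManifold (𝓡 (n + r)) ∞ G] (𝒢 : LieGroupoid n r M G)

lemma mdifferentiable_src : MDifferentiable (𝓡 (n + r)) (𝓡 n) 𝒢.src :=
  𝒢.contMDiff_src.mdifferentiable (by simp)

lemma mdifferentiable_tgt : MDifferentiable (𝓡 (n + r)) (𝓡 n) 𝒢.tgt :=
  𝒢.contMDiff_tgt.mdifferentiable (by simp)

lemma mdifferentiable_inv : MDifferentiable (𝓡 (n + r)) (𝓡 (n + r)) 𝒢.inv :=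
  𝒢.contMDiff_inv.mdifferentiable (by simp)

lemma mfderiv_src_surjective (g : G) (v : Euc n) :
    ∃ X : Euc (n + r), (mfderiv (𝓡 (n + r)) (𝓡 n) 𝒢.src g X : Euc n) = v := by
  obtain ⟨p, q, hp, hq, hg, hpq⟩ := 𝒢.exists_submersion_chart g
  have hmem : ∀ᶠ y in nhds (𝒢.src g), ((p g).1, q y) ∈ p.target := by
    have hc : ContinuousAt (fun y => ((p g).1, q y)) (𝒢.src g) :=
      continuousAt_const.prodMk (q.continuousAt (hpq g hg).1)
    refine hc (p.open_target.mem_nhds ?_)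
    change ((p g).1, q (𝒢.src g)) ∈ p.target
    rw [← (hpq g hg).2]
    exact p.map_source hg
  have h0 : ((p g).1, q (𝒢.src g)) = p g := by rw [← (hpq g hg).2]
  have hβ : ContMDiffAt (𝓡 n) (𝓡 (n + r)) ∞ (fun y => p.symm ((p g).1, q y)) (𝒢.src g) := by
    have h1 := hp.contMDiffAt_symm hmem.self_of_nhds
    exact ContMDiffAt.comp (𝒢.src g) h1
      (contMDiffAt_const.prodMk_space (hq.contMDiffAt (hpq g hg).1))
  have hsec : ∀ᶠ y in nhds (𝒢.src g), 𝒢.src (p.symm ((p g).1, q y)) = y := by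
    filter_upwards [hmem, q.open_source.mem_nhds (hpq g hg).1] with y hy hyq
    have h1 := hpq _ (p.map_target hy)
    rw [p.right_inv hy] at h1
    exact (q.injOn h1.1 hyq h1.2.symm)
  refine ⟨mfderiv (𝓡 n) (𝓡 (n + r)) (fun y => p.symm ((p g).1, q y)) (𝒢.src g) v, ?_⟩
  rw [← mfderiv_comp_apply' 𝒢.mdifferentiable_src.mdifferentiableAt
    (hβ.mdifferentiableAt (by simp)) (by rw [h0, p.left_inv hg]) v,
    mfderiv_eq_of_eventuallyEq hsec]
  exact congrArg (fun L : Euc n →L[ℝ] Euc n => L v) (mfderiv_id (I := 𝓡 n) (x := 𝒢.src g))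

lemma finrank_ker_mfderiv_src (g : G) : Module.finrank ℝ
    (LinearMap.ker (mfderiv (𝓡 (n + r)) (𝓡 n) 𝒢.src g).toLinearMap) = r := by
  let S : Euc (n + r) →ₗ[ℝ] Euc n := (mfderiv (𝓡 (n + r)) (𝓡 n) 𝒢.src g).toLinearMap
  have h1 := LinearMap.finrank_range_add_finrank_ker S
  have h2 : LinearMap.range S = ⊤ := LinearMap.range_eq_top.2 (𝒢.mfderiv_src_surjective g)
  rw [h2, finrank_top] at h1
  simp only [finrank_euclideanSpace, Fintype.card_fin] at h1
  have h3 : Module.finrank ℝ (LinearMap.ker S) = r := by omega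
  exact h3

/-- Slices of the source fibres: every source fibre is near `g` the image of a smooth map whose
derivative is onto the kernel of the differential of the source map. -/
lemma exists_slice (g : G) : ∃ c : Euc r → G,
    ContMDiffAt 𝓘(ℝ, Euc r) (𝓡 (n + r)) ∞ c 0 ∧ c 0 = g ∧
    (∀ᶠ w in nhds 0, 𝒢.src (c w) = 𝒢.src g) ∧
    ∀ X : Euc (n + r), (mfderiv (𝓡 (n + r)) (𝓡 n) 𝒢.src g X : Euc n) = 0 →
      ∃ w : Euc r, (mfderiv 𝓘(ℝ, Euc r) (𝓡 (n + r)) c 0 w : Euc (n + r)) = X := by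
  obtain ⟨p, q, hp, hq, hg, hpq⟩ := 𝒢.exists_submersion_chart g
  have h0 : (p g).1 + 0 = (p g).1 := add_zero _
  have hmem : ∀ᶠ w in nhds (0 : Euc r), ((p g).1 + w, (p g).2) ∈ p.target := by
    have hc : ContinuousAt (fun w : Euc r => ((p g).1 + w, (p g).2)) 0 := by fun_prop
    refine hc (p.open_target.mem_nhds ?_)
    change ((p g).1 + 0, (p g).2) ∈ p.target
    rw [h0]
    exact p.map_source hg
  have hc : ContMDiffAt 𝓘(ℝ, Euc r) (𝓡 (n + r)) ∞
      (fun w => p.symm ((p g).1 + w, (p g).2)) 0 := by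
    have h1 := hp.contMDiffAt_symm hmem.self_of_nhds
    have h2 : ContMDiffAt 𝓘(ℝ, Euc r) 𝓘(ℝ, Euc r × Euc n) ∞
        (fun w : Euc r => ((p g).1 + w, (p g).2)) 0 := by
      apply ContDiffAt.contMDiffAt
      fun_prop
    exact ContMDiffAt.comp (0 : Euc r) h1 h2
  have hc0 : p.symm ((p g).1 + 0, (p g).2) = g := by rw [h0]; exact p.left_inv hg
  refine ⟨_, hc, hc0, ?_, ?_⟩
  · filter_upwards [hmem] with w hw
    have h1 := hpq _ (p.map_target hw)
    rw [p.right_inv hw] at h1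
    exact q.injOn h1.1 (hpq g hg).1 (h1.2.symm.trans (hpq g hg).2)
  · intro X hX
    have hpd := (hp.contMDiffAt hg).mdifferentiableAt (n := ∞) (by simp)
    set Y : Euc r × Euc n := mfderiv (𝓡 (n + r)) 𝓘(ℝ, Euc r × Euc n) p g X with hY
    have hY2 : Y.2 = 0 := by
      have h1 : (mfderiv (𝓡 (n + r)) (𝓡 n) (fun h => q (𝒢.src h)) g X : Euc n) = Y.2 := by
        rw [mfderiv_eq_of_eventuallyEq (f' := fun h => (p h).2)
          (by filter_upwards [p.open_source.mem_nhds hg] with h hh using (hpq h hh).2.symm)]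
        have hs : MDifferentiableAt 𝓘(ℝ, Euc r × Euc n) 𝓘(ℝ, Euc n)
            (Prod.snd : Euc r × Euc n → Euc n) (p g) := differentiableAt_snd.mdifferentiableAt
        rw [mfderiv_comp_apply' hs hpd rfl X, ← hY, mfderiv_eq_fderiv, fderiv_snd]
        rfl
      rw [← h1, mfderiv_comp_apply' ((hq.contMDiffAt (hpq g hg).1).mdifferentiableAt (by simp))
        𝒢.mdifferentiable_src.mdifferentiableAt rfl, hX]
      exact map_zero (mfderiv (𝓡 n) (𝓡 n) q (𝒢.src g))
    refine ⟨Y.1, ?_⟩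
    have hsymm := (hp.contMDiffAt_symm (p.map_source hg)).mdifferentiableAt (n := ∞) (by simp)
    have h2 : MDifferentiableAt 𝓘(ℝ, Euc r) 𝓘(ℝ, Euc r × Euc n)
        (fun w : Euc r => ((p g).1 + w, (p g).2)) 0 := by
      apply DifferentiableAt.mdifferentiableAt
      fun_prop
    rw [mfderiv_comp_apply' hsymm h2 (by rw [h0])]
    have h3 : (mfderiv 𝓘(ℝ, Euc r) 𝓘(ℝ, Euc r × Euc n)
        (fun w : Euc r => ((p g).1 + w, (p g).2)) 0 Y.1 : Euc r × Euc n) = Y := by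
      have h4 : HasFDerivAt (fun w : Euc r => ((p g).1 + w, (p g).2))
          ((ContinuousLinearMap.id ℝ (Euc r)).prod 0) 0 :=
        ((hasFDerivAt_id (𝕜 := ℝ) (0 : Euc r)).const_add _).prodMk (hasFDerivAt_const _ _)
      rw [mfderiv_eq_fderiv, h4.fderiv]
      exact Prod.ext rfl hY2.symm
    rw [h3, hY, ← mfderiv_comp_apply' hsymm hpd rfl,
      mfderiv_eq_of_eventuallyEq (f' := fun h => h)
        (by filter_upwards [p.open_source.mem_nhds hg] with h hh using p.left_inv hh)]
    exact congrArg (fun L : Euc (n + r) →L[ℝ] Euc (n + r) => L X)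
      (mfderiv_id (I := 𝓡 (n + r)) (x := g))

lemma algebroid_mfderiv_src {x : M} (a : 𝒢.algebroid x) :
    (mfderiv (𝓡 (n + r)) (𝓡 n) 𝒢.src (𝒢.unit x) (a.1 : Euc (n + r)) : Euc n) = 0 := a.2

/-- Maps into the source fibre of `x` have derivatives in `A_x`. -/
lemma mem_algebroid_of_curve {E H X : Type*} [NormedAddCommGroup E] [NormedSpace ℝ E]
    [TopologicalSpace H] {J : ModelWithCorners ℝ E H} [TopologicalSpace X] [ChartedSpace H X]
    {x : M} {c : X → G} {z : X}
    (hc : MDifferentiableAt J (𝓡 (n + r)) c z)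
    (hcz : c z = 𝒢.unit x) (hsrc : ∀ᶠ w in nhds z, 𝒢.src (c w) = x) (v : E) :
    ∃ a : 𝒢.algebroid x, (a.1 : Euc (n + r)) = mfderiv J (𝓡 (n + r)) c z v := by
  refine ⟨⟨_, LinearMap.mem_ker.2 ?_⟩, rfl⟩
  refine Eq.trans (mfderiv_comp_apply' (𝒢.mdifferentiable_src.mdifferentiableAt) hc hcz v).symm ?_
  exact mfderiv_eq_zero_of_eventually_const hsrc v

/-- Slices of the source fibres at the units. -/
lemma exists_unit_slice (x : M) : ∃ c : Euc r → G,
    ContMDiffAt 𝓘(ℝ, Euc r) (𝓡 (n + r)) ∞ c 0 ∧ c 0 = 𝒢.unit x ∧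
    (∀ᶠ w in nhds 0, 𝒢.src (c w) = x) ∧
    ∀ a : 𝒢.algebroid x,
      ∃ w : Euc r, (mfderiv 𝓘(ℝ, Euc r) (𝓡 (n + r)) c 0 w : Euc (n + r)) = a.1 := by
  obtain ⟨c, h1, h2, h3, h4⟩ := 𝒢.exists_slice (𝒢.unit x)
  rw [𝒢.src_unit] at h3
  exact ⟨c, h1, h2, h3, fun a => h4 a.1 a.2⟩

lemma mfderiv_src_rightTranslation (g : G) (a : 𝒢.algebroid (𝒢.tgt g)) :
    (mfderiv (𝓡 (n + r)) (𝓡 n) 𝒢.src g (𝒢.rightTranslation g a) : Euc n) = 0 := by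
  obtain ⟨c, h1, h2, h3, h4⟩ := 𝒢.exists_unit_slice (𝒢.tgt g)
  obtain ⟨w, hw⟩ := h4 a
  have h5 := mfderiv_mul_const (h1.mdifferentiableAt (by simp)) h2 h3 w a hw.symm
  have h6 := contMDiffAt_mul h1 (contMDiffAt_const (c := g)) (by rw [h2, 𝒢.src_unit]) h3
  rw [← h5, ← mfderiv_comp_apply' 𝒢.mdifferentiable_src.mdifferentiableAt
    (h6.mdifferentiableAt (by simp)) (by rw [h2, 𝒢.unit_mul]) w]
  refine mfderiv_eq_zero_of_eventually_const (y := 𝒢.src g) ?_ w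
  filter_upwards [h3] with z hz using 𝒢.src_mul _ _ hz

lemma rightTranslation_injective (g : G) : Function.Injective (𝒢.rightTranslation g) := by
  rw [injective_iff_map_eq_zero]
  intro a ha
  obtain ⟨c, h1, h2, h3, h4⟩ := 𝒢.exists_unit_slice (𝒢.tgt g)
  obtain ⟨w, hw⟩ := h4 a
  have h5 := mfderiv_mul_const (h1.mdifferentiableAt (by simp)) h2 h3 w a hw.symm
  have h6 := contMDiffAt_mul h1 (contMDiffAt_const (c := g)) (by rw [h2, 𝒢.src_unit]) h3
  have h7 : 𝒢.src g = 𝒢.tgt (𝒢.inv g) := (𝒢.tgt_inv g).symm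
  have h8 := mfderiv_comp_mfderivWithin_apply (mdifferentiableWithinAt_mul_right h7)
    (h6.mdifferentiableAt (n := ∞) (by simp)) (by rw [h2, 𝒢.unit_mul])
    (by filter_upwards [h3] with z hz using (𝒢.src_mul _ _ hz).trans h7) w
  rw [h5, ha, mfderiv_eq_of_eventuallyEq (f' := c)
    (by filter_upwards [h3] with z hz using 𝒢.mul_mul_inv_cancel hz), hw] at h8
  exact Subtype.ext (h8.trans (map_zero _))

/-- Every pair of frames of `A_{tgt g}` and `T_{src g} M` extends to an adapted frame of `T_g G`. -/
lemma exists_adapted (g : G) (a : Module.Basis (Fin r) ℝ (𝒢.algebroid (𝒢.tgt g)))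
    (v : Module.Basis (Fin n) ℝ (TangentSpace (𝓡 n) (𝒢.src g))) : ∃ b, 𝒢.IsAdapted g a v b := by
  choose w hw using fun j => 𝒢.mfderiv_src_surjective g (v j)
  have : FiniteDimensional ℝ (TangentSpace (𝓡 (n + r)) g) :=
    inferInstanceAs (FiniteDimensional ℝ (Euc (n + r)))
  have hd : Module.finrank ℝ (TangentSpace (𝓡 (n + r)) g) = n + r :=
    finrank_euclideanSpace_fin (𝕜 := ℝ) (n := n + r)
  obtain ⟨b, hb⟩ := exists_basis_of_exact (𝒢.rightTranslation g)
    (mfderiv (𝓡 (n + r)) (𝓡 n) 𝒢.src g).toLinearMap (𝒢.mfderiv_src_rightTranslation g)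
    (𝒢.rightTranslation_injective g) (by rw [hd]; simp [add_comm]) a v w hw
  exact ⟨b, fun i => hb _, fun j => by rw [hb]; exact hw j⟩

lemma det_of_isAdapted {g : G} {a a' : Module.Basis (Fin r) ℝ (𝒢.algebroid (𝒢.tgt g))}
    {v v' : Module.Basis (Fin n) ℝ (TangentSpace (𝓡 n) (𝒢.src g))} {b b'}
    (hb : 𝒢.IsAdapted g a v b) (hb' : 𝒢.IsAdapted g a' v' b') :
    b.det b' = a.det a' * v.det v' :=
  det_of_adapted (𝒢.rightTranslation g) (mfderiv (𝓡 (n + r)) (𝓡 n) 𝒢.src g).toLinearMap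
    (𝒢.mfderiv_src_rightTranslation g) hb.1 hb.2 hb'.1 hb'.2

/-! ### The differential of the inversion -/

lemma invDeriv_mfderiv {E H X : Type*} [NormedAddCommGroup E] [NormedSpace ℝ E]
    [TopologicalSpace H] {J : ModelWithCorners ℝ E H} [TopologicalSpace X] [ChartedSpace H X]
    {g : G} {c : X → G} {z : X} (hc : MDifferentiableAt J (𝓡 (n + r)) c z)
    (hcz : c z = 𝒢.inv g) (v : E) :
    (𝒢.invDeriv g (show Euc (n + r) from mfderiv J (𝓡 (n + r)) c z v) : Euc (n + r)) =
      mfderiv J (𝓡 (n + r)) (fun w => 𝒢.inv (c w)) z v :=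
  (mfderiv_comp_apply' 𝒢.mdifferentiable_inv.mdifferentiableAt hc hcz v).symm

lemma mfderiv_inv_injective (g : G) (X : Euc (n + r))
    (hX : (mfderiv (𝓡 (n + r)) (𝓡 (n + r)) 𝒢.inv g X : Euc (n + r)) = 0) : X = 0 := by
  have h1 := mfderiv_comp_apply' (f := 𝒢.inv) (c := 𝒢.inv) (x := g)
    (𝒢.mdifferentiable_inv (𝒢.inv g)) 𝒢.mdifferentiable_inv.mdifferentiableAt rfl X
  replace h1 := (mfderiv_eq_of_eventuallyEq (J := 𝓡 (n + r)) (f' := fun h => h)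
    (.of_forall 𝒢.inv_inv) X).symm.trans h1
  have h2 := congrArg (fun L : Euc (n + r) →L[ℝ] Euc (n + r) => L X)
      (mfderiv_id (I := 𝓡 (n + r)) (x := g))
  refine h2.symm.trans (h1.trans ?_)
  rw [hX]
  exact map_zero (mfderiv (𝓡 (n + r)) (𝓡 (n + r)) 𝒢.inv (𝒢.inv g))

lemma invDeriv_injective (g : G) : Function.Injective (𝒢.invDeriv g) := by
  rw [injective_iff_map_eq_zero]
  exact fun X hX => 𝒢.mfderiv_inv_injective _ X hX

lemma mfderiv_tgt_invDeriv (g : G) (X : Euc (n + r)) :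
    (mfderiv (𝓡 (n + r)) (𝓡 n) 𝒢.tgt g (𝒢.invDeriv g X) : Euc n) =
      mfderiv (𝓡 (n + r)) (𝓡 n) 𝒢.src (𝒢.inv g) X := by
  refine Eq.trans (mfderiv_comp_apply' (f := 𝒢.tgt) (c := 𝒢.inv) (x := 𝒢.inv g)
    (𝒢.mdifferentiable_tgt g) 𝒢.mdifferentiable_inv.mdifferentiableAt (𝒢.inv_inv g) X).symm ?_
  exact mfderiv_eq_of_eventuallyEq (.of_forall 𝒢.tgt_inv) X

end LieGroupoid

/-- The absolute determinant of a linear map in terms of two pairs of frames. The map is only assumed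
to be injective; equality of dimensions comes from the common index type. -/
lemma abs_det_comp_injective {ι : Type*} [Fintype ι] [DecidableEq ι] {V V' : Type*}
    [AddCommGroup V] [Module ℝ V] [AddCommGroup V'] [Module ℝ V'] (L : V' →ₗ[ℝ] V)
    (hL : Function.Injective L) (b b₀ : Module.Basis ι ℝ V) (b' b₀' : Module.Basis ι ℝ V') :
    |b.det (fun k => L (b' k))| = |b.det b₀| * |b₀.det (fun k => L (b₀' k))| * |b₀'.det b'| := by
  have : FiniteDimensional ℝ V := b.finiteDimensional_of_finite
  have : FiniteDimensional ℝ V' := b'.finiteDimensional_of_finite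
  have hd : Module.finrank ℝ V' = Module.finrank ℝ V := by
    rw [Module.finrank_eq_card_basis b, Module.finrank_eq_card_basis b']
  let e := LinearEquiv.ofInjectiveOfFinrankEq L hL hd
  have he : ∀ (c : Module.Basis ι ℝ V'), (fun k => L (c k)) = c.map e := fun c => by
    ext k; simp only [Module.Basis.map_apply]; rfl
  have h2 : (b₀'.map e).det (b'.map e) = b₀'.det b' := by
    rw [Module.Basis.det_map]; congr 1; ext k; simp
  rw [he, he, ← abs_mul, b.det_mul_det, ← h2, ← abs_mul, b.det_mul_det]

namespace LieGroupoid

variable {n r : ℕ} {M G : Type*}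
  [TopologicalSpace M] [ChartedSpace (EuclideanSpace ℝ (Fin n)) M] [IsManifold (𝓡 n) ∞ M]
  [TopologicalSpace G] [ChartedSpace (EuclideanSpace ℝ (Fin (n + r))) G]
  [IsManifold (𝓡 (n + r)) ∞ G] (𝒢 : LieGroupoid n r M G)

/-! ### The action of arrows in frames -/

/-- An arbitrary, not necessarily continuous, family of frames of the Lie algebroid. -/
def algebroidFrame (x : M) : Module.Basis (Fin r) ℝ (𝒢.algebroid x) :=
  have : FiniteDimensional ℝ (TangentSpace (𝓡 (n + r)) (𝒢.unit x)) :=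
    inferInstanceAs (FiniteDimensional ℝ (Euc (n + r)))
  Module.finBasisOfFinrankEq ℝ (𝒢.algebroid x) (𝒢.finrank_ker_mfderiv_src (𝒢.unit x))

/-- The standard basis of the model space as a frame of a tangent space of the base. It need not
depend continuously on the point. -/
def tangentFrame (n : ℕ) {M : Type*} [TopologicalSpace M]
    [ChartedSpace (EuclideanSpace ℝ (Fin n)) M] (x : M) :
    Module.Basis (Fin n) ℝ (TangentSpace (𝓡 n) x) :=
  (EuclideanSpace.basisFun (Fin n) ℝ).toBasis

/-- The coordinate of a transverse density in the frames `algebroidFrame` and `tangentFrame`. -/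
def coord (x : M) : 𝒢.TransverseDensityFibre x →ₗ[ℝ] ℝ :=
  𝒢.evalFrame (𝒢.algebroidFrame x) (tangentFrame n x)

/-- The factor by which coordinates in the frame `(a, v)` differ from `coord`. -/
def frameFactor (a : ∀ x, Module.Basis (Fin r) ℝ (𝒢.algebroid x))
    (v : ∀ x : M, Module.Basis (Fin n) ℝ (TangentSpace (𝓡 n) x)) (x : M) : ℝ :=
  |(a x).det (𝒢.algebroidFrame x)| * |(tangentFrame n x).det (v x)|

lemma frameFactor_pos (a : ∀ x, Module.Basis (Fin r) ℝ (𝒢.algebroid x))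
    (v : ∀ x : M, Module.Basis (Fin n) ℝ (TangentSpace (𝓡 n) x)) (x : M) :
    0 < 𝒢.frameFactor a v x :=
  mul_pos (abs_det_pos _ _) (abs_det_pos _ _)

lemma evalFrame_change {x : M} (a a' : Module.Basis (Fin r) ℝ (𝒢.algebroid x))
    (v v' : Module.Basis (Fin n) ℝ (TangentSpace (𝓡 n) x)) (z : 𝒢.TransverseDensityFibre x) :
    𝒢.evalFrame a v z = |a.det a'| * |v'.det v| * 𝒢.evalFrame a' v' z := by
  have h : 𝒢.evalFrame a v = (|a.det a'| * |v'.det v|) • 𝒢.evalFrame a' v' := by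
    refine TensorProduct.ext' fun ξ η => ?_
    simp only [evalFrame, LinearMap.comp_apply, TensorProduct.map_tmul, LinearMap.mul'_apply,
      LinearMap.smul_apply, smul_eq_mul]
    rw [DensitySpace.eval_change a'.dualBasis a.dualBasis, DensitySpace.eval_change v' v,
      det_dualBasis]
    ring
  exact LinearMap.congr_fun h z

lemma evalFrame_eq_frameFactor_mul (a : ∀ x, Module.Basis (Fin r) ℝ (𝒢.algebroid x))
    (v : ∀ x : M, Module.Basis (Fin n) ℝ (TangentSpace (𝓡 n) x)) {x : M}
    (z : 𝒢.TransverseDensityFibre x) :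
    𝒢.evalFrame (a x) (v x) z = 𝒢.frameFactor a v x * 𝒢.coord x z :=
  𝒢.evalFrame_change _ _ _ _ z

/-- The transverse density with coordinate `1` in the frame `(a, v)`. -/
def densityOfFrame {x : M} (a : Module.Basis (Fin r) ℝ (𝒢.algebroid x))
    (v : Module.Basis (Fin n) ℝ (TangentSpace (𝓡 n) x)) : 𝒢.TransverseDensityFibre x :=
  DensitySpace.ofFrame a.dualBasis ⊗ₜ DensitySpace.ofFrame v

lemma evalFrame_densityOfFrame {x : M} (a : Module.Basis (Fin r) ℝ (𝒢.algebroid x))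
    (v : Module.Basis (Fin n) ℝ (TangentSpace (𝓡 n) x)) :
    𝒢.evalFrame a v (𝒢.densityOfFrame a v) = 1 := by
  simp only [evalFrame, densityOfFrame, LinearMap.comp_apply, TensorProduct.map_tmul,
    LinearMap.mul'_apply, DensitySpace.eval_ofFrame]
  rw [Module.Basis.det_self, Module.Basis.det_self, abs_one, mul_one]

lemma eq_evalFrame_smul {x : M} (a : Module.Basis (Fin r) ℝ (𝒢.algebroid x))
    (v : Module.Basis (Fin n) ℝ (TangentSpace (𝓡 n) x)) (z : 𝒢.TransverseDensityFibre x) :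
    z = 𝒢.evalFrame a v z • 𝒢.densityOfFrame a v := by
  have h : LinearMap.id =
      (𝒢.evalFrame a v).smulRight (𝒢.densityOfFrame a v) := by
    refine TensorProduct.ext' fun ξ η => ?_
    simp only [evalFrame, LinearMap.comp_apply, TensorProduct.map_tmul, LinearMap.mul'_apply,
      LinearMap.smulRight_apply, LinearMap.id_apply, densityOfFrame]
    conv_lhs => rw [DensitySpace.eq_eval_smul_ofFrame a.dualBasis ξ,
      DensitySpace.eq_eval_smul_ofFrame v η]
    rw [TensorProduct.smul_tmul_smul]
  exact LinearMap.congr_fun h z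

lemma evalFrame_injective {x : M} (a : Module.Basis (Fin r) ℝ (𝒢.algebroid x))
    (v : Module.Basis (Fin n) ℝ (TangentSpace (𝓡 n) x)) : Function.Injective (𝒢.evalFrame a v) :=
  fun z z' h => by rw [𝒢.eq_evalFrame_smul a v z, 𝒢.eq_evalFrame_smul a v z', h]

lemma evalFrame_ne_zero {x : M} (a : Module.Basis (Fin r) ℝ (𝒢.algebroid x))
    (v : Module.Basis (Fin n) ℝ (TangentSpace (𝓡 n) x)) {z : 𝒢.TransverseDensityFibre x}
    (hz : z ≠ 0) : 𝒢.evalFrame a v z ≠ 0 :=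
  fun h => hz (𝒢.evalFrame_injective a v (h.trans (map_zero _).symm))

lemma coord_ne_zero {x : M} {z : 𝒢.TransverseDensityFibre x} (hz : z ≠ 0) : 𝒢.coord x z ≠ 0 :=
  𝒢.evalFrame_ne_zero (𝒢.algebroidFrame x) (tangentFrame n x) hz

/-- A frame of `T_g G` adapted to `algebroidFrame` and `tangentFrame`. -/
def adaptedFrame (g : G) : Module.Basis (Fin r ⊕ Fin n) ℝ (TangentSpace (𝓡 (n + r)) g) :=
  (𝒢.exists_adapted g (𝒢.algebroidFrame _) (tangentFrame n _)).choose

lemma isAdapted_adaptedFrame (g : G) :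
    𝒢.IsAdapted g (𝒢.algebroidFrame _) (tangentFrame n _) (𝒢.adaptedFrame g) :=
  (𝒢.exists_adapted g (𝒢.algebroidFrame _) (tangentFrame n _)).choose_spec

/-- The positive number by which `g` acts on transverse densities, in the coordinates `coord`. -/
def actionFactor (g : G) : ℝ :=
  |(𝒢.adaptedFrame g).det (fun k => 𝒢.invDeriv g (𝒢.adaptedFrame (𝒢.inv g) k))|

/-- The determinant of the differential of the inversion in adapted frames is `actionFactor` up to
the changes of frames. -/
lemma abs_det_invDeriv {g : G} (a a' : ∀ x, Module.Basis (Fin r) ℝ (𝒢.algebroid x))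
    (v v' : ∀ x : M, Module.Basis (Fin n) ℝ (TangentSpace (𝓡 n) x)) {b b'}
    (hb : 𝒢.IsAdapted g (a (𝒢.tgt g)) (v (𝒢.src g)) b)
    (hb' : 𝒢.IsAdapted (𝒢.inv g) (a' (𝒢.tgt (𝒢.inv g))) (v' (𝒢.src (𝒢.inv g))) b') :
    |b.det (fun k => 𝒢.invDeriv g (b' k))| =
      |(a (𝒢.tgt g)).det (𝒢.algebroidFrame (𝒢.tgt g))| *
      |(v (𝒢.src g)).det (tangentFrame n (𝒢.src g))| * 𝒢.actionFactor g *
      (|(𝒢.algebroidFrame (𝒢.src g)).det (a' (𝒢.src g))| *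
      |(tangentFrame n (𝒢.tgt g)).det (v' (𝒢.tgt g))|) := by
  rw [abs_det_comp_injective _ (𝒢.invDeriv_injective g) b (𝒢.adaptedFrame g) b'
    (𝒢.adaptedFrame (𝒢.inv g)), 𝒢.det_of_isAdapted hb (𝒢.isAdapted_adaptedFrame g),
    𝒢.det_of_isAdapted (𝒢.isAdapted_adaptedFrame _) hb', abs_mul, abs_mul]
  congr 2
  · exact congrArg (fun x => |(𝒢.algebroidFrame x).det (a' x)|) (𝒢.tgt_inv g)
  · exact congrArg (fun x => |(tangentFrame n x).det (v' x)|) (𝒢.src_inv g)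

lemma abs_det_mul_abs_det_symm {ι V : Type*} [Fintype ι] [DecidableEq ι]
    [AddCommGroup V] [Module ℝ V] (e f : Module.Basis ι ℝ V) : |e.det f| * |f.det e| = 1 := by
  rw [← abs_mul, e.det_mul_det, e.det_self, abs_one]

lemma abs_det_invDeriv_of_family {g : G} (a : ∀ x, Module.Basis (Fin r) ℝ (𝒢.algebroid x))
    (v : ∀ x : M, Module.Basis (Fin n) ℝ (TangentSpace (𝓡 n) x)) {b b'}
    (hb : 𝒢.IsAdapted g (a (𝒢.tgt g)) (v (𝒢.src g)) b)
    (hb' : 𝒢.IsAdapted (𝒢.inv g) (a (𝒢.tgt (𝒢.inv g))) (v (𝒢.src (𝒢.inv g))) b') :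
    |b.det (fun k => 𝒢.invDeriv g (b' k))| * 𝒢.frameFactor a v (𝒢.src g) =
      𝒢.frameFactor a v (𝒢.tgt g) * 𝒢.actionFactor g := by
  rw [𝒢.abs_det_invDeriv a a v v hb hb', frameFactor, frameFactor]
  have h1 := abs_det_mul_abs_det_symm (a (𝒢.src g)) (𝒢.algebroidFrame (𝒢.src g))
  have h2 := abs_det_mul_abs_det_symm (v (𝒢.src g)) (tangentFrame n (𝒢.src g))
  generalize 𝒢.actionFactor g = D
  linear_combination (|(a (𝒢.tgt g)).det (𝒢.algebroidFrame (𝒢.tgt g))| *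
    |(tangentFrame n (𝒢.tgt g)).det (v (𝒢.tgt g))| * D *
    (|(v (𝒢.src g)).det (tangentFrame n (𝒢.src g))| *
      |(tangentFrame n (𝒢.src g)).det (v (𝒢.src g))|)) * h1 +
    (|(a (𝒢.tgt g)).det (𝒢.algebroidFrame (𝒢.tgt g))| *
    |(tangentFrame n (𝒢.tgt g)).det (v (𝒢.tgt g))| * D) * h2

lemma actionFactor_pos (g : G) : 0 < 𝒢.actionFactor g := by
  have hd : Module.finrank ℝ (TangentSpace (𝓡 (n + r)) (𝒢.inv g)) =
      Module.finrank ℝ (TangentSpace (𝓡 (n + r)) g) := rfl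
  have : FiniteDimensional ℝ (TangentSpace (𝓡 (n + r)) g) :=
    inferInstanceAs (FiniteDimensional ℝ (Euc (n + r)))
  have : FiniteDimensional ℝ (TangentSpace (𝓡 (n + r)) (𝒢.inv g)) :=
    inferInstanceAs (FiniteDimensional ℝ (Euc (n + r)))
  let e := LinearEquiv.ofInjectiveOfFinrankEq (𝒢.invDeriv g) (𝒢.invDeriv_injective g) hd
  have he : (fun k => 𝒢.invDeriv g (𝒢.adaptedFrame (𝒢.inv g) k)) =
      (𝒢.adaptedFrame (𝒢.inv g)).map e := by
    ext1 k; simp only [Module.Basis.map_apply]; rfl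
  rw [actionFactor, he]
  exact abs_det_pos _ _

/-- In the coordinates `coord`, an arrow acts by multiplication with `actionFactor`. -/
lemma isActionOf_iff {g : G} {z : 𝒢.TransverseDensityFibre (𝒢.src g)}
    {z' : 𝒢.TransverseDensityFibre (𝒢.tgt g)} :
    𝒢.IsActionOf g z z' ↔ 𝒢.coord _ z' = 𝒢.actionFactor g * 𝒢.coord _ z := by
  constructor
  · intro h
    exact h 𝒢.algebroidFrame (tangentFrame n) _ _ (𝒢.isAdapted_adaptedFrame g)
      (𝒢.isAdapted_adaptedFrame (𝒢.inv g))
  · intro h a v b b' hb hb'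
    rw [𝒢.evalFrame_eq_frameFactor_mul a v, 𝒢.evalFrame_eq_frameFactor_mul a v, h]
    linear_combination - 𝒢.coord _ z * 𝒢.abs_det_invDeriv_of_family a v hb hb'

end LieGroupoid

namespace LieGroupoid

variable {n r : ℕ} {M G : Type*}
  [TopologicalSpace M] [ChartedSpace (EuclideanSpace ℝ (Fin n)) M] [IsManifold (𝓡 n) ∞ M]
  [TopologicalSpace G] [ChartedSpace (EuclideanSpace ℝ (Fin (n + r))) G]
  [IsManifold (𝓡 (n + r)) ∞ G] (𝒢 : LieGroupoid n r M G)

/-! ### Local bisections and the multiplicativity of the action -/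

/-- A local bisection through the arrow `h`: a local section `β` of the source map through `h` for
which `tgt ∘ β` is a local diffeomorphism, with local inverse `ψ`. -/
structure LocalBisection (h : G) where
  /-- the section of the source map -/
  β : M → G
  /-- the local inverse of `tgt ∘ β` -/
  ψ : M → M
  contMDiffAt_β : ContMDiffAt (𝓡 n) (𝓡 (n + r)) ∞ β (𝒢.src h)
  contMDiffAt_ψ : ContMDiffAt (𝓡 n) (𝓡 n) ∞ ψ (𝒢.tgt h)
  apply_src : β (𝒢.src h) = h
  src_apply : ∀ᶠ y in nhds (𝒢.src h), 𝒢.src (β y) = y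
  left_inv : ∀ᶠ y in nhds (𝒢.src h), ψ (𝒢.tgt (β y)) = y
  right_inv : ∀ᶠ y in nhds (𝒢.tgt h), 𝒢.tgt (β (ψ y)) = y

namespace LocalBisection

variable {𝒢} {h : G} (B : 𝒢.LocalBisection h)

/-- Left translation by a bisection. -/
def leftMul (k : G) : G := 𝒢.mul (B.β (𝒢.tgt k)) k

/-- Left translation by the inverse of a bisection. -/
def leftMulInv (k : G) : G := 𝒢.mul (𝒢.inv (B.β (B.ψ (𝒢.tgt k)))) k

lemma ψ_tgt : B.ψ (𝒢.tgt h) = 𝒢.src h := by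
  have := B.left_inv.self_of_nhds
  rwa [B.apply_src] at this

lemma contMDiffAt_tgt_β : ContMDiffAt (𝓡 n) (𝓡 n) ∞ (fun y => 𝒢.tgt (B.β y)) (𝒢.src h) :=
  ContMDiffAt.comp (𝒢.src h) 𝒢.contMDiff_tgt.contMDiffAt B.contMDiffAt_β

variable {g : G} (hg : 𝒢.src h = 𝒢.tgt g)

include hg

lemma leftMul_apply : B.leftMul g = 𝒢.mul h g := by
  rw [leftMul, ← hg, B.apply_src]

lemma eventually_src_β : ∀ᶠ k in nhds g, 𝒢.src (B.β (𝒢.tgt k)) = 𝒢.tgt k := by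
  have h1 := B.src_apply
  rw [hg] at h1
  exact 𝒢.contMDiff_tgt.continuous.continuousAt.eventually h1

lemma contMDiffAt_β_tgt : ContMDiffAt (𝓡 (n + r)) (𝓡 (n + r)) ∞ (fun k => B.β (𝒢.tgt k)) g := by
  have h1 := B.contMDiffAt_β
  rw [hg] at h1
  exact ContMDiffAt.comp g h1 𝒢.contMDiff_tgt.contMDiffAt

lemma contMDiffAt_leftMul : ContMDiffAt (𝓡 (n + r)) (𝓡 (n + r)) ∞ B.leftMul g :=
  contMDiffAt_mul (B.contMDiffAt_β_tgt hg) contMDiffAt_id (B.eventually_src_β hg).self_of_nhds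
    (B.eventually_src_β hg)

lemma eventually_src_leftMul : ∀ᶠ k in nhds g, 𝒢.src (B.leftMul k) = 𝒢.src k := by
  filter_upwards [B.eventually_src_β hg] with k hk using 𝒢.src_mul _ _ hk

lemma eventually_tgt_leftMul :
    ∀ᶠ k in nhds g, 𝒢.tgt (B.leftMul k) = 𝒢.tgt (B.β (𝒢.tgt k)) := by
  filter_upwards [B.eventually_src_β hg] with k hk using 𝒢.tgt_mul _ _ hk

lemma contMDiffAt_leftMulInv :
    ContMDiffAt (𝓡 (n + r)) (𝓡 (n + r)) ∞ B.leftMulInv (𝒢.mul h g) := by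
  have h0 : 𝒢.tgt (𝒢.mul h g) = 𝒢.tgt h := 𝒢.tgt_mul _ _ hg
  have h1 : ContMDiffAt (𝓡 (n + r)) (𝓡 n) ∞ (fun k => B.ψ (𝒢.tgt k)) (𝒢.mul h g) :=
    ContMDiffAt.comp _ (by rw [h0]; exact B.contMDiffAt_ψ) 𝒢.contMDiff_tgt.contMDiffAt
  have h2 : ContMDiffAt (𝓡 (n + r)) (𝓡 (n + r)) ∞ (fun k => 𝒢.inv (B.β (B.ψ (𝒢.tgt k))))
      (𝒢.mul h g) :=
    ContMDiffAt.comp _ 𝒢.contMDiff_inv.contMDiffAt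
      (ContMDiffAt.comp _ (by rw [h0, B.ψ_tgt]; exact B.contMDiffAt_β) h1)
  have h3 : ∀ᶠ k in nhds (𝒢.mul h g), 𝒢.src (𝒢.inv (B.β (B.ψ (𝒢.tgt k)))) = 𝒢.tgt k := by
    have h4 := B.right_inv
    rw [← h0] at h4
    filter_upwards [𝒢.contMDiff_tgt.continuous.continuousAt.eventually h4] with k hk
    rw [𝒢.src_inv, hk]
  exact contMDiffAt_mul h2 contMDiffAt_id h3.self_of_nhds h3

lemma leftMulInv_leftMul : ∀ᶠ k in nhds g, B.leftMulInv (B.leftMul k) = k := by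
  have h1 := B.left_inv
  rw [hg] at h1
  filter_upwards [B.eventually_src_β hg, B.eventually_tgt_leftMul hg,
    𝒢.contMDiff_tgt.continuous.continuousAt.eventually h1] with k hk hk' hk''
  rw [leftMulInv, hk', hk'', leftMul, 𝒢.inv_mul_mul_cancel hk]

lemma mfderiv_leftMul_injective (X : Euc (n + r))
    (hX : (mfderiv (𝓡 (n + r)) (𝓡 (n + r)) B.leftMul g X : Euc (n + r)) = 0) : X = 0 := by
  have h1 := mfderiv_comp_apply' ((B.contMDiffAt_leftMulInv hg).mdifferentiableAt (by simp))
    ((B.contMDiffAt_leftMul hg).mdifferentiableAt (by simp)) (B.leftMul_apply hg) X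
  rw [hX, mfderiv_eq_of_eventuallyEq (f' := fun k => k) (B.leftMulInv_leftMul hg)] at h1
  have h2 := congrArg (fun L : Euc (n + r) →L[ℝ] Euc (n + r) => L X)
      (mfderiv_id (I := 𝓡 (n + r)) (x := g))
  exact h2.symm.trans (h1.trans (map_zero (mfderiv (𝓡 (n + r)) (𝓡 (n + r)) B.leftMulInv _)))

lemma mfderiv_src_leftMul (X : Euc (n + r)) :
    (mfderiv (𝓡 (n + r)) (𝓡 n) 𝒢.src (𝒢.mul h g)
      (mfderiv (𝓡 (n + r)) (𝓡 (n + r)) B.leftMul g X : Euc (n + r)) : Euc n) =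
      mfderiv (𝓡 (n + r)) (𝓡 n) 𝒢.src g X := by
  rw [← mfderiv_comp_apply' 𝒢.mdifferentiable_src.mdifferentiableAt
    ((B.contMDiffAt_leftMul hg).mdifferentiableAt (by simp)) (B.leftMul_apply hg) X]
  exact mfderiv_eq_of_eventuallyEq (B.eventually_src_leftMul hg) X

omit hg in
lemma mfderiv_tgt_β_injective (v : Euc n)
    (hv : (mfderiv (𝓡 n) (𝓡 n) (fun y => 𝒢.tgt (B.β y)) (𝒢.src h) v : Euc n) = 0) : v = 0 := by
  have h1 := mfderiv_comp_apply' (B.contMDiffAt_ψ.mdifferentiableAt (by simp))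
    (B.contMDiffAt_tgt_β.mdifferentiableAt (by simp)) (by rw [B.apply_src]) v
  rw [hv, mfderiv_eq_of_eventuallyEq (f' := fun k => k) B.left_inv] at h1
  have h2 := congrArg (fun L : Euc n →L[ℝ] Euc n => L v)
      (mfderiv_id (I := 𝓡 n) (x := 𝒢.src h))
  exact h2.symm.trans (h1.trans (map_zero (mfderiv (𝓡 n) (𝓡 n) B.ψ _)))

end LocalBisection

end LieGroupoid

/-- An injective endomorphism of a finite dimensional space maps frames to frames. -/
lemma exists_basis_map {ι V : Type*} [Fintype ι] [DecidableEq ι] [AddCommGroup V] [Module ℝ V]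
    (L : V →ₗ[ℝ] V) (hL : ∀ x, L x = 0 → x = 0) (b : Module.Basis ι ℝ V) :
    ∃ b' : Module.Basis ι ℝ V, (∀ k, b' k = L (b k)) ∧
      ∀ x : ι → V, b'.det (fun k => L (x k)) = b.det x := by
  have : FiniteDimensional ℝ V := b.finiteDimensional_of_finite
  let e := LinearEquiv.ofInjectiveEndo L ((injective_iff_map_eq_zero L).2 hL)
  refine ⟨b.map e, fun k => rfl, fun x => ?_⟩
  rw [Module.Basis.det_map]
  congr 1
  ext1 k
  exact e.symm_apply_apply (x k)

namespace LieGroupoid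

variable {n r : ℕ} {M G : Type*}
  [TopologicalSpace M] [ChartedSpace (EuclideanSpace ℝ (Fin n)) M] [IsManifold (𝓡 n) ∞ M]
  [TopologicalSpace G] [ChartedSpace (EuclideanSpace ℝ (Fin (n + r))) G]
  [IsManifold (𝓡 (n + r)) ∞ G] (𝒢 : LieGroupoid n r M G)

lemma algebroidFrame_congr {x y : M} (h : x = y) (i : Fin r) :
    ((𝒢.algebroidFrame x i).1 : Euc (n + r)) = (𝒢.algebroidFrame y i).1 := by
  subst h; rfl

namespace LocalBisection

variable {𝒢} {h : G} (B : 𝒢.LocalBisection h)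

/-- A bisection `B` through `h` acts on the Lie algebroid by conjugation: left translation by `B`
sends the right translates of a frame of `A_{src h}` to right translates of a frame of
`A_{tgt h}`. -/
lemma exists_conjugateFrame : ∃ a' : ∀ x, Module.Basis (Fin r) ℝ (𝒢.algebroid x),
    ∀ g : G, 𝒢.src h = 𝒢.tgt g → ∀ i,
      (mfderiv (𝓡 (n + r)) (𝓡 (n + r)) B.leftMul g
        (𝒢.rightTranslation g (𝒢.algebroidFrame (𝒢.tgt g) i)) : Euc (n + r)) =
      𝒢.rightTranslation (𝒢.mul h g) (a' (𝒢.tgt (𝒢.mul h g)) i) := by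
  obtain ⟨c, hc, hc0, hcs, hcA⟩ := 𝒢.exists_unit_slice (𝒢.src h)
  choose w hw using fun i => hcA (𝒢.algebroidFrame (𝒢.src h) i)
  have hu : 𝒢.src h = 𝒢.tgt (𝒢.unit (𝒢.src h)) := (𝒢.tgt_unit _).symm
  have hcl : ContMDiffAt 𝓘(ℝ, Euc r) (𝓡 (n + r)) ∞ (fun z => B.leftMul (c z)) 0 :=
    ContMDiffAt.comp (0 : Euc r) (by rw [hc0]; exact B.contMDiffAt_leftMul hu) hc
  have hls : ∀ᶠ z in nhds (0 : Euc r), 𝒢.src (B.β (𝒢.tgt (c z))) = 𝒢.tgt (c z) := by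
    refine hc.continuousAt.eventually (p := fun k => 𝒢.src (B.β (𝒢.tgt k)) = 𝒢.tgt k) ?_
    rw [hc0]; exact B.eventually_src_β hu
  have hcls : ∀ᶠ z in nhds (0 : Euc r), 𝒢.src (B.leftMul (c z)) = 𝒢.tgt (𝒢.inv h) := by
    filter_upwards [hls, hcs] with z hz hz'
    rw [leftMul, 𝒢.src_mul _ _ hz, hz', 𝒢.tgt_inv]
  -- conjugation by `B` moves the curves through the unit of `src h` to the unit of `tgt h`
  set k : Euc r → G := fun z => 𝒢.mul (B.leftMul (c z)) (𝒢.inv h) with hk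
  have hkc : ContMDiffAt 𝓘(ℝ, Euc r) (𝓡 (n + r)) ∞ k 0 :=
    contMDiffAt_mul hcl contMDiffAt_const hcls.self_of_nhds hcls
  have hk0 : k 0 = 𝒢.unit (𝒢.tgt h) := by
    rw [hk]; change 𝒢.mul (B.leftMul (c 0)) _ = _
    rw [hc0, B.leftMul_apply hu, 𝒢.mul_unit, 𝒢.mul_inv]
  have hks : ∀ᶠ z in nhds (0 : Euc r), 𝒢.src (k z) = 𝒢.tgt h := by
    filter_upwards [hcls] with z hz
    rw [hk, 𝒢.src_mul _ _ hz, 𝒢.src_inv]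
  have hkd := hkc.mdifferentiableAt (n := ∞) (by simp)
  have hcd := hc.mdifferentiableAt (n := ∞) (by simp)
  choose α hα using fun i => 𝒢.mem_algebroid_of_curve hkd hk0 hks (w i)
  -- `B.leftMul` has an injective differential, so the conjugated vectors are independent
  have hli : LinearIndependent ℝ α := by
    rw [Fintype.linearIndependent_iff]
    intro d hd
    refine Fintype.linearIndependent_iff.1 (𝒢.algebroidFrame (𝒢.src h)).linearIndependent d ?_
    have h1 : (mfderiv 𝓘(ℝ, Euc r) (𝓡 (n + r)) k 0 (∑ i, d i • w i) : Euc (n + r)) = 0 := by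
      have h2 := congrArg (fun x : 𝒢.algebroid (𝒢.tgt h) => (x.1 : Euc (n + r))) hd
      refine Eq.trans ?_ h2
      refine (map_sum (mfderiv 𝓘(ℝ, Euc r) (𝓡 (n + r)) k 0) _ _).trans ?_
      refine Eq.trans ?_ (map_sum (𝒢.algebroid (𝒢.tgt h)).subtype _ _).symm
      refine Finset.sum_congr rfl fun i _ => ?_
      refine (map_smul (mfderiv 𝓘(ℝ, Euc r) (𝓡 (n + r)) k 0) _ _).trans ?_
      exact congrArg (d i • ·) (hα i).symm
    have h3 := mfderiv_comp_mfderivWithin_apply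
      (mdifferentiableWithinAt_mul_right (𝒢 := 𝒢) (g := h) (𝒢.src_unit (𝒢.tgt h)))
      hkd hk0 hks (∑ i, d i • w i)
    have h4 := (mfderiv_eq_of_eventuallyEq (f := fun z => B.leftMul (c z))
      (by filter_upwards [hcls] with z hz using
        (𝒢.mul_inv_mul_cancel (hz.trans (𝒢.tgt_inv h))).symm) (∑ i, d i • w i)).trans
      (h3.trans ((congrArg (mfderivWithin (𝓡 (n + r)) (𝓡 (n + r)) (fun k => 𝒢.mul k h)
        {k | 𝒢.src k = 𝒢.tgt h} (𝒢.unit (𝒢.tgt h))) h1).trans (map_zero _)))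
    rw [mfderiv_comp_apply' ((B.contMDiffAt_leftMul hu).mdifferentiableAt (by simp)) hcd hc0] at h4
    have h5 := B.mfderiv_leftMul_injective hu _ h4
    refine Subtype.ext (Eq.trans ?_ h5)
    refine Eq.trans ?_ (map_sum (mfderiv 𝓘(ℝ, Euc r) (𝓡 (n + r)) c 0) _ _).symm
    refine (map_sum (𝒢.algebroid (𝒢.src h)).subtype _ _).trans ?_
    refine Finset.sum_congr rfl fun i _ => ?_
    refine Eq.trans ?_ (map_smul (mfderiv 𝓘(ℝ, Euc r) (𝓡 (n + r)) c 0) _ _).symm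
    exact congrArg (d i • ·) (hw i).symm
  have hdim : Fintype.card (Fin r) = Module.finrank ℝ (𝒢.algebroid (𝒢.tgt h)) :=
    (Fintype.card_fin r).trans (𝒢.finrank_ker_mfderiv_src (𝒢.unit (𝒢.tgt h))).symm
  have : FiniteDimensional ℝ (TangentSpace (𝓡 (n + r)) (𝒢.unit (𝒢.tgt h))) :=
    inferInstanceAs (FiniteDimensional ℝ (Euc (n + r)))
  classical
  let a₁ := basisOfLinearIndependentOfCardEqFinrank' α hli hdim
  let a' : ∀ x, Module.Basis (Fin r) ℝ (𝒢.algebroid x) :=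
    Function.update 𝒢.algebroidFrame (𝒢.tgt h) a₁
  have ha' : ∀ y, y = 𝒢.tgt h → ∀ i, ((a' y i).1 : Euc (n + r)) =
      mfderiv 𝓘(ℝ, Euc r) (𝓡 (n + r)) k 0 (w i) := by
    rintro _ rfl i
    rw [← hα i]
    simp [a', a₁]
  refine ⟨a', fun g hg i => ?_⟩
  have h0 : 𝒢.tgt (𝒢.mul h g) = 𝒢.tgt h := 𝒢.tgt_mul _ _ hg
  have h1 := mfderiv_mul_const (g := g) hcd (by rw [hc0, hg]) (by rw [← hg]; exact hcs) (w i)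
    (𝒢.algebroidFrame (𝒢.tgt g) i) ((𝒢.algebroidFrame_congr hg.symm i).trans (hw i).symm)
  have h2 := mfderiv_mul_const (g := 𝒢.mul h g) hkd (by rw [hk0, h0])
    (by rw [h0]; exact hks) (w i) (a' (𝒢.tgt (𝒢.mul h g)) i) (ha' _ h0 i)
  have hcg : ∀ᶠ z in nhds (0 : Euc r), 𝒢.src (c z) = 𝒢.tgt g := by rw [← hg]; exact hcs
  have h3 := contMDiffAt_mul hc (contMDiffAt_const (c := g)) hcg.self_of_nhds hcg
  rw [← h1, ← h2, ← mfderiv_comp_apply' ((B.contMDiffAt_leftMul hg).mdifferentiableAt (by simp))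
    (h3.mdifferentiableAt (by simp)) (by rw [hc0, hg, 𝒢.unit_mul])]
  refine mfderiv_eq_of_eventuallyEq ?_ _
  filter_upwards [hls, hcls, hcg] with z h4 h5 h6
  have h7 : 𝒢.tgt (𝒢.inv h) = 𝒢.src h := 𝒢.tgt_inv h
  calc B.leftMul (𝒢.mul (c z) g) = 𝒢.mul (B.leftMul (c z)) g := by
        rw [leftMul, leftMul, 𝒢.tgt_mul _ _ h6, 𝒢.mul_assoc _ _ _ h4 h6]
    _ = 𝒢.mul (k z) (𝒢.mul h g) := by
        have h8 : 𝒢.src (k z) = 𝒢.tgt h := by rw [hk, 𝒢.src_mul _ _ h5, 𝒢.src_inv]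
        rw [← 𝒢.mul_assoc _ _ _ h8 hg, 𝒢.mul_inv_mul_cancel (h5.trans h7)]

/-- Multiplication by `h` from the left changes the factor by which arrows act by a constant. -/
lemma exists_actionFactor_mul (B : 𝒢.LocalBisection h) : ∃ κ : ℝ, ∀ g : G, 𝒢.src h = 𝒢.tgt g →
    𝒢.actionFactor (𝒢.mul h g) = κ * 𝒢.actionFactor g := by
  obtain ⟨a', ha'⟩ := B.exists_conjugateFrame
  let Dt : Euc n →ₗ[ℝ] Euc n :=
    (mfderiv (𝓡 n) (𝓡 n) (fun y => 𝒢.tgt (B.β y)) (𝒢.src h)).toLinearMap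
  -- `tgt ∘ β` moves the frame `tangentFrame` at `src h`, the standard basis of the model space, to a
  -- frame at `tgt h`; a constant family on the base extends it
  obtain ⟨vT, hvT, -⟩ := exists_basis_map Dt B.mfderiv_tgt_β_injective
    (EuclideanSpace.basisFun (Fin n) ℝ).toBasis
  let v' : ∀ x : M, Module.Basis (Fin n) ℝ (TangentSpace (𝓡 n) x) := fun x => vT
  refine ⟨(𝒢.frameFactor a' v' (𝒢.tgt h))⁻¹, fun g hg => ?_⟩
  have hu := (𝒢.frameFactor_pos a' v' (𝒢.tgt h)).ne'
  rw [eq_inv_mul_iff_mul_eq₀ hu]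
  have h0 : 𝒢.tgt (𝒢.mul h g) = 𝒢.tgt h := 𝒢.tgt_mul _ _ hg
  have h0' : 𝒢.src (𝒢.mul h g) = 𝒢.src g := 𝒢.src_mul _ _ hg
  rw [← h0]
  -- the frame at `h g`
  let dL : Euc (n + r) →ₗ[ℝ] Euc (n + r) :=
    (mfderiv (𝓡 (n + r)) (𝓡 (n + r)) B.leftMul g).toLinearMap
  obtain ⟨b, hb, hbdet⟩ := exists_basis_map dL (B.mfderiv_leftMul_injective hg)
    (𝒢.adaptedFrame g : Module.Basis (Fin r ⊕ Fin n) ℝ (Euc (n + r)))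
  have hbA : 𝒢.IsAdapted (𝒢.mul h g) (a' _) (tangentFrame n _) b := by
    refine ⟨fun i => ?_, fun j => ?_⟩
    · refine (hb _).trans (Eq.trans ?_ (ha' g hg i))
      exact congrArg dL ((𝒢.isAdapted_adaptedFrame g).1 i)
    · refine (congrArg (mfderiv (𝓡 (n + r)) (𝓡 n) 𝒢.src (𝒢.mul h g)) (hb (Sum.inr j))).trans ?_
      exact (B.mfderiv_src_leftMul hg _).trans ((𝒢.isAdapted_adaptedFrame g).2 j)
  -- right translation by the inverse bisection, and the frame at `(h g)⁻¹`
  let R : G → G := fun k => 𝒢.inv (B.leftMul (𝒢.inv k))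
  have hRg : R (𝒢.inv g) = 𝒢.inv (𝒢.mul h g) := by
    change 𝒢.inv (B.leftMul (𝒢.inv (𝒢.inv g))) = _
    rw [𝒢.inv_inv, B.leftMul_apply hg]
  have hLi : ContMDiffAt (𝓡 (n + r)) (𝓡 (n + r)) ∞ (fun k => B.leftMul (𝒢.inv k)) (𝒢.inv g) :=
    ContMDiffAt.comp _ (by rw [𝒢.inv_inv]; exact B.contMDiffAt_leftMul hg)
      𝒢.contMDiff_inv.contMDiffAt
  have hR : ContMDiffAt (𝓡 (n + r)) (𝓡 (n + r)) ∞ R (𝒢.inv g) :=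
    ContMDiffAt.comp _ 𝒢.contMDiff_inv.contMDiffAt hLi
  have hRd := hR.mdifferentiableAt (n := ∞) (by simp)
  let dR : Euc (n + r) →ₗ[ℝ] Euc (n + r) :=
    (mfderiv (𝓡 (n + r)) (𝓡 (n + r)) R (𝒢.inv g)).toLinearMap
  -- the two translations are conjugate under the inversion, which compares the two determinants
  have hdRL : ∀ X : Euc (n + r), (𝒢.invDeriv (𝒢.mul h g) (dR X) : Euc (n + r)) =
      dL (𝒢.invDeriv g X) := by
    intro X
    refine (𝒢.invDeriv_mfderiv hRd hRg X).trans ?_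
    refine (mfderiv_eq_of_eventuallyEq (f' := fun k => B.leftMul (𝒢.inv k))
      (.of_forall fun k => 𝒢.inv_inv _) X).trans ?_
    exact mfderiv_comp_apply' ((B.contMDiffAt_leftMul hg).mdifferentiableAt (by simp))
      𝒢.mdifferentiable_inv.mdifferentiableAt (𝒢.inv_inv g) X
  have hdRinj : ∀ X, dR X = 0 → X = 0 := by
    intro X hX
    have h1 := hdRL X
    rw [hX] at h1
    have h2 := B.mfderiv_leftMul_injective hg _
      (h1.symm.trans (map_zero (𝒢.invDeriv (𝒢.mul h g))))
    exact 𝒢.mfderiv_inv_injective _ X h2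
  obtain ⟨b', hb', -⟩ := exists_basis_map dR hdRinj
    (𝒢.adaptedFrame (𝒢.inv g) : Module.Basis (Fin r ⊕ Fin n) ℝ (Euc (n + r)))
  have hbA' : 𝒢.IsAdapted (𝒢.inv (𝒢.mul h g)) (𝒢.algebroidFrame _) (v' _) b' := by
    refine ⟨fun i => ?_, fun j => ?_⟩
    · refine (hb' _).trans ((congrArg dR ((𝒢.isAdapted_adaptedFrame (𝒢.inv g)).1 i)).trans ?_)
      obtain ⟨c, hc, hc0, hcs, hcA⟩ := 𝒢.exists_unit_slice (𝒢.tgt (𝒢.inv g))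
      have hcd := hc.mdifferentiableAt (n := ∞) (by simp)
      obtain ⟨w, hw⟩ := hcA (𝒢.algebroidFrame (𝒢.tgt (𝒢.inv g)) i)
      have hy : 𝒢.tgt (𝒢.inv (𝒢.mul h g)) = 𝒢.tgt (𝒢.inv g) := by
        rw [𝒢.tgt_inv, 𝒢.tgt_inv, h0']
      have h1 := mfderiv_mul_const (g := 𝒢.inv g) hcd hc0 hcs w _ hw.symm
      have h2 := mfderiv_mul_const (g := 𝒢.inv (𝒢.mul h g)) hcd (by rw [hc0, hy])
        (by rw [hy]; exact hcs) w (𝒢.algebroidFrame (𝒢.tgt (𝒢.inv (𝒢.mul h g))) i)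
        ((𝒢.algebroidFrame_congr hy i).trans hw.symm)
      have h3 := contMDiffAt_mul hc (contMDiffAt_const (c := 𝒢.inv g)) hcs.self_of_nhds hcs
      refine (congrArg dR h1).symm.trans (Eq.trans ?_ h2)
      refine (mfderiv_comp_apply' hRd (h3.mdifferentiableAt (by simp))
        (by rw [hc0, 𝒢.unit_mul]) w).symm.trans ?_
      refine mfderiv_eq_of_eventuallyEq ?_ _
      filter_upwards [hcs] with z hz
      change 𝒢.inv (B.leftMul (𝒢.inv (𝒢.mul (c z) (𝒢.inv g)))) = _
      have hz' : 𝒢.src g = 𝒢.tgt (𝒢.inv (c z)) := by rw [𝒢.tgt_inv, hz, 𝒢.tgt_inv]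
      rw [𝒢.inv_mul_rev hz, 𝒢.inv_inv, leftMul, 𝒢.tgt_mul _ _ hz', ← hg, B.apply_src,
        ← 𝒢.mul_assoc _ _ _ hg hz', 𝒢.inv_mul_rev (h0'.trans hz'), 𝒢.inv_inv]
    · refine (congrArg (mfderiv (𝓡 (n + r)) (𝓡 n) 𝒢.src _) (hb' (Sum.inr j))).trans ?_
      refine (mfderiv_comp_apply' 𝒢.mdifferentiable_src.mdifferentiableAt hRd hRg _).symm.trans ?_
      have hi : 𝒢.src (𝒢.inv g) = 𝒢.src h := by rw [𝒢.src_inv, hg]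
      refine (mfderiv_eq_of_eventuallyEq (f' := fun k => 𝒢.tgt (B.β (𝒢.src k))) ?_ _).trans ?_
      · have h4 := B.eventually_tgt_leftMul hg
        rw [← 𝒢.inv_inv g] at h4
        filter_upwards [𝒢.contMDiff_inv.continuous.continuousAt.eventually h4] with k hk
        change 𝒢.src (𝒢.inv (B.leftMul (𝒢.inv k))) = _
        rw [𝒢.src_inv, hk, 𝒢.tgt_inv]
      · refine (mfderiv_comp_apply' (B.contMDiffAt_tgt_β.mdifferentiableAt (by simp))
          𝒢.mdifferentiable_src.mdifferentiableAt hi _).trans ?_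
        refine Eq.trans ?_ (hvT j).symm
        exact congrArg Dt ((𝒢.isAdapted_adaptedFrame (𝒢.inv g)).2 j)
  have h1 := 𝒢.abs_det_invDeriv a' 𝒢.algebroidFrame (tangentFrame n) v' hbA hbA'
  have h2 : b.det (fun k => (𝒢.invDeriv (𝒢.mul h g) (b' k) : Euc (n + r))) =
      (𝒢.adaptedFrame g).det (fun k => 𝒢.invDeriv g (𝒢.adaptedFrame (𝒢.inv g) k)) := by
    refine Eq.trans ?_ (hbdet _)
    congr 1
    ext1 k
    exact (congrArg (𝒢.invDeriv (𝒢.mul h g)) (hb' k)).trans (hdRL _)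
  have h3 := (congrArg abs h2).symm.trans h1
  rw [Module.Basis.det_self, Module.Basis.det_self, abs_one, mul_one, one_mul] at h3
  rw [frameFactor]
  refine Eq.trans ?_ h3.symm
  ring

end LocalBisection

end LieGroupoid

/-! ### Determinants of block triangular families -/

section BlockDet

variable {ι κ : Type*} [Fintype ι] [DecidableEq ι] [Fintype κ] [DecidableEq κ]
  {V W : Type*} [AddCommGroup V] [Module ℝ V] [AddCommGroup W] [Module ℝ W]
  (e : Module.Basis ι ℝ V) (e' : Module.Basis κ ℝ W)

lemma det_prod_of_inl_snd_eq_zero {x : ι ⊕ κ → V × W} {α : ι → V} {ν : κ → W}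
    (h1 : ∀ i, (x (Sum.inl i)).1 = α i) (h2 : ∀ i, (x (Sum.inl i)).2 = 0)
    (h3 : ∀ j, (x (Sum.inr j)).2 = ν j) :
    (e.prod e').det x = e.det α * e'.det ν := by
  have hM : (e.prod e').toMatrix x = Matrix.fromBlocks (e.toMatrix α)
      (Matrix.of fun i j => e.repr (x (Sum.inr j)).1 i) 0 (e'.toMatrix ν) := by
    ext i j
    rcases i with i | i <;> rcases j with j | j <;> simp [Module.Basis.toMatrix_apply, *]
  rw [Module.Basis.det_apply, hM, Matrix.det_fromBlocks_zero₂₁, Module.Basis.det_apply,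
    Module.Basis.det_apply]

lemma det_prod_of_inr_fst_eq_zero {x : ι ⊕ κ → V × W} {α : ι → V} {ν : κ → W}
    (h1 : ∀ i, (x (Sum.inl i)).1 = α i) (h2 : ∀ j, (x (Sum.inr j)).1 = 0)
    (h3 : ∀ j, (x (Sum.inr j)).2 = ν j) :
    (e.prod e').det x = e.det α * e'.det ν := by
  have hM : (e.prod e').toMatrix x = Matrix.fromBlocks (e.toMatrix α) 0
      (Matrix.of fun i j => e'.repr (x (Sum.inl j)).2 i) (e'.toMatrix ν) := by
    ext i j
    rcases i with i | i <;> rcases j with j | j <;> simp [Module.Basis.toMatrix_apply, *]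
  rw [Module.Basis.det_apply, hM, Matrix.det_fromBlocks_zero₁₂, Module.Basis.det_apply,
    Module.Basis.det_apply]

/-- A family in `V × W` that becomes block triangular after replacing the second coordinate by the
linear function `D`. -/
lemma det_prod_mul_det {x : ι ⊕ κ → V × W} {α : ι → V} {ν : κ → W} (D : V × W →ₗ[ℝ] W)
    (h1 : ∀ i, (x (Sum.inl i)).1 = α i) (h2 : ∀ i, D (x (Sum.inl i)) = 0)
    (h3 : ∀ j, D (x (Sum.inr j)) = ν j) :
    e'.det (fun j => D (0, e' j)) * (e.prod e').det x = e.det α * e'.det ν := by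
  let Q : V × W →ₗ[ℝ] V × W := (LinearMap.fst ℝ V W).prod D
  have hQ : LinearMap.det Q = e'.det (fun j => D (0, e' j)) := by
    have h := (e.prod e').det_comp Q (e.prod e')
    rw [Module.Basis.det_self, mul_one] at h
    rw [← h, det_prod_of_inr_fst_eq_zero e e' (α := e) (ν := fun j => D (0, e' j)),
      Module.Basis.det_self, one_mul] <;> simp [Q]
  rw [← hQ, ← Module.Basis.det_comp]
  exact det_prod_of_inl_snd_eq_zero e e' h1 h2 h3

/-- The determinant of the family `x` in the frame `b`, when in the coordinates `P` the frame `b` is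
adapted to the projection to `W` and the image of `x` is adapted to the projection `D`. This is the
shape of the differential of the inversion, where the two projections are the differentials of the
source and of the target. -/
lemma log_abs_det_of_adapted {U : Type*} [AddCommGroup U] [Module ℝ U]
    (P : U →ₗ[ℝ] V × W) (D : V × W →ₗ[ℝ] W) (b : Module.Basis (ι ⊕ κ) ℝ U) (x : ι ⊕ κ → U)
    {α α' : ι → V} {ν ν' : κ → W}
    (hb1 : ∀ i, P (b (Sum.inl i)) = (α i, 0)) (hb2 : ∀ j, (P (b (Sum.inr j))).2 = ν j)
    (hx1 : ∀ i, (P (x (Sum.inl i))).1 = - α' i) (hx2 : ∀ i, D (P (x (Sum.inl i))) = 0)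
    (hx3 : ∀ j, D (P (x (Sum.inr j))) = ν' j)
    (hα : e.det α ≠ 0) (hα' : e.det α' ≠ 0) (hν : e'.det ν ≠ 0) (hν' : e'.det ν' ≠ 0)
    (hD : e'.det (fun j => D (0, e' j)) ≠ 0) :
    Real.log |b.det x| = Real.log |e.det α'| + Real.log |e'.det ν'|
      - Real.log |e'.det (fun j => D (0, e' j))| - Real.log |e.det α| - Real.log |e'.det ν| := by
  have h1 : (e.prod e').det (fun k => P (b k)) = e.det α * e'.det ν :=
    det_prod_of_inl_snd_eq_zero e e' (fun i => by rw [hb1]) (fun i => by rw [hb1]) hb2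
  have h2 : e'.det (fun j => D (0, e' j)) * (e.prod e').det (fun k => P (x k)) =
      e.det (fun i => - α' i) * e'.det ν' :=
    det_prod_mul_det e e' D hx1 hx2 hx3
  have h3 : |e.det (fun i => - α' i)| = |e.det α'| := by
    have h := e.det_comp (-LinearMap.id) α'
    have h4 : (fun i => - α' i) = (-LinearMap.id : V →ₗ[ℝ] V) ∘ α' := by ext1 i; simp
    have h5 : |LinearMap.det (-LinearMap.id : V →ₗ[ℝ] V)| = 1 := by
      have h6 := LinearMap.det_comp (-LinearMap.id : V →ₗ[ℝ] V) (-LinearMap.id)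
      have h7 : (-LinearMap.id : V →ₗ[ℝ] V) ∘ₗ (-LinearMap.id) = LinearMap.id := by ext; simp
      rw [h7, LinearMap.det_id] at h6
      rcases mul_self_eq_one_iff.1 h6.symm with h | h <;> simp [h]
    rw [h4, h, abs_mul, h5, one_mul]
  have h4 : (e.prod e').det (fun k => P (x k)) =
      (e.prod e').det (fun k => P (b k)) * b.det x := by
    have h5 := ((e.prod e').det.compLinearMap P).eq_smul_basis_det b
    have h6 := congrArg (fun f => f x) h5
    simpa using h6
  have hx : b.det x ≠ 0 := by
    intro h
    rw [h4, h, mul_zero, mul_zero] at h2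
    have h5 := congrArg abs h2
    rw [abs_mul, h3, abs_zero, ← abs_mul, eq_comm, abs_eq_zero] at h5
    exact mul_ne_zero hα' hν' h5
  rw [h4, h1] at h2
  have h5 := congrArg (fun t => Real.log |t|) h2
  simp only [abs_mul, h3] at h5
  rw [Real.log_mul, Real.log_mul, Real.log_mul, Real.log_mul] at h5
  · linarith
  all_goals simp only [ne_eq, abs_eq_zero, mul_eq_zero, not_or]
  all_goals tauto

end BlockDet

namespace LieGroupoid

variable {n r : ℕ} {M G : Type*}
  [TopologicalSpace M] [ChartedSpace (EuclideanSpace ℝ (Fin n)) M] [IsManifold (𝓡 n) ∞ M]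
  [TopologicalSpace G] [ChartedSpace (EuclideanSpace ℝ (Fin (n + r))) G]
  [IsManifold (𝓡 (n + r)) ∞ G] {𝒢 : LieGroupoid n r M G}

namespace AdaptedChart

variable {x₀ : M} (C : 𝒢.AdaptedChart x₀)

/-! ### The groupoid in an adapted chart -/

/-- The target map in an adapted chart. -/
def localTgt (z : Euc r × Euc n) : Euc n := C.q (𝒢.tgt (C.p.symm z))

/-- The product in an adapted chart, as in `localLogCocycle`. -/
def localMul (z : Euc r × Euc r × Euc n) : Euc r :=
  (C.p (𝒢.mul (C.p.symm (z.1, C.localTgt z.2)) (C.p.symm z.2))).1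

/-- A section of the Lie algebroid in an adapted chart. -/
def localSection (α : ∀ x, 𝒢.algebroid x) (y : Euc n) : Euc r :=
  (mfderiv (𝓡 (n + r)) 𝓘(ℝ, Euc r × Euc n) C.p (𝒢.unit (C.q.symm y))
    (α (C.q.symm y)).1 : Euc r × Euc n).1

/-- A vector field on the base in an adapted chart. -/
def localField (v : ∀ x : M, TangentSpace (𝓡 n) x) (y : Euc n) : Euc n :=
  mfderiv (𝓡 n) 𝓘(ℝ, Euc n) C.q (C.q.symm y) (v (C.q.symm y))

lemma p_eq {g : G} (hg : g ∈ C.p.source) : C.p g = ((C.p g).1, C.q (𝒢.src g)) :=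
  Prod.ext rfl (C.snd_p g hg)

lemma src_symm {z : Euc r × Euc n} (hz : z ∈ C.p.target) : 𝒢.src (C.p.symm z) = C.q.symm z.2 := by
  have h1 := C.p.map_target hz
  have h2 := C.snd_p _ h1
  rw [C.p.right_inv hz] at h2
  rw [h2, C.q.left_inv (C.src_mem _ h1)]

lemma snd_mem_target {z : Euc r × Euc n} (hz : z ∈ C.p.target) : z.2 ∈ C.q.target := by
  have h1 := C.p.map_target hz
  have h2 := C.snd_p _ h1
  rw [C.p.right_inv hz] at h2
  rw [h2]
  exact C.q.map_source (C.src_mem _ h1)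

lemma zero_mem_target {y : Euc n} (hy : y ∈ C.q.target) : ((0 : Euc r), y) ∈ C.p.target := by
  have h1 := C.p.map_source (C.unit_mem _ (C.q.map_target hy))
  rwa [C.p_unit _ (C.q.map_target hy), C.q.right_inv hy] at h1

lemma symm_zero {y : Euc n} (hy : y ∈ C.q.target) : C.p.symm (0, y) = 𝒢.unit (C.q.symm y) := by
  have h1 := C.p_unit _ (C.q.map_target hy)
  rw [C.q.right_inv hy] at h1
  rw [← h1, C.p.left_inv (C.unit_mem _ (C.q.map_target hy))]

lemma localTgt_mem {z : Euc r × Euc n} (hz : z ∈ C.p.target) : C.localTgt z ∈ C.q.target :=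
  C.q.map_source (C.tgt_mem _ (C.p.map_target hz))

lemma symm_localTgt {z : Euc r × Euc n} (hz : z ∈ C.p.target) :
    C.q.symm (C.localTgt z) = 𝒢.tgt (C.p.symm z) :=
  C.q.left_inv (C.tgt_mem _ (C.p.map_target hz))

lemma localTgt_p {g : G} (hg : g ∈ C.p.source) : C.localTgt (C.p g) = C.q (𝒢.tgt g) := by
  rw [localTgt, C.p.left_inv hg]

lemma localTgt_zero {y : Euc n} (hy : y ∈ C.q.target) : C.localTgt (0, y) = y := by
  rw [localTgt, C.symm_zero hy, 𝒢.tgt_unit, C.q.right_inv hy]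

lemma contDiffAt_localTgt {z : Euc r × Euc n} (hz : z ∈ C.p.target) :
    ContDiffAt ℝ ∞ C.localTgt z := by
  rw [← contMDiffAt_iff_contDiffAt]
  exact ContMDiffAt.comp z (C.smooth_q.contMDiffAt (C.tgt_mem _ (C.p.map_target hz)))
    (ContMDiffAt.comp z 𝒢.contMDiff_tgt.contMDiffAt (C.smooth_p.contMDiffAt_symm hz))

lemma composable {z : Euc r × Euc r × Euc n} (hz : z.2 ∈ C.p.target)
    (hz' : (z.1, C.localTgt z.2) ∈ C.p.target) :
    𝒢.src (C.p.symm (z.1, C.localTgt z.2)) = 𝒢.tgt (C.p.symm z.2) := by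
  rw [C.src_symm hz', C.symm_localTgt hz]

lemma contDiffAt_localMul {z : Euc r × Euc r × Euc n} (hz : z.2 ∈ C.p.target)
    (hz' : (z.1, C.localTgt z.2) ∈ C.p.target)
    (hm : 𝒢.mul (C.p.symm (z.1, C.localTgt z.2)) (C.p.symm z.2) ∈ C.p.source) :
    ContDiffAt ℝ ∞ C.localMul z := by
  have hT : ContDiffAt ℝ ∞ (fun z : Euc r × Euc r × Euc n => (z.1, C.localTgt z.2)) z :=
    contDiffAt_fst.prodMk (ContDiffAt.comp (g := C.localTgt) z (C.contDiffAt_localTgt hz) contDiffAt_snd)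
  have hs : ContDiffAt ℝ ∞ (fun z : Euc r × Euc r × Euc n => z.2) z := contDiffAt_snd
  have h1 : ∀ᶠ z' : Euc r × Euc r × Euc n in nhds z, z'.2 ∈ C.p.target :=
    hs.continuousAt (C.p.open_target.mem_nhds hz)
  have h2 : ∀ᶠ z' : Euc r × Euc r × Euc n in nhds z, (z'.1, C.localTgt z'.2) ∈ C.p.target :=
    hT.continuousAt (C.p.open_target.mem_nhds hz')
  have h3 := contMDiffAt_mul (𝒢 := 𝒢)
    (f := fun z : Euc r × Euc r × Euc n => C.p.symm (z.1, C.localTgt z.2))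
    (k := fun z => C.p.symm z.2)
    (ContMDiffAt.comp z (C.smooth_p.contMDiffAt_symm hz') hT.contMDiffAt)
    (ContMDiffAt.comp z (C.smooth_p.contMDiffAt_symm hz) hs.contMDiffAt)
    (C.composable hz hz') (by filter_upwards [h1, h2] with z' using C.composable)
  exact (contMDiffAt_iff_contDiffAt.1
    (ContMDiffAt.comp z (C.smooth_p.contMDiffAt hm) h3)).fst

lemma mul_left_unit {z : Euc r × Euc n} (hz : z ∈ C.p.target) :
    𝒢.mul (C.p.symm (0, C.localTgt z)) (C.p.symm z) = C.p.symm z := by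
  rw [C.symm_zero (C.localTgt_mem hz), C.symm_localTgt hz, 𝒢.unit_mul]

lemma mul_right_unit {z : Euc r × Euc n} (hz : z ∈ C.p.target) :
    𝒢.mul (C.p.symm (z.1, C.localTgt (0, z.2))) (C.p.symm (0, z.2)) = C.p.symm z := by
  rw [C.localTgt_zero (C.snd_mem_target hz), C.symm_zero (C.snd_mem_target hz), ← C.src_symm hz,
    𝒢.mul_unit]

lemma contDiffAt_localMul_left {z : Euc r × Euc n} (hz : z ∈ C.p.target) :
    ContDiffAt ℝ ∞ C.localMul (0, z) :=
  C.contDiffAt_localMul hz (C.zero_mem_target (C.localTgt_mem hz))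
    (by rw [C.mul_left_unit hz]; exact C.p.map_target hz)

lemma contDiffAt_localMul_right {z : Euc r × Euc n} (hz : z ∈ C.p.target) :
    ContDiffAt ℝ ∞ C.localMul (z.1, 0, z.2) :=
  C.contDiffAt_localMul (C.zero_mem_target (C.snd_mem_target hz))
    (by rw [C.localTgt_zero (C.snd_mem_target hz)]; exact hz)
    (by rw [C.mul_right_unit hz]; exact C.p.map_target hz)

lemma localMul_left {z : Euc r × Euc n} (hz : z ∈ C.p.target) : C.localMul (0, z) = z.1 := by
  rw [localMul, C.mul_left_unit hz, C.p.right_inv hz]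

lemma localMul_right {z : Euc r × Euc n} (hz : z ∈ C.p.target) :
    C.localMul (z.1, 0, z.2) = z.1 := by
  rw [localMul, C.mul_right_unit hz, C.p.right_inv hz]

lemma fderiv_localTgt_zero {y : Euc n} (hy : y ∈ C.q.target) (η : Euc n) :
    fderiv ℝ C.localTgt (0, y) (0, η) = η := by
  have h1 : HasFDerivAt (fun y : Euc n => C.localTgt (0, y))
      (fderiv ℝ C.localTgt (0, y) ∘L ContinuousLinearMap.inr ℝ (Euc r) (Euc n)) y :=
    HasFDerivAt.comp y (C.contDiffAt_localTgt (C.zero_mem_target hy)).hasFDerivAt_fderiv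
      (hasFDerivAt_prodMk_right (𝕜 := ℝ) (0 : Euc r) y)
  have h2 : (fun y : Euc n => C.localTgt (0, y)) =ᶠ[nhds y] id := by
    filter_upwards [C.q.open_target.mem_nhds hy] with y' hy' using C.localTgt_zero hy'
  have h3 := (hasFDerivAt_id (𝕜 := ℝ) y).congr_of_eventuallyEq h2
  exact congrArg (fun L : Euc n →L[ℝ] Euc n => L η) (h1.unique h3)

/-- Right multiplication by a unit is the identity. -/
lemma fderiv_localMul_right {z : Euc r × Euc n} (hz : z ∈ C.p.target) (w : Euc r) :
    fderiv ℝ C.localMul (z.1, 0, z.2) (w, 0, 0) = w := by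
  have h1 : HasFDerivAt (fun u : Euc r => C.localMul (u, 0, z.2))
      (fderiv ℝ C.localMul (z.1, 0, z.2) ∘L ContinuousLinearMap.inl ℝ (Euc r) (Euc r × Euc n)) z.1 :=
    HasFDerivAt.comp (g := C.localMul) z.1 (C.contDiffAt_localMul_right hz).hasFDerivAt_fderiv
      (hasFDerivAt_prodMk_left (𝕜 := ℝ) z.1 ((0 : Euc r), z.2))
  have h2 : (fun u : Euc r => C.localMul (u, 0, z.2)) =ᶠ[nhds z.1] id := by
    have hc : ContinuousAt (fun u : Euc r => (u, z.2)) z.1 := by fun_prop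
    filter_upwards [hc (C.p.open_target.mem_nhds hz)] with u hu using C.localMul_right hu
  have h3 := (hasFDerivAt_id (𝕜 := ℝ) z.1).congr_of_eventuallyEq h2
  exact congrArg (fun L : Euc r →L[ℝ] Euc r => L w) (h1.unique h3)

lemma fderiv_localMul_left {z : Euc r × Euc n} (hz : z ∈ C.p.target) (w : Euc r) :
    fderiv ℝ C.localMul (0, z) (0, w, 0) = w := by
  have h1 : HasFDerivAt (fun u : Euc r => C.localMul (0, u, z.2))
      (fderiv ℝ C.localMul (0, z) ∘L (ContinuousLinearMap.inr ℝ (Euc r) (Euc r × Euc n) ∘L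
        ContinuousLinearMap.inl ℝ (Euc r) (Euc n))) z.1 :=
    HasFDerivAt.comp (g := C.localMul) (f := fun u : Euc r => (0, u, z.2)) z.1
      (C.contDiffAt_localMul_left hz).hasFDerivAt_fderiv
      ((hasFDerivAt_prodMk_right (𝕜 := ℝ) (0 : Euc r) z).comp z.1
        (hasFDerivAt_prodMk_left (𝕜 := ℝ) z.1 z.2))
  have h2 : (fun u : Euc r => C.localMul (0, u, z.2)) =ᶠ[nhds z.1] id := by
    have hc : ContinuousAt (fun u : Euc r => (u, z.2)) z.1 := by fun_prop
    filter_upwards [hc (C.p.open_target.mem_nhds hz)] with u hu using C.localMul_left hu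
  have h3 := (hasFDerivAt_id (𝕜 := ℝ) z.1).congr_of_eventuallyEq h2
  exact congrArg (fun L : Euc r →L[ℝ] Euc r => L w) (h1.unique h3)

/-! ### Tangent vectors in an adapted chart -/

/-- The coordinates of a tangent vector of the groupoid. -/
def dp (g : G) : Euc (n + r) →L[ℝ] Euc r × Euc n := mfderiv (𝓡 (n + r)) 𝓘(ℝ, Euc r × Euc n) C.p g

/-- The coordinates of a tangent vector of the base. -/
def dq (x : M) : Euc n →L[ℝ] Euc n := mfderiv (𝓡 n) 𝓘(ℝ, Euc n) C.q x

lemma mdifferentiableAt_p {g : G} (hg : g ∈ C.p.source) :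
    MDifferentiableAt (𝓡 (n + r)) 𝓘(ℝ, Euc r × Euc n) C.p g :=
  (C.smooth_p.contMDiffAt hg).mdifferentiableAt (by simp)

lemma mdifferentiableAt_q {x : M} (hx : x ∈ C.q.source) :
    MDifferentiableAt (𝓡 n) 𝓘(ℝ, Euc n) C.q x :=
  (C.smooth_q.contMDiffAt hx).mdifferentiableAt (by simp)

lemma mdifferentiableAt_symm {z : Euc r × Euc n} (hz : z ∈ C.p.target) :
    MDifferentiableAt 𝓘(ℝ, Euc r × Euc n) (𝓡 (n + r)) C.p.symm z :=
  (C.smooth_p.contMDiffAt_symm hz).mdifferentiableAt (by simp)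

lemma mfderiv_symm_dp {g : G} (hg : g ∈ C.p.source) (X : Euc (n + r)) :
    (mfderiv 𝓘(ℝ, Euc r × Euc n) (𝓡 (n + r)) C.p.symm (C.p g) (C.dp g X) : Euc (n + r)) = X := by
  refine (mfderiv_comp_apply' (C.mdifferentiableAt_symm (C.p.map_source hg))
    (C.mdifferentiableAt_p hg) rfl X).symm.trans ?_
  refine (mfderiv_eq_of_eventuallyEq (f' := fun h => h)
        (by filter_upwards [C.p.open_source.mem_nhds hg] with h hh using C.p.left_inv hh) X).trans ?_
  exact congrArg (fun L : Euc (n + r) →L[ℝ] Euc (n + r) => L X)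
      (mfderiv_id (I := 𝓡 (n + r)) (x := g))

lemma snd_dp {g : G} (hg : g ∈ C.p.source) (X : Euc (n + r)) :
    (C.dp g X).2 = C.dq (𝒢.src g) (mfderiv (𝓡 (n + r)) (𝓡 n) 𝒢.src g X : Euc n) := by
  have hs : MDifferentiableAt 𝓘(ℝ, Euc r × Euc n) 𝓘(ℝ, Euc n)
            (Prod.snd : Euc r × Euc n → Euc n) (C.p g) := differentiableAt_snd.mdifferentiableAt
  have h1 := mfderiv_comp_apply' hs (C.mdifferentiableAt_p hg) rfl X
  rw [mfderiv_eq_fderiv, fderiv_snd] at h1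
  refine h1.symm.trans ?_
  refine (mfderiv_eq_of_eventuallyEq (f' := fun h => C.q (𝒢.src h))
    (by filter_upwards [C.p.open_source.mem_nhds hg] with h hh using C.snd_p h hh) X).trans ?_
  exact mfderiv_comp_apply' (C.mdifferentiableAt_q (C.src_mem g hg))
    𝒢.mdifferentiable_src.mdifferentiableAt rfl X

lemma fderiv_localTgt_dp {g : G} (hg : g ∈ C.p.source) (X : Euc (n + r)) :
    fderiv ℝ C.localTgt (C.p g) (C.dp g X) =
      C.dq (𝒢.tgt g) (mfderiv (𝓡 (n + r)) (𝓡 n) 𝒢.tgt g X : Euc n) := by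
  have h1 := mfderiv_comp_apply' (J₂ := 𝓘(ℝ, Euc n))
    ((C.contDiffAt_localTgt (C.p.map_source hg)).differentiableAt
    (by simp)).mdifferentiableAt (C.mdifferentiableAt_p hg) rfl X
  rw [mfderiv_eq_fderiv] at h1
  refine h1.symm.trans ?_
  refine (mfderiv_eq_of_eventuallyEq (f' := fun h => C.q (𝒢.tgt h))
    (by filter_upwards [C.p.open_source.mem_nhds hg] with h hh using C.localTgt_p hh) X).trans ?_
  exact mfderiv_comp_apply' (C.mdifferentiableAt_q (C.tgt_mem g hg))
    𝒢.mdifferentiable_tgt.mdifferentiableAt rfl X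

lemma localField_q (v : ∀ x : M, TangentSpace (𝓡 n) x) {x : M} (hx : x ∈ C.q.source) :
    C.localField v (C.q x) = C.dq x (v x) := by
  rw [localField, C.q.left_inv hx]
  rfl

lemma dp_section (α : ∀ x, 𝒢.algebroid x) {x : M} (hx : x ∈ C.q.source) :
    C.dp (𝒢.unit x) (α x).1 = (C.localSection α (C.q x), 0) := by
  refine Prod.ext ?_ ?_
  · rw [localSection, C.q.left_inv hx]; rfl
  · exact (C.snd_dp (C.unit_mem x hx) _).trans
      ((congrArg _ (𝒢.algebroid_mfderiv_src (α x))).trans (map_zero _))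

/-- The slice of the source fibre of `x` at the unit given by the chart. -/
def slice (x : M) (w : Euc r) : G := C.p.symm (w, C.q x)

section slice

variable {x : M} (hx : x ∈ C.q.source)

include hx

lemma slice_zero : C.slice x 0 = 𝒢.unit x := by
  rw [slice, C.symm_zero (C.q.map_source hx), C.q.left_inv hx]

lemma eventually_slice : ∀ᶠ w in nhds (0 : Euc r), (w, C.q x) ∈ C.p.target := by
  have hc : ContinuousAt (fun w : Euc r => (w, C.q x)) 0 := by fun_prop
  exact hc (C.p.open_target.mem_nhds (C.zero_mem_target (C.q.map_source hx)))

lemma src_slice : ∀ᶠ w in nhds (0 : Euc r), 𝒢.src (C.slice x w) = x := by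
  filter_upwards [C.eventually_slice hx] with w hw
  rw [slice, C.src_symm hw, C.q.left_inv hx]

lemma contMDiffAt_slice : ContMDiffAt 𝓘(ℝ, Euc r) (𝓡 (n + r)) ∞ (C.slice x) 0 := by
  have h : ContDiffAt ℝ ∞ (fun w : Euc r => (w, C.q x)) 0 := by fun_prop
  exact ContMDiffAt.comp (0 : Euc r)
    (C.smooth_p.contMDiffAt_symm (C.eventually_slice hx).self_of_nhds) h.contMDiffAt

lemma mfderiv_slice (α : ∀ x, 𝒢.algebroid x) :
    (mfderiv 𝓘(ℝ, Euc r) (𝓡 (n + r)) (C.slice x) 0 (C.localSection α (C.q x)) : Euc (n + r)) =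
      (α x).1 := by
  have h : HasFDerivAt (fun w : Euc r => (w, C.q x))
      (ContinuousLinearMap.inl ℝ (Euc r) (Euc n)) 0 := hasFDerivAt_prodMk_left _ _
  refine (mfderiv_comp_apply' (f := C.p.symm) (y := C.p (𝒢.unit x))
    (C.mdifferentiableAt_symm (C.p.map_source (C.unit_mem x hx)))
    h.differentiableAt.mdifferentiableAt (C.p_unit x hx).symm _).trans ?_
  rw [mfderiv_eq_fderiv, h.fderiv]
  refine Eq.trans ?_ (C.mfderiv_symm_dp (C.unit_mem x hx) (α x).1)
  rw [C.dp_section α hx]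
  rfl

end slice

/-- If `p ∘ c` is known near `z`, then so are the coordinates of the derivative of `c`. -/
lemma dp_mfderiv {g : G} (hg : g ∈ C.p.source) {c : Euc r → G} {z : Euc r}
    (hc : MDifferentiableAt 𝓘(ℝ, Euc r) (𝓡 (n + r)) c z) (hcz : c z = g)
    {f : Euc r → Euc r × Euc n} {f' : Euc r →L[ℝ] Euc r × Euc n} (hf : HasFDerivAt f f' z)
    (hfc : ∀ᶠ w in nhds z, C.p (c w) = f w) (v : Euc r) :
    C.dp g (mfderiv 𝓘(ℝ, Euc r) (𝓡 (n + r)) c z v : Euc (n + r)) = f' v := by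
  refine (mfderiv_comp_apply' (C.mdifferentiableAt_p hg) hc hcz v).symm.trans ?_
  refine (mfderiv_eq_of_eventuallyEq hfc v).trans ?_
  rw [mfderiv_eq_fderiv, hf.fderiv]
  rfl

/-- Right invariant vector fields in an adapted chart. -/
lemma dp_rightTranslation (α : ∀ x, 𝒢.algebroid x) {g : G} (hg : g ∈ C.p.source) :
    C.dp g (𝒢.rightTranslation g (α (𝒢.tgt g))) =
      localRightInvariant C.localMul C.localTgt (C.localSection α) (C.p g) := by
  have hx := C.tgt_mem g hg
  have hs := C.src_slice hx
  have hc := C.contMDiffAt_slice hx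
  have h1 := mfderiv_mul_const (hc.mdifferentiableAt (by simp)) (C.slice_zero hx) hs _ _
    (C.mfderiv_slice hx α).symm
  have h2 := contMDiffAt_mul hc (contMDiffAt_const (c := g)) hs.self_of_nhds hs
  have h3 : 𝒢.mul (C.slice (𝒢.tgt g) 0) g = g := by rw [C.slice_zero hx, 𝒢.unit_mul]
  have h4 : HasFDerivAt (fun w : Euc r => (C.localMul (w, C.p g), (C.p g).2))
      ((fderiv ℝ C.localMul (0, C.p g) ∘L
        ContinuousLinearMap.inl ℝ (Euc r) (Euc r × Euc n)).prod 0) 0 := by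
    refine HasFDerivAt.prodMk ?_ (hasFDerivAt_const _ _)
    exact HasFDerivAt.comp (0 : Euc r)
      (C.contDiffAt_localMul_left (C.p.map_source hg)).hasFDerivAt_fderiv
      (hasFDerivAt_prodMk_left (𝕜 := ℝ) (0 : Euc r) (C.p g))
  refine (congrArg (C.dp g) h1).symm.trans ?_
  refine (C.dp_mfderiv hg (h2.mdifferentiableAt (by simp)) h3 h4 ?_ _).trans ?_
  · have h5 : ∀ᶠ w in nhds (0 : Euc r), 𝒢.mul (C.slice (𝒢.tgt g) w) g ∈ C.p.source :=
      h2.continuousAt (C.p.open_source.mem_nhds (by rw [h3]; exact hg))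
    filter_upwards [h5, hs] with w hw hw'
    refine Prod.ext ?_ ?_
    · change _ = (C.p (𝒢.mul (C.p.symm (w, C.localTgt (C.p g))) (C.p.symm (C.p g)))).1
      rw [C.localTgt_p hg, C.p.left_inv hg]
      rfl
    · rw [C.snd_p _ hw, 𝒢.src_mul _ _ hw', ← C.snd_p _ hg]
  · rw [localRightInvariant, C.localTgt_p hg]
    rfl

/-- The anchor in an adapted chart. -/
lemma dq_anchor (α : ∀ x, 𝒢.algebroid x) {x : M} (hx : x ∈ C.q.source) :
    C.dq x (𝒢.anchor x (α x)) = localAnchor C.localTgt (C.localSection α) (C.q x) := by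
  have h1 := C.fderiv_localTgt_dp (C.unit_mem x hx) (α x).1
  rw [C.dp_section α hx, C.p_unit x hx, 𝒢.tgt_unit] at h1
  exact h1.symm

/-- The inversion carries right invariant vectors to left invariant ones. -/
lemma fst_dp_invDeriv (α : ∀ x, 𝒢.algebroid x) {g : G} (hg : g ∈ C.p.source) :
    (C.dp g (𝒢.invDeriv g (𝒢.rightTranslation (𝒢.inv g) (α (𝒢.tgt (𝒢.inv g)))))).1 =
      - fderiv ℝ C.localMul ((C.p g).1, 0, (C.p g).2) (0, C.localSection α (C.p g).2, 0) := by
  have hx := C.src_mem g hg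
  have hx' : 𝒢.tgt (𝒢.inv g) ∈ C.q.source := by rw [𝒢.tgt_inv]; exact hx
  have hy : 𝒢.tgt (𝒢.inv g) = 𝒢.src g := 𝒢.tgt_inv g
  have hs := C.src_slice hx'
  have hc := C.contMDiffAt_slice hx'
  have h1 := mfderiv_mul_const (hc.mdifferentiableAt (by simp)) (C.slice_zero hx') hs _ _
    (C.mfderiv_slice hx' α).symm
  have h2 := contMDiffAt_mul hc (contMDiffAt_const (c := 𝒢.inv g)) hs.self_of_nhds hs
  have h3 : 𝒢.mul (C.slice (𝒢.tgt (𝒢.inv g)) 0) (𝒢.inv g) = 𝒢.inv g := by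
    rw [C.slice_zero hx', 𝒢.unit_mul]
  set k : Euc r → G := fun w => 𝒢.inv (𝒢.mul (C.slice (𝒢.tgt (𝒢.inv g)) w) (𝒢.inv g)) with hk
  have hk0 : k 0 = g := by
    rw [hk]; change 𝒢.inv (𝒢.mul (C.slice (𝒢.tgt (𝒢.inv g)) 0) (𝒢.inv g)) = g
    rw [h3, 𝒢.inv_inv]
  have hkc : ContMDiffAt 𝓘(ℝ, Euc r) (𝓡 (n + r)) ∞ k 0 :=
    ContMDiffAt.comp (0 : Euc r) 𝒢.contMDiff_inv.contMDiffAt h2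
  have hkm : ∀ᶠ w in nhds (0 : Euc r), k w ∈ C.p.source :=
    hkc.continuousAt (C.p.open_source.mem_nhds (by rw [hk0]; exact hg))
  have h5 := (𝒢.invDeriv_mfderiv (h2.mdifferentiableAt (by simp)) h3
    (C.localSection α (C.q (𝒢.tgt (𝒢.inv g)))))
  have hpk : ContDiffAt ℝ ∞ (fun w => C.p (k w)) 0 := contMDiffAt_iff_contDiffAt.1
    (ContMDiffAt.comp (0 : Euc r) (C.smooth_p.contMDiffAt (by rw [hk0]; exact hg)) hkc)
  have hpk' := hpk.hasFDerivAt_fderiv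
  have h6 := C.dp_mfderiv hg (hkc.mdifferentiableAt (by simp)) hk0 hpk' (.of_forall fun _ => rfl)
    (C.localSection α (C.q (𝒢.tgt (𝒢.inv g))))
  have h7 : C.dp g (𝒢.invDeriv g (𝒢.rightTranslation (𝒢.inv g) (α (𝒢.tgt (𝒢.inv g))))) =
      fderiv ℝ (fun w => C.p (k w)) 0 (C.localSection α (C.p g).2) := by
    rw [C.snd_p g hg, ← hy]
    refine Eq.trans ?_ h6
    refine congrArg (C.dp g) ?_
    exact (congrArg (𝒢.invDeriv g) h1).symm.trans h5
  rw [h7]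
  -- differentiate the identity `k(w) · slice(w) = g`
  have h8 : ∀ᶠ w in nhds (0 : Euc r), C.localMul ((C.p (k w)).1, w, (C.p g).2) = (C.p g).1 := by
    filter_upwards [hkm, hs, C.eventually_slice hx'] with w hw hw' hw''
    have h9 : C.p.symm (w, (C.p g).2) = C.slice (𝒢.tgt (𝒢.inv g)) w := by
      rw [slice, C.snd_p g hg, hy]
    have h10 : (w, (C.p g).2) ∈ C.p.target := by rwa [C.snd_p g hg, ← hy]
    have h11 : 𝒢.src (k w) = 𝒢.tgt (C.slice (𝒢.tgt (𝒢.inv g)) w) := by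
      rw [hk, 𝒢.src_inv, 𝒢.tgt_mul _ _ hw']
    have h12 : C.p.symm ((C.p (k w)).1, C.localTgt (w, (C.p g).2)) = k w := by
      rw [localTgt, h9, ← h11, ← C.p_eq hw, C.p.left_inv hw]
    have h13 : k w = 𝒢.mul g (𝒢.inv (C.slice (𝒢.tgt (𝒢.inv g)) w)) := by
      rw [hk]; change 𝒢.inv (𝒢.mul (C.slice (𝒢.tgt (𝒢.inv g)) w) (𝒢.inv g)) = _
      rw [𝒢.inv_mul_rev hw', 𝒢.inv_inv]
    rw [localMul]
    change (C.p (𝒢.mul (C.p.symm ((C.p (k w)).1, C.localTgt (w, (C.p g).2)))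
      (C.p.symm (w, (C.p g).2)))).1 = _
    rw [h12, h9, h13, 𝒢.mul_inv_mul_cancel (by rw [hw', hy])]
  have h9 : HasFDerivAt (fun w => C.localMul ((C.p (k w)).1, w, (C.p g).2))
      (fderiv ℝ C.localMul ((C.p g).1, 0, (C.p g).2) ∘L
        ((ContinuousLinearMap.fst ℝ _ _ ∘L fderiv ℝ (fun w => C.p (k w)) 0).prod
          ((ContinuousLinearMap.id ℝ (Euc r)).prod 0))) 0 := by
    refine HasFDerivAt.comp (0 : Euc r)
      (f := fun w : Euc r => ((C.p (k w)).1, w, (C.p g).2)) (g := C.localMul) ?_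
      (hpk'.fst.prodMk ((hasFDerivAt_id (𝕜 := ℝ) (0 : Euc r)).prodMk (hasFDerivAt_const _ _)))
    rw [hk0]
    exact (C.contDiffAt_localMul_right (C.p.map_source hg)).hasFDerivAt_fderiv
  have h10 := h9.unique ((hasFDerivAt_const (C.p g).1 (0 : Euc r)).congr_of_eventuallyEq h8)
  have h11 := congrArg (fun L : Euc r →L[ℝ] Euc r => L (C.localSection α (C.p g).2)) h10
  set κ := fderiv ℝ (fun w => C.p (k w)) 0 (C.localSection α (C.p g).2)
  have h12 : fderiv ℝ C.localMul ((C.p g).1, 0, (C.p g).2)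
      (κ.1, C.localSection α (C.p g).2, 0) = 0 := h11
  have h13 : ((κ.1, C.localSection α (C.p g).2, 0) : Euc r × Euc r × Euc n) =
      (κ.1, 0, 0) + (0, C.localSection α (C.p g).2, 0) := by simp
  rw [h13, map_add, C.fderiv_localMul_right (C.p.map_source hg)] at h12
  exact eq_neg_of_add_eq_zero_left h12

end AdaptedChart

end LieGroupoid

lemma log_add_log_sub_log {d f f' D c c' : ℝ} (h : d * f = f' * D) (hf : 0 < f)
    (hf' : 0 < f') (hD : 0 < D) (hc : c ≠ 0) (hc' : c' ≠ 0) :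
    Real.log D + Real.log |c| - Real.log |c'| =
      Real.log d + Real.log |f * c| - Real.log |f' * c'| := by
  have hd' : d ≠ 0 := by
    rintro rfl
    rw [zero_mul] at h
    exact (mul_pos hf' hD).ne h
  have h2 := congrArg Real.log h
  rw [Real.log_mul hd' hf.ne', Real.log_mul hf'.ne' hD.ne'] at h2
  rw [Real.log_abs, Real.log_abs, Real.log_abs, Real.log_abs, Real.log_mul hf.ne' hc,
    Real.log_mul hf'.ne' hc']
  linarith

namespace LieGroupoid

variable {n r : ℕ} {M G : Type*}
  [TopologicalSpace M] [ChartedSpace (EuclideanSpace ℝ (Fin n)) M] [IsManifold (𝓡 n) ∞ M]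
  [TopologicalSpace G] [ChartedSpace (EuclideanSpace ℝ (Fin (n + r))) G]
  [IsManifold (𝓡 (n + r)) ∞ G] {𝒢 : LieGroupoid n r M G}

namespace AdaptedChart

variable {x₀ : M} (C : 𝒢.AdaptedChart x₀)

/-! ### Frames in an adapted chart -/

/-- Smoothness of a section of the Lie algebroid, in an adapted chart. -/
lemma contMDiffAt_dp_section_iff {α : ∀ x, 𝒢.algebroid x} {x : M} (hx : x ∈ C.q.source) :
    ContMDiffAt (𝓡 n) (𝓡 (n + r)).tangent ∞
      (fun x => (⟨𝒢.unit x, (α x : TangentSpace (𝓡 (n + r)) (𝒢.unit x))⟩ :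
        TangentBundle (𝓡 (n + r)) G)) x ↔
    ContDiffAt ℝ ∞ (C.localSection α) (C.q x) := by
  rw [C.smooth_p.contMDiffAt_tangentBundle_iff 𝒢.contMDiff_unit.contMDiffAt (C.unit_mem x hx)]
  have h1 : ∀ᶠ y in nhds x, C.dp (𝒢.unit y) (α y).1 = (C.localSection α (C.q y), 0) := by
    filter_upwards [C.q.open_source.mem_nhds hx] with y hy using C.dp_section α hy
  have h2 : (fun y => C.dp (𝒢.unit y) (α y).1) =ᶠ[nhds x]
      fun y => ((C.localSection α (C.q y), 0) : Euc r × Euc n) := h1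
  constructor
  · intro h
    have h3 : ContMDiffAt (𝓡 n) 𝓘(ℝ, Euc r × Euc n) ∞
      (fun y => ((C.localSection α (C.q y), 0) : Euc r × Euc n)) x := h.congr_of_eventuallyEq h2.symm
    have h4 : ContMDiffAt 𝓘(ℝ, Euc n) 𝓘(ℝ, Euc r × Euc n) ∞
        (fun y => ((C.localSection α (C.q (C.q.symm y)), 0) : Euc r × Euc n)) (C.q x) :=
      ContMDiffAt.comp (C.q x) (by rw [C.q.left_inv hx]; exact h3)
        (C.smooth_q.contMDiffAt_symm (C.q.map_source hx))
    have h5 := (contMDiffAt_iff_contDiffAt.1 h4).fst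
    refine h5.congr_of_eventuallyEq ?_
    filter_upwards [C.q.open_target.mem_nhds (C.q.map_source hx)] with y hy
    simp only [C.q.right_inv hy]
  · intro h
    have h3 : ContMDiffAt (𝓡 n) 𝓘(ℝ, Euc r) ∞ (fun y => C.localSection α (C.q y)) x :=
      ContMDiffAt.comp (g := C.localSection α) x h.contMDiffAt (C.smooth_q.contMDiffAt hx)
    have h4 : ContMDiffAt (𝓡 n) 𝓘(ℝ, Euc r × Euc n) ∞
      (fun y => ((C.localSection α (C.q y), 0) : Euc r × Euc n)) x :=
      h3.prodMk_space contMDiffAt_const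
    exact h4.congr_of_eventuallyEq h2

lemma contDiffAt_localSection {α : ∀ x, 𝒢.algebroid x} {U : Set M} (hU : IsOpen U)
    (hα : 𝒢.SmoothSectionOn α U) {x : M} (hxU : x ∈ U) (hx : x ∈ C.q.source) :
    ContDiffAt ℝ ∞ (C.localSection α) (C.q x) :=
  (C.contMDiffAt_dp_section_iff hx).1 (hα.contMDiffAt (hU.mem_nhds hxU))

lemma contMDiffAt_dq_field_iff {v : ∀ x : M, TangentSpace (𝓡 n) x} {x : M} (hx : x ∈ C.q.source) :
    ContMDiffAt (𝓡 n) (𝓡 n).tangent ∞ (fun x => (⟨x, v x⟩ : TangentBundle (𝓡 n) M)) x ↔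
    ContDiffAt ℝ ∞ (C.localField v) (C.q x) := by
  rw [C.smooth_q.contMDiffAt_tangentBundle_iff contMDiffAt_id hx]
  have h2 : (fun y => C.dq y (v y)) =ᶠ[nhds x] fun y => C.localField v (C.q y) := by
    filter_upwards [C.q.open_source.mem_nhds hx] with y hy using (C.localField_q v hy).symm
  constructor
  · intro h
    have h3 : ContMDiffAt (𝓡 n) 𝓘(ℝ, Euc n) ∞ (fun y => C.localField v (C.q y)) x :=
      h.congr_of_eventuallyEq h2.symm
    have h4 : ContMDiffAt 𝓘(ℝ, Euc n) 𝓘(ℝ, Euc n) ∞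
        (fun y => C.localField v (C.q (C.q.symm y))) (C.q x) :=
      ContMDiffAt.comp (C.q x) (by rw [C.q.left_inv hx]; exact h3)
        (C.smooth_q.contMDiffAt_symm (C.q.map_source hx))
    refine (contMDiffAt_iff_contDiffAt.1 h4).congr_of_eventuallyEq ?_
    filter_upwards [C.q.open_target.mem_nhds (C.q.map_source hx)] with y hy
    simp only [C.q.right_inv hy]
  · intro h
    have h3 : ContMDiffAt (𝓡 n) 𝓘(ℝ, Euc n) ∞ (fun y => C.localField v (C.q y)) x :=
      ContMDiffAt.comp (g := C.localField v) x h.contMDiffAt (C.smooth_q.contMDiffAt hx)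
    exact h3.congr_of_eventuallyEq h2

lemma contDiffAt_localField {v : ∀ x : M, TangentSpace (𝓡 n) x} {U : Set M} (hU : IsOpen U)
    (hv : ContMDiffOn (𝓡 n) (𝓡 n).tangent ∞ (fun x => (⟨x, v x⟩ : TangentBundle (𝓡 n) M)) U)
    {x : M} (hxU : x ∈ U) (hx : x ∈ C.q.source) :
    ContDiffAt ℝ ∞ (C.localField v) (C.q x) :=
  (C.contMDiffAt_dq_field_iff hx).1 (hv.contMDiffAt (hU.mem_nhds hxU))

/-- The first coordinate of the chart identifies `A_x` with the model space. -/
def algebroidEquiv {x : M} (hx : x ∈ C.q.source) : 𝒢.algebroid x ≃ₗ[ℝ] Euc r :=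
  LinearEquiv.ofBijective
    (LinearMap.fst ℝ (Euc r) (Euc n) ∘ₗ
      (show TangentSpace (𝓡 (n + r)) (𝒢.unit x) →ₗ[ℝ] Euc r × Euc n from
        (C.dp (𝒢.unit x)).toLinearMap) ∘ₗ (𝒢.algebroid x).subtype) (by
    have hinj : Function.Injective (LinearMap.fst ℝ (Euc r) (Euc n) ∘ₗ
      (show TangentSpace (𝓡 (n + r)) (𝒢.unit x) →ₗ[ℝ] Euc r × Euc n from
        (C.dp (𝒢.unit x)).toLinearMap) ∘ₗ (𝒢.algebroid x).subtype) := by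
      rw [injective_iff_map_eq_zero]
      intro a ha
      have h1 : C.dp (𝒢.unit x) a.1 = 0 := by
        refine Prod.ext ha ?_
        exact (C.snd_dp (C.unit_mem x hx) _).trans
          ((congrArg _ (𝒢.algebroid_mfderiv_src a)).trans (map_zero _))
      have h2 := C.mfderiv_symm_dp (C.unit_mem x hx) a.1
      refine Subtype.ext (h2.symm.trans ((congrArg _ h1).trans ?_))
      exact map_zero (mfderiv 𝓘(ℝ, Euc r × Euc n) (𝓡 (n + r)) C.p.symm (C.p (𝒢.unit x)))
    have : FiniteDimensional ℝ (TangentSpace (𝓡 (n + r)) (𝒢.unit x)) :=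
      inferInstanceAs (FiniteDimensional ℝ (Euc (n + r)))
    refine ⟨hinj, (LinearMap.injective_iff_surjective_of_finrank_eq_finrank ?_).1 hinj⟩
    exact (𝒢.finrank_ker_mfderiv_src (𝒢.unit x)).trans finrank_euclideanSpace_fin.symm)

lemma algebroidEquiv_apply {x : M} (hx : x ∈ C.q.source) (α : ∀ x, 𝒢.algebroid x) :
    C.algebroidEquiv hx (α x) = C.localSection α (C.q x) := by
  have h : (C.dp (𝒢.unit x) (α x).1).1 = C.localSection α (C.q x) :=
    (Prod.ext_iff.1 (C.dp_section α hx)).1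
  exact h

/-- The chart identifies `T_x M` with the model space. -/
def tangentEquiv {x : M} (hx : x ∈ C.q.source) : TangentSpace (𝓡 n) x ≃ₗ[ℝ] Euc n :=
  (C.smooth_q.mdifferentiable.mfderiv hx).toLinearEquiv

lemma tangentEquiv_apply {x : M} (hx : x ∈ C.q.source) (v : ∀ x : M, TangentSpace (𝓡 n) x) :
    C.tangentEquiv hx (v x) = C.localField v (C.q x) :=
  (C.localField_q v hx).symm

end AdaptedChart

/-! ### The modular cocycle of a nowhere vanishing section -/

variable (𝒢)

/-- The logarithm of the coordinate of a section of the transverse density bundle. -/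
def logCoord (σ : ∀ x, 𝒢.TransverseDensityFibre x) (x : M) : ℝ :=
  Real.log |𝒢.coord x (σ x)|

/-- The modular cocycle of a nowhere vanishing section `σ` of the transverse density bundle: the
logarithm of the number `|g_* σ(src g) / σ(tgt g)|`. -/
def modularCocycle (σ : ∀ x, 𝒢.TransverseDensityFibre x) (g : G) : ℝ :=
  Real.log (𝒢.actionFactor g) + 𝒢.logCoord σ (𝒢.src g) - 𝒢.logCoord σ (𝒢.tgt g)

variable {𝒢}

/-- The modular cocycle computed in an arbitrary family of frames. -/
lemma modularCocycle_eq {σ : ∀ x, 𝒢.TransverseDensityFibre x} (hσ : ∀ x, σ x ≠ 0)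
    {g : G} (a : ∀ x, Module.Basis (Fin r) ℝ (𝒢.algebroid x))
    (v : ∀ x : M, Module.Basis (Fin n) ℝ (TangentSpace (𝓡 n) x)) {b b'}
    (hb : 𝒢.IsAdapted g (a (𝒢.tgt g)) (v (𝒢.src g)) b)
    (hb' : 𝒢.IsAdapted (𝒢.inv g) (a (𝒢.tgt (𝒢.inv g))) (v (𝒢.src (𝒢.inv g))) b') :
    𝒢.modularCocycle σ g = Real.log |b.det (fun k => 𝒢.invDeriv g (b' k))|
      + Real.log |𝒢.evalFrame (a (𝒢.src g)) (v (𝒢.src g)) (σ (𝒢.src g))|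
      - Real.log |𝒢.evalFrame (a (𝒢.tgt g)) (v (𝒢.tgt g)) (σ (𝒢.tgt g))| := by
  have e1 := 𝒢.evalFrame_eq_frameFactor_mul a v (σ (𝒢.src g))
  have e2 := 𝒢.evalFrame_eq_frameFactor_mul a v (σ (𝒢.tgt g))
  rw [e1, e2]
  exact log_add_log_sub_log (𝒢.abs_det_invDeriv_of_family a v hb hb')
    (𝒢.frameFactor_pos a v (𝒢.src g)) (𝒢.frameFactor_pos a v (𝒢.tgt g)) (𝒢.actionFactor_pos g)
    (𝒢.coord_ne_zero (hσ _)) (𝒢.coord_ne_zero (hσ _))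

/-- The logarithm of the coefficient of `σ` in a family of frames. -/
def logCoeff (σ : ∀ x, 𝒢.TransverseDensityFibre x)
    (a : ∀ x, Module.Basis (Fin r) ℝ (𝒢.algebroid x))
    (v : ∀ x : M, Module.Basis (Fin n) ℝ (TangentSpace (𝓡 n) x)) (x : M) : ℝ :=
  Real.log |𝒢.evalFrame (a x) (v x) (σ x)|

namespace AdaptedChart

variable {x₀ : M} (C : 𝒢.AdaptedChart x₀)

/-- Near a unit the modular cocycle is given by `localLogCocycle`. -/
lemma eventually_modularCocycle_eq {σ : ∀ x, 𝒢.TransverseDensityFibre x} (hσ : ∀ x, σ x ≠ 0)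
    {a : ∀ x, Module.Basis (Fin r) ℝ (𝒢.algebroid x)}
    {v : ∀ x : M, Module.Basis (Fin n) ℝ (TangentSpace (𝓡 n) x)} {U : Set M} (hU : IsOpen U)
    (hav : 𝒢.SmoothFramesOn a v U) {x : M} (hxU : x ∈ U) (hx : x ∈ C.q.source)
    (e : Module.Basis (Fin r) ℝ (Euc r)) (e' : Module.Basis (Fin n) ℝ (Euc n)) :
    ∀ᶠ g in nhds (𝒢.unit x), 𝒢.modularCocycle σ g =
      localLogCocycle e e' C.localMul C.localTgt
        (fun y i => C.localSection (fun x => a x i) y) (fun y j => C.localField (fun x => v x j) y)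
        (C.p g)
      + logCoeff σ a v (𝒢.src g) - logCoeff σ a v (𝒢.tgt g) := by
  have hy := C.q.map_source hx
  have hz := C.zero_mem_target hy
  have h1 := eventually_det_ne_zero (e := e) (e' := e') (ea := (a x).map (C.algebroidEquiv hx))
    (ev := (v x).map (C.tangentEquiv hx)) (m := C.localMul) (T := C.localTgt)
    (a := fun y i => C.localSection (fun x => a x i) y)
    (v := fun y j => C.localField (fun x => v x j) y)
    (C.contDiffAt_localMul_left hz) (C.contDiffAt_localTgt hz) (C.localTgt_zero hy)
    (C.fderiv_localMul_right hz) (C.fderiv_localMul_left hz)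
    (C.fderiv_localTgt_zero hy) (fun i => C.contDiffAt_localSection hU (hav.1 i) hxU hx)
    (fun j => C.contDiffAt_localField hU (hav.2 j) hxU hx)
    (fun i => by
      rw [Module.Basis.map_apply]; exact (C.algebroidEquiv_apply hx (fun x => a x i)).symm)
    (fun j => by
      rw [Module.Basis.map_apply]; exact (C.tangentEquiv_apply hx (fun x => v x j)).symm)
  rw [← C.p_unit x hx] at h1
  filter_upwards [(C.p.continuousAt (C.unit_mem x hx)).eventually h1,
    C.p.open_source.mem_nhds (C.unit_mem x hx)] with g hdet hg
  obtain ⟨d1, d2, d3, d4, d5⟩ := hdet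
  obtain ⟨b, hb⟩ := 𝒢.exists_adapted g (a (𝒢.tgt g)) (v (𝒢.src g))
  obtain ⟨b', hb'⟩ := 𝒢.exists_adapted (𝒢.inv g) (a (𝒢.tgt (𝒢.inv g))) (v (𝒢.src (𝒢.inv g)))
  refine (modularCocycle_eq hσ a v hb hb').trans ?_
  refine congrArg (fun t => t + logCoeff σ a v (𝒢.src g) - logCoeff σ a v (𝒢.tgt g)) ?_
  -- In the chart `b` is adapted to the differential of the source map, the projection to the base. The
  -- inversion turns the source at `g⁻¹` into the target at `g`, so the image of `b'` is adapted to the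
  -- differential of the target map.
  refine (log_abs_det_of_adapted e e' (U := TangentSpace (𝓡 (n + r)) g)
    (show TangentSpace (𝓡 (n + r)) g →ₗ[ℝ] Euc r × Euc n from (C.dp g).toLinearMap)
    (fderiv ℝ C.localTgt (C.p g)).toLinearMap b _ (fun i => ?_) (fun j => ?_) (fun i => ?_)
    (fun i => ?_) (fun j => ?_) d4 d1 d5 d2 d3).trans ?_
  · exact (congrArg (C.dp g) (hb.1 i)).trans (C.dp_rightTranslation (fun x => a x i) hg)
  · refine (C.snd_dp hg _).trans ((congrArg (C.dq (𝒢.src g)) (hb.2 j)).trans ?_)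
    rw [C.snd_p g hg]
    exact (C.localField_q (fun x => v x j) (C.src_mem g hg)).symm
  · refine Eq.trans ?_ (C.fst_dp_invDeriv (fun x => a x i) hg)
    exact congrArg (fun X : Euc (n + r) => (C.dp g (𝒢.invDeriv g X)).1) (hb'.1 i)
  · refine (C.fderiv_localTgt_dp hg _).trans ?_
    refine Eq.trans ?_ (map_zero (C.dq (𝒢.tgt g)))
    refine congrArg (C.dq (𝒢.tgt g)) ?_
    refine (𝒢.mfderiv_tgt_invDeriv g _).trans ?_
    exact (congrArg (mfderiv (𝓡 (n + r)) (𝓡 n) 𝒢.src (𝒢.inv g)) (hb'.1 i)).trans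
      (𝒢.mfderiv_src_rightTranslation _ _)
  · refine (C.fderiv_localTgt_dp hg _).trans ?_
    rw [C.localTgt_p hg]
    refine Eq.trans ?_ (C.localField_q (fun x => v x j) (C.tgt_mem g hg)).symm
    refine congrArg (C.dq (𝒢.tgt g)) ((𝒢.mfderiv_tgt_invDeriv g _).trans ((hb'.2 j).trans ?_))
    exact congrArg (fun x => (v x j : Euc n)) (𝒢.src_inv g)
  · rfl

end AdaptedChart

end LieGroupoid

namespace LieGroupoid

variable {n r : ℕ} {M G : Type*}
  [TopologicalSpace M] [ChartedSpace (EuclideanSpace ℝ (Fin n)) M] [IsManifold (𝓡 n) ∞ M]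
  [TopologicalSpace G] [ChartedSpace (EuclideanSpace ℝ (Fin (n + r))) G]
  [IsManifold (𝓡 (n + r)) ∞ G] {𝒢 : LieGroupoid n r M G}

namespace AdaptedChart

variable {x₀ : M} (C : 𝒢.AdaptedChart x₀)

open Classical in
/-- The frame of the Lie algebroid given by the chart, extended arbitrarily. -/
def frameA (x : M) : Module.Basis (Fin r) ℝ (𝒢.algebroid x) :=
  if hx : x ∈ C.q.source then
    (EuclideanSpace.basisFun (Fin r) ℝ).toBasis.map (C.algebroidEquiv hx).symm
  else 𝒢.algebroidFrame x

open Classical in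
/-- The coordinate frame of the base, extended arbitrarily. -/
def frameT (x : M) : Module.Basis (Fin n) ℝ (TangentSpace (𝓡 n) x) :=
  if hx : x ∈ C.q.source then
    (EuclideanSpace.basisFun (Fin n) ℝ).toBasis.map (C.tangentEquiv hx).symm
  else tangentFrame n x

lemma localSection_frameA {y : Euc n} (hy : y ∈ C.q.target) (i : Fin r) :
    C.localSection (fun x => C.frameA x i) y = (EuclideanSpace.basisFun (Fin r) ℝ).toBasis i := by
  have hx := C.q.map_target hy
  have h1 := C.algebroidEquiv_apply hx (fun x => C.frameA x i)
  rw [C.q.right_inv hy] at h1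
  rw [← h1, frameA, dif_pos hx, Module.Basis.map_apply, LinearEquiv.apply_symm_apply]

lemma localField_frameT {y : Euc n} (hy : y ∈ C.q.target) (j : Fin n) :
    C.localField (fun x => C.frameT x j) y = (EuclideanSpace.basisFun (Fin n) ℝ).toBasis j := by
  have hx := C.q.map_target hy
  have h1 := C.tangentEquiv_apply hx (fun x => C.frameT x j)
  rw [C.q.right_inv hy] at h1
  rw [← h1, frameT, dif_pos hx, Module.Basis.map_apply, LinearEquiv.apply_symm_apply]

lemma smoothFramesOn : 𝒢.SmoothFramesOn C.frameA C.frameT C.q.source := by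
  refine ⟨fun i x hx => ContMDiffAt.contMDiffWithinAt ?_,
    fun j x hx => ContMDiffAt.contMDiffWithinAt ?_⟩
  · rw [C.contMDiffAt_dp_section_iff hx]
    refine (contDiffAt_const (c := (EuclideanSpace.basisFun (Fin r) ℝ).toBasis i)
      ).congr_of_eventuallyEq ?_
    filter_upwards [C.q.open_target.mem_nhds (C.q.map_source hx)] with y hy
      using C.localSection_frameA hy i
  · rw [C.contMDiffAt_dq_field_iff hx]
    refine (contDiffAt_const (c := (EuclideanSpace.basisFun (Fin n) ℝ).toBasis j)
      ).congr_of_eventuallyEq ?_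
    filter_upwards [C.q.open_target.mem_nhds (C.q.map_source hx)] with y hy
      using C.localField_frameT hy j

/-! ### The modular cocycle near the units -/

variable {σ : ∀ x, 𝒢.TransverseDensityFibre x}

lemma contMDiffAt_logCoeff (hσ : ∀ x, σ x ≠ 0) (hs : 𝒢.IsSmoothDensity σ)
    {a : ∀ x, Module.Basis (Fin r) ℝ (𝒢.algebroid x)}
    {v : ∀ x : M, Module.Basis (Fin n) ℝ (TangentSpace (𝓡 n) x)} {U : Set M} (hU : IsOpen U)
    (hav : 𝒢.SmoothFramesOn a v U) {x : M} (hxU : x ∈ U) :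
    ContMDiffAt (𝓡 n) 𝓘(ℝ, ℝ) ∞ (logCoeff σ a v) x := by
  have h1 := (hs U hU a v hav).contMDiffAt (hU.mem_nhds hxU)
  have h2 : ContDiffAt ℝ ∞ (fun t : ℝ => Real.log |t|) (𝒢.evalFrame (a x) (v x) (σ x)) := by
    simp only [Real.log_abs]
    exact Real.contDiffAt_log.2 (𝒢.evalFrame_ne_zero _ _ (hσ x))
  exact ContMDiffAt.comp (g := fun t : ℝ => Real.log |t|) x h2.contMDiffAt h1

lemma modularCocycle_unit' {a : ∀ x, Module.Basis (Fin r) ℝ (𝒢.algebroid x)}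
    {v : ∀ x : M, Module.Basis (Fin n) ℝ (TangentSpace (𝓡 n) x)} (hσ : ∀ x, σ x ≠ 0) {U : Set M}
    (hU : IsOpen U) (hav : 𝒢.SmoothFramesOn a v U) {x : M} (hxU : x ∈ U) (hx : x ∈ C.q.source) :
    𝒢.modularCocycle σ (𝒢.unit x) = 0 := by
  have hy := C.q.map_source hx
  have hz := C.zero_mem_target hy
  have h1 := (C.eventually_modularCocycle_eq hσ hU hav hxU hx
    (EuclideanSpace.basisFun (Fin r) ℝ).toBasis
    (EuclideanSpace.basisFun (Fin n) ℝ).toBasis).self_of_nhds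
  rw [C.p_unit x hx, localLogCocycle_unit (C.localTgt_zero hy) (C.fderiv_localMul_right hz)
    (C.fderiv_localMul_left hz) (C.fderiv_localTgt_zero hy), 𝒢.src_unit, 𝒢.tgt_unit] at h1
  rw [h1, zero_add, sub_self]

lemma contMDiffAt_modularCocycle_unit' {a : ∀ x, Module.Basis (Fin r) ℝ (𝒢.algebroid x)}
    {v : ∀ x : M, Module.Basis (Fin n) ℝ (TangentSpace (𝓡 n) x)} (hσ : ∀ x, σ x ≠ 0)
    (hs : 𝒢.IsSmoothDensity σ) {U : Set M}
    (hU : IsOpen U) (hav : 𝒢.SmoothFramesOn a v U) {x : M} (hxU : x ∈ U) (hx : x ∈ C.q.source) :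
    ContMDiffAt (𝓡 (n + r)) 𝓘(ℝ, ℝ) ∞ (𝒢.modularCocycle σ) (𝒢.unit x) := by
  have hy := C.q.map_source hx
  have hz := C.zero_mem_target hy
  have h1 := C.eventually_modularCocycle_eq hσ hU hav hxU hx
    (EuclideanSpace.basisFun (Fin r) ℝ).toBasis (EuclideanSpace.basisFun (Fin n) ℝ).toBasis
  have h2 := contDiffAt_localLogCocycle (e := (EuclideanSpace.basisFun (Fin r) ℝ).toBasis)
    (e' := (EuclideanSpace.basisFun (Fin n) ℝ).toBasis)
    (ea := (a x).map (C.algebroidEquiv hx))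
    (ev := (v x).map (C.tangentEquiv hx)) (m := C.localMul) (T := C.localTgt)
    (a := fun y i => C.localSection (fun x => a x i) y)
    (v := fun y j => C.localField (fun x => v x j) y)
    (C.contDiffAt_localMul_left hz) (C.contDiffAt_localTgt hz) (C.localTgt_zero hy)
    (C.fderiv_localMul_right hz) (C.fderiv_localMul_left hz)
    (C.fderiv_localTgt_zero hy) (fun i => C.contDiffAt_localSection hU (hav.1 i) hxU hx)
    (fun j => C.contDiffAt_localField hU (hav.2 j) hxU hx)
    (fun i => by
      rw [Module.Basis.map_apply]; exact (C.algebroidEquiv_apply hx (fun x => a x i)).symm)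
    (fun j => by
      rw [Module.Basis.map_apply]; exact (C.tangentEquiv_apply hx (fun x => v x j)).symm)
  have h3 : ContMDiffAt (𝓡 (n + r)) 𝓘(ℝ, ℝ) ∞ (fun g => localLogCocycle
      (EuclideanSpace.basisFun (Fin r) ℝ).toBasis (EuclideanSpace.basisFun (Fin n) ℝ).toBasis
      C.localMul C.localTgt
      (fun y i => C.localSection (fun x => a x i) y) (fun y j => C.localField (fun x => v x j) y)
      (C.p g)) (𝒢.unit x) :=
    ContMDiffAt.comp (𝒢.unit x) (by rw [C.p_unit x hx]; exact h2.contMDiffAt)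
      (C.smooth_p.contMDiffAt (C.unit_mem x hx))
  have hl := contMDiffAt_logCoeff hσ hs hU hav hxU
  have h4 : ContMDiffAt (𝓡 (n + r)) 𝓘(ℝ, ℝ) ∞ (fun g => logCoeff σ a v (𝒢.src g)) (𝒢.unit x) :=
    ContMDiffAt.comp (g := logCoeff σ a v) (𝒢.unit x)
      (by rw [𝒢.src_unit]; exact hl) 𝒢.contMDiff_src.contMDiffAt
  have h5 : ContMDiffAt (𝓡 (n + r)) 𝓘(ℝ, ℝ) ∞ (fun g => logCoeff σ a v (𝒢.tgt g)) (𝒢.unit x) :=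
    ContMDiffAt.comp (g := logCoeff σ a v) (𝒢.unit x)
      (by rw [𝒢.tgt_unit]; exact hl) 𝒢.contMDiff_tgt.contMDiffAt
  exact ((h3.add h4).sub h5).congr_of_eventuallyEq h1

/-- The anchor of a section bracketed with a vector field, in coordinates. -/
lemma tangentEquiv_mlieBracket {α : ∀ x, 𝒢.algebroid x} {w : ∀ x : M, TangentSpace (𝓡 n) x}
    {x : M} (hx : x ∈ C.q.source) (hα : ContDiffAt ℝ ∞ (C.localSection α) (C.q x))
    (hw : ContDiffAt ℝ ∞ (C.localField w) (C.q x)) :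
    C.tangentEquiv hx (VectorField.mlieBracket (𝓡 n) (fun y => 𝒢.anchor y (α y)) w x) =
      VectorField.lieBracket ℝ (localAnchor C.localTgt (C.localSection α))
        (C.localField w) (C.q x) := by
  refine C.smooth_q.mfderiv_mlieBracket (V := fun y => 𝒢.anchor y (α y))
    (W := w) (V' := localAnchor C.localTgt (C.localSection α)) (W' := C.localField w) hx
    (by filter_upwards [C.q.open_source.mem_nhds hx] with y hy using C.dq_anchor α hy)
    (by filter_upwards [C.q.open_source.mem_nhds hx] with y hy using (C.localField_q w hy).symm)
    ?_ hw
  have hz := C.zero_mem_target (C.q.map_source hx)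
  have h6 : ContDiffAt ℝ ∞ (fun y : Euc n => fderiv ℝ C.localTgt (0, y)) (C.q x) :=
    ContDiffAt.comp (g := fderiv ℝ C.localTgt) (C.q x)
      ((C.contDiffAt_localTgt hz).fderiv_right (m := ∞) (by simp))
      (contDiffAt_const.prodMk contDiffAt_id)
  exact h6.clm_apply (hα.prodMk contDiffAt_const)

lemma contDiffAt_localRightInvariant {α : ∀ x, 𝒢.algebroid x} {x : M} (hx : x ∈ C.q.source)
    (hα : ContDiffAt ℝ ∞ (C.localSection α) (C.q x)) :
    ContDiffAt ℝ ∞ (localRightInvariant C.localMul C.localTgt (C.localSection α)) (0, C.q x) := by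
  have hy := C.q.map_source hx
  have hz := C.zero_mem_target hy
  exact (contDiffAt_fderiv_one (C.contDiffAt_localMul_left hz)
    (contDiffAt_comp_target (C.contDiffAt_localTgt hz) (C.localTgt_zero hy) hα)).prodMk
    contDiffAt_const

/-- The bracket of right invariant vector fields, in coordinates. -/
lemma dp_mlieBracket {α β : ∀ x, 𝒢.algebroid x} {x : M} (hx : x ∈ C.q.source)
    (hα : ContDiffAt ℝ ∞ (C.localSection α) (C.q x))
    (hβ : ContDiffAt ℝ ∞ (C.localSection β) (C.q x)) :
    C.dp (𝒢.unit x) (VectorField.mlieBracket (𝓡 (n + r)) (𝒢.rightInvariantField α)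
      (𝒢.rightInvariantField β) (𝒢.unit x)) =
      VectorField.lieBracket ℝ
      (localRightInvariant C.localMul C.localTgt (C.localSection α))
      (localRightInvariant C.localMul C.localTgt (C.localSection β)) (0, C.q x) := by
  have hux := C.unit_mem x hx
  have h5 := C.smooth_p.mfderiv_mlieBracket (V := 𝒢.rightInvariantField α)
    (W := 𝒢.rightInvariantField β)
    (V' := localRightInvariant C.localMul C.localTgt (C.localSection α))
    (W' := localRightInvariant C.localMul C.localTgt (C.localSection β)) hux
    (by filter_upwards [C.p.open_source.mem_nhds hux] with g hg using C.dp_rightTranslation α hg)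
    (by filter_upwards [C.p.open_source.mem_nhds hux] with g hg using C.dp_rightTranslation β hg)
    (by rw [C.p_unit x hx]; exact C.contDiffAt_localRightInvariant hx hα)
    (by rw [C.p_unit x hx]; exact C.contDiffAt_localRightInvariant hx hβ)
  rw [C.p_unit x hx] at h5
  exact h5

lemma algebroidEquiv_isBracketAt {α β : ∀ x, 𝒢.algebroid x} {x : M} (hx : x ∈ C.q.source)
    (hα : ContDiffAt ℝ ∞ (C.localSection α) (C.q x))
    (hβ : ContDiffAt ℝ ∞ (C.localSection β) (C.q x)) {γ : 𝒢.algebroid x}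
    (hγ : 𝒢.IsBracketAt α β x γ) :
    C.algebroidEquiv hx γ = (VectorField.lieBracket ℝ
      (localRightInvariant C.localMul C.localTgt (C.localSection α))
      (localRightInvariant C.localMul C.localTgt (C.localSection β)) (0, C.q x)).1 := by
  have h := congrArg (fun X : Euc (n + r) => (C.dp (𝒢.unit x) X).1) hγ
  exact h.trans (congrArg Prod.fst (C.dp_mlieBracket hx hα hβ))

/-- The derivative of the modular cocycle at a unit. -/
lemma mfderiv_modularCocycle_unit' {a : ∀ x, Module.Basis (Fin r) ℝ (𝒢.algebroid x)}
    {v : ∀ x : M, Module.Basis (Fin n) ℝ (TangentSpace (𝓡 n) x)} (hσ : ∀ x, σ x ≠ 0)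
    (hs : 𝒢.IsSmoothDensity σ) {U : Set M}
    (hU : IsOpen U) (hav : 𝒢.SmoothFramesOn a v U) {x : M} (hxU : x ∈ U) (hx : x ∈ C.q.source)
    {α : ∀ x, 𝒢.algebroid x} (hα : 𝒢.SmoothSectionOn α U) {γ : Fin r → 𝒢.algebroid x}
    (hγ : ∀ j, 𝒢.IsBracketAt α (fun y => a y j) x (γ j)) :
    (mfderiv (𝓡 (n + r)) 𝓘(ℝ, ℝ) (𝒢.modularCocycle σ) (𝒢.unit x) (α x).1 : ℝ) =
      (∑ j, (v x).repr (VectorField.mlieBracket (𝓡 n) (fun y => 𝒢.anchor y (α y))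
                (fun y => v y j) x) j) - (∑ j, (a x).repr (γ j) j)
      - 𝒢.anchorDeriv (logCoeff σ a v) x (α x) := by
  have hy := C.q.map_source hx
  have hz := C.zero_mem_target hy
  have hux := C.unit_mem x hx
  set e := (EuclideanSpace.basisFun (Fin r) ℝ).toBasis
  set e' := (EuclideanSpace.basisFun (Fin n) ℝ).toBasis
  have h1 := C.eventually_modularCocycle_eq hσ hU hav hxU hx e e'
  have hαl := C.contDiffAt_localSection hU hα hxU hx
  have hal := fun i => C.contDiffAt_localSection hU (hav.1 i) hxU hx
  have hvl := fun i => C.contDiffAt_localField hU (hav.2 i) hxU hx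
  have ha0 : ∀ i, C.localSection (fun x => a x i) (C.q x) = (a x).map (C.algebroidEquiv hx) i :=
    fun i => by
      rw [Module.Basis.map_apply]; exact (C.algebroidEquiv_apply hx (fun x => a x i)).symm
  have hv0 : ∀ j, C.localField (fun x => v x j) (C.q x) = (v x).map (C.tangentEquiv hx) j :=
    fun j => by
      rw [Module.Basis.map_apply]; exact (C.tangentEquiv_apply hx (fun x => v x j)).symm
  have h2 := contDiffAt_localLogCocycle (e := e) (e' := e')
    (a := fun y i => C.localSection (fun x => a x i) y)
    (v := fun y j => C.localField (fun x => v x j) y)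
    (C.contDiffAt_localMul_left hz) (C.contDiffAt_localTgt hz) (C.localTgt_zero hy)
    (C.fderiv_localMul_right hz) (C.fderiv_localMul_left hz)
    (C.fderiv_localTgt_zero hy) hal hvl ha0 hv0
  have h3 := hasFDerivAt_localLogCocycle (e := e) (e' := e')
    (a := fun y i => C.localSection (fun x => a x i) y)
    (v := fun y j => C.localField (fun x => v x j) y) (α := C.localSection α)
    (C.contDiffAt_localMul_left hz) (C.contDiffAt_localTgt hz) (C.localTgt_zero hy)
    (C.fderiv_localMul_right hz) (C.fderiv_localMul_left hz)
    (C.fderiv_localTgt_zero hy) hal hvl hαl ha0 hv0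
  set Ψ := localLogCocycle e e' C.localMul C.localTgt
      (fun y i => C.localSection (fun x => a x i) y) (fun y j => C.localField (fun x => v x j) y)
    with hΨ
  set ℓ : M → ℝ := logCoeff σ a v with hℓ
  have hl : ContMDiffAt (𝓡 n) 𝓘(ℝ, ℝ) ∞ ℓ x := contMDiffAt_logCoeff hσ hs hU hav hxU
  have hld := hl.mdifferentiableAt (n := ∞) (by simp)
  have hΨd : MDifferentiableAt 𝓘(ℝ, Euc r × Euc n) 𝓘(ℝ, ℝ) Ψ (0, C.q x) :=
    (h2.differentiableAt (by simp)).mdifferentiableAt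
  have hd1 : MDifferentiableAt (𝓡 (n + r)) 𝓘(ℝ, ℝ) (fun g => Ψ (C.p g)) (𝒢.unit x) :=
    MDifferentiableAt.comp (𝒢.unit x) (by rw [C.p_unit x hx]; exact hΨd)
      (C.mdifferentiableAt_p hux)
  have hd2 : MDifferentiableAt (𝓡 (n + r)) 𝓘(ℝ, ℝ) (fun g => ℓ (𝒢.src g)) (𝒢.unit x) :=
    MDifferentiableAt.comp (g := ℓ) (𝒢.unit x) (by rw [𝒢.src_unit]; exact hld)
      𝒢.mdifferentiable_src.mdifferentiableAt
  have hd3 : MDifferentiableAt (𝓡 (n + r)) 𝓘(ℝ, ℝ) (fun g => ℓ (𝒢.tgt g)) (𝒢.unit x) :=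
    MDifferentiableAt.comp (g := ℓ) (𝒢.unit x) (by rw [𝒢.tgt_unit]; exact hld)
      𝒢.mdifferentiable_tgt.mdifferentiableAt
  have e1 : (mfderiv (𝓡 (n + r)) 𝓘(ℝ, ℝ) (fun g => Ψ (C.p g)) (𝒢.unit x) (α x).1 : ℝ) =
      fderiv ℝ Ψ (0, C.q x) (C.localSection α (C.q x), 0) := by
    refine (mfderiv_comp_apply' hΨd (C.mdifferentiableAt_p hux) (C.p_unit x hx) _).trans ?_
    rw [mfderiv_eq_fderiv]
    exact congrArg (fderiv ℝ Ψ (0, C.q x)) (C.dp_section α hx)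
  have e2 : (mfderiv (𝓡 (n + r)) 𝓘(ℝ, ℝ) (fun g => ℓ (𝒢.src g)) (𝒢.unit x) (α x).1 : ℝ) = 0 := by
    refine (mfderiv_comp_apply' hld 𝒢.mdifferentiable_src.mdifferentiableAt (𝒢.src_unit x) _).trans
      ?_
    exact (congrArg _ (𝒢.algebroid_mfderiv_src (α x))).trans
      (map_zero (mfderiv (𝓡 n) 𝓘(ℝ, ℝ) ℓ x))
  have e3 : (mfderiv (𝓡 (n + r)) 𝓘(ℝ, ℝ) (fun g => ℓ (𝒢.tgt g)) (𝒢.unit x) (α x).1 : ℝ) =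
      𝒢.anchorDeriv ℓ x (α x) :=
    mfderiv_comp_apply' hld 𝒢.mdifferentiable_tgt.mdifferentiableAt (𝒢.tgt_unit x) _
  have e4 : ∀ j, ((v x).map (C.tangentEquiv hx)).repr (VectorField.lieBracket ℝ
      (localAnchor C.localTgt (C.localSection α))
      (C.localField (fun x => v x j)) (C.q x)) =
      (v x).repr (VectorField.mlieBracket (𝓡 n) (fun y => 𝒢.anchor y (α y))
                (fun y => v y j) x) := by
    intro j
    rw [← C.tangentEquiv_mlieBracket hx hαl (hvl j), Module.Basis.map_repr,
      LinearEquiv.trans_apply, LinearEquiv.symm_apply_apply]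
  have e5 : ∀ j, ((a x).map (C.algebroidEquiv hx)).repr (VectorField.lieBracket ℝ
      (localRightInvariant C.localMul C.localTgt (C.localSection α))
      (localRightInvariant C.localMul C.localTgt (C.localSection (fun x => a x j)))
        (0, C.q x)).1 = (a x).repr (γ j) := by
    intro j
    rw [← C.algebroidEquiv_isBracketAt hx hαl (hal j) (hγ j), Module.Basis.map_repr,
      LinearEquiv.trans_apply, LinearEquiv.symm_apply_apply]
  simp only [e4, e5] at h3
  have h4 := mfderiv_add_sub_apply hd1 hd2 hd3 h1 (α x).1 e1 (b := (0 : ℝ)) e2 e3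
  rw [h3, add_zero] at h4
  exact h4

end AdaptedChart

end LieGroupoid

namespace LieGroupoid

variable {n r : ℕ} {M G : Type*}
  [TopologicalSpace M] [ChartedSpace (EuclideanSpace ℝ (Fin n)) M] [IsManifold (𝓡 n) ∞ M]
  [TopologicalSpace G] [ChartedSpace (EuclideanSpace ℝ (Fin (n + r))) G]
  [IsManifold (𝓡 (n + r)) ∞ G] {𝒢 : LieGroupoid n r M G}

variable {σ : ∀ x, 𝒢.TransverseDensityFibre x}

/-! ### Multiplicativity of the modular cocycle near the units -/

lemma modularCocycle_unit (hσ : ∀ x, σ x ≠ 0) (x : M) : 𝒢.modularCocycle σ (𝒢.unit x) = 0 := by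
  obtain ⟨C⟩ := 𝒢.nonempty_adaptedChart x
  exact C.modularCocycle_unit' hσ C.q.open_source C.smoothFramesOn C.mem C.mem

lemma contMDiffAt_modularCocycle_unit (hσ : ∀ x, σ x ≠ 0) (hs : 𝒢.IsSmoothDensity σ) (x : M) :
    ContMDiffAt (𝓡 (n + r)) 𝓘(ℝ, ℝ) ∞ (𝒢.modularCocycle σ) (𝒢.unit x) := by
  obtain ⟨C⟩ := 𝒢.nonempty_adaptedChart x
  exact C.contMDiffAt_modularCocycle_unit' hσ hs C.q.open_source C.smoothFramesOn C.mem C.mem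

/-- Units act trivially: the section with coordinate `1` in the chosen frames has modular cocycle
`log (actionFactor)`. That section need not be continuous, which `modularCocycle_unit` permits. -/
lemma actionFactor_unit (x : M) : 𝒢.actionFactor (𝒢.unit x) = 1 := by
  have h0 : ∀ y, 𝒢.densityOfFrame (𝒢.algebroidFrame y) (tangentFrame n y) ≠ 0 := by
    intro y h
    have h1 := 𝒢.evalFrame_densityOfFrame (𝒢.algebroidFrame y) (tangentFrame n y)
    rw [h, map_zero] at h1
    exact zero_ne_one h1
  have h1 : ∀ y, 𝒢.coord y (𝒢.densityOfFrame (𝒢.algebroidFrame y) (tangentFrame n y)) = 1 :=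
    fun y => 𝒢.evalFrame_densityOfFrame (𝒢.algebroidFrame y) (tangentFrame n y)
  have h2 := modularCocycle_unit h0 x
  rw [modularCocycle, logCoord, logCoord, h1, h1, abs_one, Real.log_one, add_zero, sub_zero] at h2
  have h3 := 𝒢.actionFactor_pos (𝒢.unit x)
  exact Real.eq_one_of_pos_of_log_eq_zero h3 h2

namespace LocalBisection

variable {h g : G}

/-- Left multiplication by `h` changes `actionFactor` by a constant, which is found by evaluating at
the unit. -/
lemma actionFactor_mul (B : 𝒢.LocalBisection h) (hg : 𝒢.src h = 𝒢.tgt g) :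
    𝒢.actionFactor (𝒢.mul h g) = 𝒢.actionFactor h * 𝒢.actionFactor g := by
  obtain ⟨κ, hκ⟩ := B.exists_actionFactor_mul
  have h1 := hκ (𝒢.unit (𝒢.src h)) (𝒢.tgt_unit _).symm
  rw [𝒢.mul_unit, actionFactor_unit, mul_one] at h1
  rw [hκ g hg, h1]

lemma modularCocycle_mul (B : 𝒢.LocalBisection h) (hg : 𝒢.src h = 𝒢.tgt g) :
    𝒢.modularCocycle σ (𝒢.mul h g) = 𝒢.modularCocycle σ h + 𝒢.modularCocycle σ g := by
  rw [modularCocycle, modularCocycle, modularCocycle, 𝒢.tgt_mul _ _ hg, 𝒢.src_mul _ _ hg,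
    B.actionFactor_mul hg, Real.log_mul (𝒢.actionFactor_pos h).ne' (𝒢.actionFactor_pos g).ne', hg]
  ring

end LocalBisection

/-- The invertible derivative in the base directions, in an open set around the units. -/
lemma AdaptedChart.eventually_isInvertible {x₀ : M} (C : 𝒢.AdaptedChart x₀) {y : Euc n}
    (hy : y ∈ C.q.target) :
    ∀ᶠ z in nhds ((0 : Euc r), y), ∃ A : Euc n ≃L[ℝ] Euc n,
      (A : Euc n →L[ℝ] Euc n) =
        fderiv ℝ C.localTgt z ∘L ContinuousLinearMap.inr ℝ (Euc r) (Euc n) := by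
  have hz := C.zero_mem_target hy
  have h1 : ContinuousAt (fun z => fderiv ℝ C.localTgt z ∘L
      ContinuousLinearMap.inr ℝ (Euc r) (Euc n)) ((0 : Euc r), y) :=
    (((C.contDiffAt_localTgt hz).fderiv_right (m := ∞) (by simp)).continuousAt).clm_comp
      continuousAt_const
  have h2 : fderiv ℝ C.localTgt (0, y) ∘L ContinuousLinearMap.inr ℝ (Euc r) (Euc n) =
      (ContinuousLinearEquiv.refl ℝ (Euc n) : Euc n →L[ℝ] Euc n) := by
    ext1 η
    exact C.fderiv_localTgt_zero hy η
  have h3 := ContinuousLinearEquiv.nhds (ContinuousLinearEquiv.refl ℝ (Euc n))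
  rw [← h2] at h3
  exact h1 h3

/-- Through every arrow near a unit there is a local bisection: in an adapted chart, the
bisection is constant in the direction of the source fibres. -/
lemma eventually_nonempty_localBisection (x : M) :
    ∀ᶠ h in nhds (𝒢.unit x), Nonempty (𝒢.LocalBisection h) := by
  obtain ⟨C⟩ := 𝒢.nonempty_adaptedChart x
  have hux := C.unit_mem x C.mem
  have h1 := C.eventually_isInvertible (C.q.map_source C.mem)
  rw [← C.p_unit x C.mem] at h1
  filter_upwards [C.p.open_source.mem_nhds hux, (C.p.continuousAt hux).eventually h1] with h hh hA
  obtain ⟨A, hA⟩ := hA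
  set u := (C.p h).1
  have hsx := C.src_mem h hh
  have htx := C.tgt_mem h hh
  have hph : C.p h = (u, C.q (𝒢.src h)) := C.p_eq hh
  have hzt : (u, C.q (𝒢.src h)) ∈ C.p.target := by rw [← hph]; exact C.p.map_source hh
  have hcd : ContDiffAt ℝ ∞ (fun y : Euc n => C.localTgt (u, y)) (C.q (𝒢.src h)) :=
    ContDiffAt.comp (g := C.localTgt) (C.q (𝒢.src h)) (C.contDiffAt_localTgt hzt)
      (contDiffAt_const.prodMk contDiffAt_id)
  have hd : HasFDerivAt (fun y : Euc n => C.localTgt (u, y)) (A : Euc n →L[ℝ] Euc n)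
      (C.q (𝒢.src h)) := by
    rw [hA, hph]
    exact HasFDerivAt.comp (g := C.localTgt) _ (C.contDiffAt_localTgt hzt).hasFDerivAt_fderiv
      (hasFDerivAt_prodMk_right (𝕜 := ℝ) u _)
  have hst := hcd.hasStrictFDerivAt' hd (by simp)
  have hli := hst.eventually_left_inverse
  have hri := hst.eventually_right_inverse
  have hsm := hcd.to_localInverse hd (by simp)
  have h0 : C.localTgt (u, C.q (𝒢.src h)) = C.q (𝒢.tgt h) := by rw [← hph, C.localTgt_p hh]
  have hc0 : HasStrictFDerivAt.localInverse _ A _ hst (C.q (𝒢.tgt h)) = C.q (𝒢.src h) := by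
    rw [← h0]; exact hst.localInverse_apply_image
  set ψ₀ : Euc n → Euc n := HasStrictFDerivAt.localInverse _ A _ hst with hψ₀
  have hsm' : ContDiffAt ℝ ∞ ψ₀ (C.q (𝒢.tgt h)) := by rw [← h0]; exact hsm
  have hqs : ContMDiffAt (𝓡 n) 𝓘(ℝ, Euc n) ∞ C.q (𝒢.src h) := C.smooth_q.contMDiffAt hsx
  have hqt : ContMDiffAt (𝓡 n) 𝓘(ℝ, Euc n) ∞ C.q (𝒢.tgt h) := C.smooth_q.contMDiffAt htx
  have hψq : ContMDiffAt (𝓡 n) 𝓘(ℝ, Euc n) ∞ (fun y => ψ₀ (C.q y)) (𝒢.tgt h) :=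
    ContMDiffAt.comp _ hsm'.contMDiffAt hqt
  have hmem : ∀ᶠ y in nhds (𝒢.src h), (u, C.q y) ∈ C.p.target :=
    (continuousAt_const.prodMk hqs.continuousAt) (C.p.open_target.mem_nhds hzt)
  have hψmem : ∀ᶠ y in nhds (𝒢.tgt h), (u, ψ₀ (C.q y)) ∈ C.p.target :=
    (continuousAt_const.prodMk hψq.continuousAt)
      (C.p.open_target.mem_nhds (by change (u, ψ₀ (C.q (𝒢.tgt h))) ∈ _; rw [hc0]; exact hzt))
  have hsrc : ∀ᶠ y in nhds (𝒢.src h), 𝒢.src (C.p.symm (u, C.q y)) = y := by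
    filter_upwards [hmem, C.q.open_source.mem_nhds hsx] with y hy hyq
    rw [C.src_symm hy, C.q.left_inv hyq]
  refine ⟨⟨fun y => C.p.symm (u, C.q y), fun y => C.q.symm (ψ₀ (C.q y)), ?_, ?_, ?_, hsrc, ?_, ?_⟩⟩
  · exact ContMDiffAt.comp (g := C.p.symm) (𝒢.src h) (C.smooth_p.contMDiffAt_symm hzt)
      (contMDiffAt_const.prodMk_space hqs)
  · refine ContMDiffAt.comp (g := C.q.symm) (𝒢.tgt h) ?_ hψq
    rw [hc0]
    exact C.smooth_q.contMDiffAt_symm (C.q.map_source hsx)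
  · rw [← hph, C.p.left_inv hh]
  · filter_upwards [hmem, C.q.open_source.mem_nhds hsx, hqs.continuousAt.eventually hli]
      with y hy hyq hyl
    have h2 : C.q (𝒢.tgt (C.p.symm (u, C.q y))) = C.localTgt (u, C.q y) := rfl
    rw [h2, hyl, C.q.left_inv hyq]
  · have hri' : ∀ᶠ y in nhds (C.q (𝒢.tgt h)), C.localTgt (u, ψ₀ y) = y := by
      rw [← h0]; exact hri
    filter_upwards [hψmem, C.q.open_source.mem_nhds htx, hqt.continuousAt.eventually hri']
      with y hy hyq hyr
    have h2 := C.snd_mem_target hy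
    rw [C.q.right_inv h2, ← C.symm_localTgt hy, hyr, C.q.left_inv hyq]

end LieGroupoid

/-- The derivative of a function along a Lie bracket is the commutator of the derivatives. -/
lemma fderiv_lieBracket_eq {E : Type*} [NormedAddCommGroup E] [NormedSpace ℝ E] {Φ : E → ℝ}
    {X Y : E → E} {z : E} (hΦ : ContDiffAt ℝ ∞ Φ z) (hX : DifferentiableAt ℝ X z)
    (hY : DifferentiableAt ℝ Y z) :
    fderiv ℝ Φ z (VectorField.lieBracket ℝ X Y z) =
      fderiv ℝ (fun w => fderiv ℝ Φ w (Y w)) z (X z)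
        - fderiv ℝ (fun w => fderiv ℝ Φ w (X w)) z (Y z) := by
  have h1 : HasFDerivAt (fderiv ℝ Φ) (fderiv ℝ (fderiv ℝ Φ) z) z :=
    (hΦ.fderiv_right (m := ∞) (by simp)).hasFDerivAt_fderiv
  have hsymm : fderiv ℝ (fderiv ℝ Φ) z (X z) (Y z) = fderiv ℝ (fderiv ℝ Φ) z (Y z) (X z) :=
    (hΦ.isSymmSndFDerivAt (by simpa using two_le_infty)) _ _
  rw [(h1.clm_apply hX.hasFDerivAt).fderiv, (h1.clm_apply hY.hasFDerivAt).fderiv]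
  simp [VectorField.lieBracket, hsymm]

lemma sub_sub_eq_zero_of_neg {a b c : ℝ} (h : -c = -a - -b) : a - b - c = 0 := by linarith

namespace LieGroupoid

variable {n r : ℕ} {M G : Type*}
  [TopologicalSpace M] [ChartedSpace (EuclideanSpace ℝ (Fin n)) M] [IsManifold (𝓡 n) ∞ M]
  [TopologicalSpace G] [ChartedSpace (EuclideanSpace ℝ (Fin (n + r))) G]
  [IsManifold (𝓡 (n + r)) ∞ G] {𝒢 : LieGroupoid n r M G}

/-! ### The modular form and its closedness -/

variable (𝒢) in
/-- The `1`-form of a nowhere vanishing section of the transverse density bundle: minus the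
derivative of its modular cocycle along the units. -/
def modularForm (σ : ∀ x, 𝒢.TransverseDensityFibre x) : 𝒢.DualSections := fun x =>
  -(show Module.Dual ℝ (𝒢.algebroid x) from LinearMap.comp (M₃ := ℝ)
    (mfderiv (𝓡 (n + r)) 𝓘(ℝ, ℝ) (𝒢.modularCocycle σ) (𝒢.unit x)).toLinearMap
    (𝒢.algebroid x).subtype)

variable {σ : ∀ x, 𝒢.TransverseDensityFibre x}

lemma modularForm_apply (x : M) (a : 𝒢.algebroid x) : 𝒢.modularForm σ x a =
    -(mfderiv (𝓡 (n + r)) 𝓘(ℝ, ℝ) (𝒢.modularCocycle σ) (𝒢.unit x) a.1 : ℝ) := rfl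

/-- The modular cocycle is a homomorphism, so its derivative along right invariant vector fields is
determined by the derivative at the units. -/
lemma mfderiv_modularCocycle_rightTranslation (hσ : ∀ x, σ x ≠ 0) (hs : 𝒢.IsSmoothDensity σ)
    {g : G} (hF : MDifferentiableAt (𝓡 (n + r)) 𝓘(ℝ, ℝ) (𝒢.modularCocycle σ) g)
    (a : 𝒢.algebroid (𝒢.tgt g)) :
    (mfderiv (𝓡 (n + r)) 𝓘(ℝ, ℝ) (𝒢.modularCocycle σ) g (𝒢.rightTranslation g a) : ℝ) =
      - 𝒢.modularForm σ (𝒢.tgt g) a := by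
  obtain ⟨c, hc, hc0, hcs, hcA⟩ := 𝒢.exists_unit_slice (𝒢.tgt g)
  obtain ⟨w, hw⟩ := hcA a
  have hcd := hc.mdifferentiableAt (n := ∞) (by simp)
  have h1 := mfderiv_mul_const (g := g) hcd hc0 hcs w a hw.symm
  have h2 := contMDiffAt_mul hc (contMDiffAt_const (c := g)) hcs.self_of_nhds hcs
  have hu := (contMDiffAt_modularCocycle_unit hσ hs (𝒢.tgt g)).mdifferentiableAt (n := ∞) (by simp)
  have hfc : MDifferentiableAt 𝓘(ℝ, Euc r) 𝓘(ℝ, ℝ) (fun z => 𝒢.modularCocycle σ (c z)) 0 :=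
    MDifferentiableAt.comp (0 : Euc r) (by rw [hc0]; exact hu) hcd
  have h3 := mfderiv_comp_apply' hF (h2.mdifferentiableAt (by simp))
    (by rw [hc0, 𝒢.unit_mul]) w
  -- multiplicativity, for arrows `c z` in the source fibre near the unit of `tgt g`
  have h4 : ∀ᶠ z in nhds (0 : Euc r), 𝒢.modularCocycle σ (𝒢.mul (c z) g) =
      𝒢.modularCocycle σ (c z) + 𝒢.modularCocycle σ g - 0 := by
    have h5 := 𝒢.eventually_nonempty_localBisection (𝒢.tgt g)
    rw [← hc0] at h5
    filter_upwards [hc.continuousAt.eventually h5, hcs] with z hz hz'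
    obtain ⟨B⟩ := hz
    rw [B.modularCocycle_mul hz', sub_zero]
  have h5 : (mfderiv 𝓘(ℝ, Euc r) 𝓘(ℝ, ℝ) (fun z => 𝒢.modularCocycle σ (c z)) 0 w : ℝ) =
      mfderiv (𝓡 (n + r)) 𝓘(ℝ, ℝ) (𝒢.modularCocycle σ) (𝒢.unit (𝒢.tgt g)) a.1 :=
    (mfderiv_comp_apply' hu hcd hc0 w).trans (congrArg _ hw)
  have hconst : ∀ t : ℝ, (mfderiv 𝓘(ℝ, Euc r) 𝓘(ℝ, ℝ) (fun _ : Euc r => t) 0 w : ℝ) = 0 :=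
    fun t => congrArg (fun L : Euc r →L[ℝ] ℝ => L w) (hasMFDerivAt_const t (0 : Euc r)).mfderiv
  have h6 := mfderiv_add_sub_apply hfc
    (mdifferentiableAt_const (c := 𝒢.modularCocycle σ g)) (mdifferentiableAt_const (c := (0 : ℝ)))
    h4 w (b := (0 : ℝ)) (d := (0 : ℝ)) h5 (hconst _) (hconst _)
  have h7 : ∀ t : ℝ, t + 0 - 0 = t := fun t => by rw [add_zero, sub_zero]
  refine Eq.trans ?_ ((h6.trans (h7 _)).trans (neg_neg _).symm)
  refine Eq.trans ?_ h3.symm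
  exact congrArg (mfderiv (𝓡 (n + r)) 𝓘(ℝ, ℝ) (𝒢.modularCocycle σ) g) h1.symm

namespace AdaptedChart

variable {x₀ : M} (C : 𝒢.AdaptedChart x₀)

lemma fderiv_comp_p_symm {F : G → ℝ} {g : G} (hg : g ∈ C.p.source)
    (hF : MDifferentiableAt (𝓡 (n + r)) 𝓘(ℝ, ℝ) F g) (X : Euc (n + r)) :
    fderiv ℝ (fun z => F (C.p.symm z)) (C.p g) (C.dp g X) =
      mfderiv (𝓡 (n + r)) 𝓘(ℝ, ℝ) F g X := by
  have h1 : MDifferentiableAt 𝓘(ℝ, Euc r × Euc n) 𝓘(ℝ, ℝ) (fun z => F (C.p.symm z)) (C.p g) :=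
    MDifferentiableAt.comp (g := F) (C.p g) (by rw [C.p.left_inv hg]; exact hF)
      (C.mdifferentiableAt_symm (C.p.map_source hg))
  have h2 := mfderiv_comp_apply' h1 (C.mdifferentiableAt_p hg) rfl X
  rw [mfderiv_eq_fderiv] at h2
  refine h2.symm.trans (mfderiv_eq_of_eventuallyEq ?_ X)
  filter_upwards [C.p.open_source.mem_nhds hg] with h hh
  rw [C.p.left_inv hh]

lemma contDiffAt_modularCocycle (hσ : ∀ x, σ x ≠ 0) (hs : 𝒢.IsSmoothDensity σ) {x : M}
    (hx : x ∈ C.q.source) :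
    ContDiffAt ℝ ∞ (fun z => 𝒢.modularCocycle σ (C.p.symm z)) (0, C.q x) := by
  have hz := C.zero_mem_target (C.q.map_source hx)
  refine contMDiffAt_iff_contDiffAt.1 (ContMDiffAt.comp (g := 𝒢.modularCocycle σ) _ ?_
    (C.smooth_p.contMDiffAt_symm hz))
  rw [C.symm_zero (C.q.map_source hx), C.q.left_inv hx]
  exact contMDiffAt_modularCocycle_unit hσ hs x

lemma modularForm_eq (hσ : ∀ x, σ x ≠ 0) (hs : 𝒢.IsSmoothDensity σ) (α : ∀ x, 𝒢.algebroid x)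
    {x : M} (hx : x ∈ C.q.source) : 𝒢.modularForm σ x (α x) =
      - fderiv ℝ (fun z => 𝒢.modularCocycle σ (C.p.symm z)) (0, C.q x)
        (C.localSection α (C.q x), 0) := by
  have h1 := C.fderiv_comp_p_symm (C.unit_mem x hx) ((contMDiffAt_modularCocycle_unit hσ hs
    x).mdifferentiableAt (n := ∞) (by simp)) (α x).1
  have h2 := C.dp_section α hx
  rw [C.p_unit x hx] at h1
  rw [modularForm_apply, ← h1]
  refine congrArg Neg.neg (congrArg _ h2)

lemma contMDiffAt_modularForm (hσ : ∀ x, σ x ≠ 0) (hs : 𝒢.IsSmoothDensity σ)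
    {α : ∀ x, 𝒢.algebroid x} {x : M} (hx : x ∈ C.q.source)
    (hα : ContDiffAt ℝ ∞ (C.localSection α) (C.q x)) :
    ContMDiffAt (𝓡 n) 𝓘(ℝ, ℝ) ∞ (fun y => 𝒢.modularForm σ y (α y)) x := by
  have h1 : ContDiffAt ℝ ∞ (fun y => - fderiv ℝ (fun z => 𝒢.modularCocycle σ (C.p.symm z)) (0, y)
      (C.localSection α y, 0)) (C.q x) := by
    have h2 : ContDiffAt ℝ ∞ (fun y : Euc n =>
        fderiv ℝ (fun z => 𝒢.modularCocycle σ (C.p.symm z)) (0, y)) (C.q x) :=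
      ContDiffAt.comp (g := fderiv ℝ (fun z => 𝒢.modularCocycle σ (C.p.symm z))) (C.q x)
        ((C.contDiffAt_modularCocycle hσ hs hx).fderiv_right (m := ∞) (by simp))
        (contDiffAt_const.prodMk contDiffAt_id)
    exact (h2.clm_apply (hα.prodMk contDiffAt_const)).neg
  have h2 := ContMDiffAt.comp x h1.contMDiffAt (C.smooth_q.contMDiffAt hx)
  refine h2.congr_of_eventuallyEq ?_
  filter_upwards [C.q.open_source.mem_nhds hx] with y hy using C.modularForm_eq hσ hs α hy

/-- The differential of the modular form vanishes, because it is the restriction to the units of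
the differential of an exact form on the source fibres. -/
lemma modularForm_closed (hσ : ∀ x, σ x ≠ 0) (hs : 𝒢.IsSmoothDensity σ)
    {α β : ∀ x, 𝒢.algebroid x} {x : M} (hx : x ∈ C.q.source)
    (hα : ContDiffAt ℝ ∞ (C.localSection α) (C.q x))
    (hβ : ContDiffAt ℝ ∞ (C.localSection β) (C.q x)) {γ : 𝒢.algebroid x}
    (hγ : 𝒢.IsBracketAt α β x γ) :
    𝒢.anchorDeriv (fun y => 𝒢.modularForm σ y (β y)) x (α x)
      - 𝒢.anchorDeriv (fun y => 𝒢.modularForm σ y (α y)) x (β x) - 𝒢.modularForm σ x γ = 0 := by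
  have hy := C.q.map_source hx
  have hz := C.zero_mem_target hy
  have hux := C.unit_mem x hx
  have hFu := contMDiffAt_modularCocycle_unit hσ hs x
  have hΦ := C.contDiffAt_modularCocycle hσ hs hx
  have hFnear : ∀ᶠ g in nhds (𝒢.unit x),
      MDifferentiableAt (𝓡 (n + r)) 𝓘(ℝ, ℝ) (𝒢.modularCocycle σ) g := by
    have h1 := hFu.of_le (m := 1) (WithTop.coe_le_coe.2 le_top : (1 : ℕ∞ω) ≤ ∞)
    filter_upwards [(contMDiffAt_iff_contMDiffAt_nhds (by simp)).1 h1] with g hg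
      using hg.mdifferentiableAt (by simp)
  have hzn : ∀ᶠ z in nhds ((0 : Euc r), C.q x), z ∈ C.p.target ∧
      MDifferentiableAt (𝓡 (n + r)) 𝓘(ℝ, ℝ) (𝒢.modularCocycle σ) (C.p.symm z) := by
    have h1 := (C.smooth_p.contMDiffAt_symm hz).continuousAt
    have h2 : C.p.symm (0, C.q x) = 𝒢.unit x := by
      rw [C.symm_zero hy, C.q.left_inv hx]
    rw [← h2] at hFnear
    filter_upwards [C.p.open_target.mem_nhds hz, h1.eventually hFnear] with z h3 h4
      using ⟨h3, h4⟩
  -- the derivative of the cocycle along a right invariant field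
  have key : ∀ {β : ∀ x, 𝒢.algebroid x}, ContDiffAt ℝ ∞ (C.localSection β) (C.q x) →
      ∀ a : 𝒢.algebroid x,
      fderiv ℝ (fun z => fderiv ℝ (fun z => 𝒢.modularCocycle σ (C.p.symm z)) z
        (localRightInvariant C.localMul C.localTgt (C.localSection β) z)) (0, C.q x)
          (C.dp (𝒢.unit x) a.1) =
      - 𝒢.anchorDeriv (fun y => 𝒢.modularForm σ y (β y)) x a := by
    intro β hβ a
    set f : M → ℝ := fun y => 𝒢.modularForm σ y (β y) with hf
    have hfd := (C.contMDiffAt_modularForm hσ hs hx hβ).mdifferentiableAt (n := ∞) (by simp)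
    have h1 : (fun z => fderiv ℝ (fun z => 𝒢.modularCocycle σ (C.p.symm z)) z
        (localRightInvariant C.localMul C.localTgt (C.localSection β) z)) =ᶠ[nhds (0, C.q x)]
        fun z => - f (𝒢.tgt (C.p.symm z)) := by
      filter_upwards [hzn] with z hz
      have h2 := C.fderiv_comp_p_symm (C.p.map_target hz.1) hz.2
        (𝒢.rightTranslation (C.p.symm z) (β (𝒢.tgt (C.p.symm z))))
      rw [C.p.right_inv hz.1] at h2
      have h3 := C.dp_rightTranslation β (C.p.map_target hz.1)
      rw [C.p.right_inv hz.1] at h3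
      refine (congrArg _ h3.symm).trans (h2.trans ?_)
      exact mfderiv_modularCocycle_rightTranslation hσ hs hz.2 _
    rw [h1.fderiv_eq, ← C.p_unit x hx]
    have hfd' : MDifferentiableAt (𝓡 (n + r)) 𝓘(ℝ, ℝ) (fun g => f (𝒢.tgt g)) (𝒢.unit x) :=
      MDifferentiableAt.comp (g := f) (𝒢.unit x) (by rw [𝒢.tgt_unit]; exact hfd)
        𝒢.mdifferentiable_tgt.mdifferentiableAt
    have h4 := C.fderiv_comp_p_symm hux hfd' a.1
    have h5 : (mfderiv (𝓡 (n + r)) 𝓘(ℝ, ℝ) (fun g => f (𝒢.tgt g)) (𝒢.unit x) a.1 : ℝ) =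
        𝒢.anchorDeriv f x a :=
      mfderiv_comp_apply' hfd 𝒢.mdifferentiable_tgt.mdifferentiableAt (𝒢.tgt_unit x) _
    rw [fderiv_fun_neg]
    exact congrArg Neg.neg (h4.trans h5)
  -- `[X, Y]F = X(YF) - Y(XF)` at the unit of `x`
  have h1 := fderiv_lieBracket_eq hΦ
    ((C.contDiffAt_localRightInvariant hx hα).differentiableAt (by simp))
    ((C.contDiffAt_localRightInvariant hx hβ).differentiableAt (by simp))
  have hval : ∀ β : ∀ x, 𝒢.algebroid x,
      localRightInvariant C.localMul C.localTgt (C.localSection β) (0, C.q x) =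
        C.dp (𝒢.unit x) (β x).1 := by
    intro β
    refine Eq.trans ?_ (C.dp_section β hx).symm
    rw [localRightInvariant, C.localTgt_zero hy]
    exact Prod.ext (C.fderiv_localMul_right hz _) rfl
  rw [hval, hval] at h1
  have h2 := h1.trans (congrArg₂ (fun s t : ℝ => s - t) (key hβ (α x)) (key hα (β x)))
  have h3 : fderiv ℝ (fun z => 𝒢.modularCocycle σ (C.p.symm z)) (0, C.q x)
      (VectorField.lieBracket ℝ
      (localRightInvariant C.localMul C.localTgt (C.localSection α))
      (localRightInvariant C.localMul C.localTgt (C.localSection β)) (0, C.q x)) =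
      - 𝒢.modularForm σ x γ := by
    rw [← C.dp_mlieBracket hx hα hβ, ← C.p_unit x hx, modularForm_apply]
    refine (C.fderiv_comp_p_symm hux (hFu.mdifferentiableAt (by simp)) _).trans ?_
    refine Eq.trans ?_ (neg_neg _).symm
    exact congrArg (mfderiv (𝓡 (n + r)) 𝓘(ℝ, ℝ) (𝒢.modularCocycle σ) (𝒢.unit x)) hγ.symm
  exact sub_sub_eq_zero_of_neg (h3.symm.trans h2)

end AdaptedChart

/-- The modular form is a closed `1`-form of the Lie algebroid. -/
theorem modularForm_mem_closedForms (hσ : ∀ x, σ x ≠ 0) (hs : 𝒢.IsSmoothDensity σ) :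
    𝒢.modularForm σ ∈ 𝒢.closedForms := by
  refine ⟨fun α hα x => ?_, fun α β γ hα hβ hγ x => ?_⟩
  · obtain ⟨C⟩ := 𝒢.nonempty_adaptedChart x
    exact C.contMDiffAt_modularForm hσ hs C.mem
      (C.contDiffAt_localSection isOpen_univ hα (Set.mem_univ x) C.mem)
  · obtain ⟨C⟩ := 𝒢.nonempty_adaptedChart x
    exact C.modularForm_closed hσ hs C.mem
      (C.contDiffAt_localSection isOpen_univ hα (Set.mem_univ x) C.mem)
      (C.contDiffAt_localSection isOpen_univ hβ (Set.mem_univ x) C.mem) (hγ x)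


end LieGroupoid

lemma neg_mul_eq_of_eq {m d p q s f : ℝ} (h : m = q - p - s) (hd : d = s * f) :
    -m * f = d + (p - q) * f := by
  subst h hd
  ring

namespace LieGroupoid

variable {n r : ℕ} {M G : Type*}
  [TopologicalSpace M] [ChartedSpace (EuclideanSpace ℝ (Fin n)) M] [IsManifold (𝓡 n) ∞ M]
  [TopologicalSpace G] [ChartedSpace (EuclideanSpace ℝ (Fin (n + r))) G]
  [IsManifold (𝓡 (n + r)) ∞ G] {𝒢 : LieGroupoid n r M G}

/-! ### The modular form as connection form -/

variable (𝒢) in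
lemma anchorDeriv_log_abs {f : M → ℝ} {x : M} (hf : ContMDiffAt (𝓡 n) 𝓘(ℝ, ℝ) ∞ f x)
    (hf0 : f x ≠ 0) (w : 𝒢.algebroid x) :
    𝒢.anchorDeriv f x w = 𝒢.anchorDeriv (fun y => Real.log |f y|) x w * f x := by
  have h2 : HasDerivAt (fun t : ℝ => Real.log |t|) (f x)⁻¹ (f x) := by
    simp only [Real.log_abs]
    exact Real.hasDerivAt_log hf0
  have h3 := mfderiv_comp_apply' h2.differentiableAt.mdifferentiableAt
    (hf.mdifferentiableAt (by simp)) rfl (𝒢.anchor x w)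
  rw [mfderiv_eq_fderiv] at h3
  have h4 : 𝒢.anchorDeriv (fun y => Real.log |f y|) x w =
      fderiv ℝ (fun t : ℝ => Real.log |t|) (f x) (𝒢.anchorDeriv f x w) := h3
  have h5 : fderiv ℝ (fun t : ℝ => Real.log |t|) (f x) (𝒢.anchorDeriv f x w) =
      𝒢.anchorDeriv f x w * (f x)⁻¹ := by
    rw [← h2.deriv]
    exact fderiv_eq_smul_deriv _
  rw [h4, h5]
  exact (inv_mul_cancel_right₀ hf0 _).symm

variable {σ : ∀ x, 𝒢.TransverseDensityFibre x}

/-- The derivative of the logarithm of the coefficient of a section. -/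
lemma anchorDeriv_logCoeff (hσ : ∀ x, σ x ≠ 0) (hs : 𝒢.IsSmoothDensity σ)
    {a : ∀ x, Module.Basis (Fin r) ℝ (𝒢.algebroid x)}
    {v : ∀ x : M, Module.Basis (Fin n) ℝ (TangentSpace (𝓡 n) x)} {U : Set M} (hU : IsOpen U)
    (hav : 𝒢.SmoothFramesOn a v U) {x : M} (hxU : x ∈ U) (w : 𝒢.algebroid x) :
    𝒢.anchorDeriv (fun y => 𝒢.evalFrame (a y) (v y) (σ y)) x w =
      𝒢.anchorDeriv (logCoeff σ a v) x w * 𝒢.evalFrame (a x) (v x) (σ x) :=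
  𝒢.anchorDeriv_log_abs ((hs U hU a v hav).contMDiffAt (hU.mem_nhds hxU))
    (𝒢.evalFrame_ne_zero _ _ (hσ x)) w

/-- The modular form of `σ` is the connection form of the canonical representation. -/
theorem isLieDerivative_modularForm (hσ : ∀ x, σ x ≠ 0) (hs : 𝒢.IsSmoothDensity σ)
    {α : ∀ x, 𝒢.algebroid x} (hα : 𝒢.SmoothSectionOn α Set.univ) :
    𝒢.IsLieDerivative α σ (fun x => 𝒢.modularForm σ x (α x) • σ x) := by
  intro U hU a v hav x hxU γ hγ
  obtain ⟨C⟩ := 𝒢.nonempty_adaptedChart x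
  have h1 := C.mfderiv_modularCocycle_unit' hσ hs hU hav hxU C.mem (hα.mono (Set.subset_univ U)) hγ
  refine ((𝒢.evalFrame (a x) (v x)).map_smul _ _).trans ?_
  exact neg_mul_eq_of_eq h1 (anchorDeriv_logCoeff hσ hs hU hav hxU (α x))

end LieGroupoid

namespace LieGroupoid

variable {n r : ℕ} {M G : Type*}
  [TopologicalSpace M] [ChartedSpace (EuclideanSpace ℝ (Fin n)) M] [IsManifold (𝓡 n) ∞ M]
  [TopologicalSpace G] [ChartedSpace (EuclideanSpace ℝ (Fin (n + r))) G]
  [IsManifold (𝓡 (n + r)) ∞ G] {𝒢 : LieGroupoid n r M G}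

/-! ### Sections with prescribed values, and the uniqueness of the connection form -/

/-- A section is smooth at a point if its first coordinates in an adapted chart are. -/
lemma AdaptedChart.contMDiffAt_section_of_eventuallyEq {x₀ : M} (C : 𝒢.AdaptedChart x₀)
    {α : ∀ x, 𝒢.algebroid x} {x : M} (hx : x ∈ C.q.source) {f : M → Euc r}
    (hf : ContMDiffAt (𝓡 n) 𝓘(ℝ, Euc r) ∞ f x)
    (hα : ∀ᶠ y in nhds x, ∀ hy : y ∈ C.q.source, C.algebroidEquiv hy (α y) = f y) :
    ContMDiffAt (𝓡 n) (𝓡 (n + r)).tangent ∞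
      (fun x => (⟨𝒢.unit x, (α x : TangentSpace (𝓡 (n + r)) (𝒢.unit x))⟩ :
        TangentBundle (𝓡 (n + r)) G)) x := by
  rw [C.contMDiffAt_dp_section_iff hx]
  have hy := C.q.map_source hx
  have h1 : ContMDiffAt 𝓘(ℝ, Euc n) 𝓘(ℝ, Euc r) ∞ (fun y => f (C.q.symm y)) (C.q x) :=
    ContMDiffAt.comp (g := f) (C.q x) (by rw [C.q.left_inv hx]; exact hf)
      (C.smooth_q.contMDiffAt_symm hy)
  refine (contMDiffAt_iff_contDiffAt.1 h1).congr_of_eventuallyEq ?_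
  have h2 : ContinuousAt C.q.symm (C.q x) := C.q.continuousAt_symm hy
  have h3 : ∀ᶠ y in nhds (C.q.symm (C.q x)),
      ∀ hy : y ∈ C.q.source, C.algebroidEquiv hy (α y) = f y := by rwa [C.q.left_inv hx]
  filter_upwards [h2.eventually h3, C.q.open_target.mem_nhds hy] with y h4 h5
  rw [← h4 (C.q.map_target h5), C.algebroidEquiv_apply, C.q.right_inv h5]

open Classical in
/-- Every element of the Lie algebroid is the value of a smooth section. -/
lemma exists_smoothSection [T2Space M] {x : M} (a : 𝒢.algebroid x) :
    ∃ α : ∀ x, 𝒢.algebroid x, 𝒢.SmoothSectionOn α Set.univ ∧ α x = a := by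
  obtain ⟨C⟩ := 𝒢.nonempty_adaptedChart x
  obtain ⟨φ, -, hφ⟩ := (SmoothBumpFunction.nhds_basis_tsupport (I := 𝓡 n) x).mem_iff.1
    (C.q.open_source.mem_nhds C.mem)
  set w := C.algebroidEquiv C.mem a with hw
  -- the section with constant coordinates in the chart, cut off by a bump function
  refine ⟨fun y => if hy : y ∈ C.q.source then (C.algebroidEquiv hy).symm (φ y • w) else 0,
    fun y _ => ContMDiffAt.contMDiffWithinAt ?_, ?_⟩
  · by_cases hy : y ∈ C.q.source
    · refine C.contMDiffAt_section_of_eventuallyEq hy (f := fun y => φ y • w) ?_ ?_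
      · exact φ.contMDiff.contMDiffAt.smul contMDiffAt_const
      · refine Filter.Eventually.of_forall fun z hz => ?_
        rw [dif_pos hz, LinearEquiv.apply_symm_apply]
    · obtain ⟨C'⟩ := 𝒢.nonempty_adaptedChart y
      refine C'.contMDiffAt_section_of_eventuallyEq C'.mem (f := fun _ => 0)
        contMDiffAt_const ?_
      filter_upwards [(isClosed_tsupport φ).isOpen_compl.mem_nhds (fun h => hy (hφ h))] with z hz h
      have h0 : φ z = 0 := image_eq_zero_of_notMem_tsupport hz
      split_ifs with hz'
      · rw [h0, zero_smul, map_zero, map_zero]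
      · exact map_zero _
  · refine (dif_pos C.mem).trans ?_
    rw [φ.eq_one, one_smul, hw, LinearEquiv.symm_apply_apply]

/-- Brackets of smooth sections exist. -/
lemma AdaptedChart.exists_isBracketAt {x₀ : M} (C : 𝒢.AdaptedChart x₀)
    {α β : ∀ x, 𝒢.algebroid x} {x : M} (hx : x ∈ C.q.source)
    (hα : ContDiffAt ℝ ∞ (C.localSection α) (C.q x))
    (hβ : ContDiffAt ℝ ∞ (C.localSection β) (C.q x)) :
    ∃ γ : 𝒢.algebroid x, 𝒢.IsBracketAt α β x γ := by
  have hux := C.unit_mem x hx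
  have h1 := C.dp_mlieBracket hx hα hβ
  have h2 : ∀ {α : ∀ x, 𝒢.algebroid x}, ContDiffAt ℝ ∞ (C.localSection α) (C.q x) →
      ∀ z, (fderiv ℝ (localRightInvariant C.localMul C.localTgt (C.localSection α)) (0, C.q x)
        z).2 = 0 := by
    intro α hα z
    have h3 := (C.contDiffAt_localRightInvariant hx hα).differentiableAt (by simp)
    have h4 := (hasFDerivAt_snd (𝕜 := ℝ) (E := Euc r) (F := Euc n)
      (p := localRightInvariant C.localMul C.localTgt (C.localSection α) (0, C.q x))).comp
        ((0 : Euc r), C.q x) h3.hasFDerivAt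
    exact congrArg (fun L : Euc r × Euc n →L[ℝ] Euc n => L z)
      (h4.unique (hasFDerivAt_const (0 : Euc n) _))
  set X : Euc (n + r) := VectorField.mlieBracket (𝓡 (n + r)) (𝒢.rightInvariantField α)
      (𝒢.rightInvariantField β) (𝒢.unit x) with hX
  have h5 : (C.dp (𝒢.unit x) X).2 = 0 := by
    refine (congrArg Prod.snd h1).trans ?_
    rw [VectorField.lieBracket, Prod.snd_sub, h2 hβ, h2 hα, sub_zero]
  rw [C.snd_dp hux] at h5
  have hx' : 𝒢.src (𝒢.unit x) ∈ C.q.source := C.src_mem _ hux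
  refine ⟨⟨X, LinearMap.mem_ker.2 ?_⟩, rfl⟩
  exact (C.tangentEquiv hx').injective (h5.trans (map_zero _).symm)

/-- The connection form of a nowhere vanishing section is its modular form. -/
lemma eq_modularForm_of_isLieDerivative [T2Space M] {σ : ∀ x, 𝒢.TransverseDensityFibre x}
    (hσ : ∀ x, σ x ≠ 0) (hs : 𝒢.IsSmoothDensity σ) {θ : 𝒢.DualSections}
    (hθ : ∀ α, 𝒢.SmoothSectionOn α Set.univ →
      𝒢.IsLieDerivative α σ (fun x => θ x (α x) • σ x)) : θ = 𝒢.modularForm σ := by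
  funext x
  refine LinearMap.ext fun a => ?_
  obtain ⟨α, hα, rfl⟩ := exists_smoothSection a
  obtain ⟨C⟩ := 𝒢.nonempty_adaptedChart x
  have hα' := C.contDiffAt_localSection isOpen_univ hα (Set.mem_univ x) C.mem
  have h1 : ∀ j, ∃ γ : 𝒢.algebroid x, 𝒢.IsBracketAt α (fun y => C.frameA y j) x γ := fun j =>
    C.exists_isBracketAt C.mem hα'
      (C.contDiffAt_localSection C.q.open_source (C.smoothFramesOn.1 j) C.mem C.mem)
  choose γ hγ using h1
  have h2 := hθ α hα _ C.q.open_source _ _ C.smoothFramesOn x C.mem γ hγ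
  have h3 := isLieDerivative_modularForm hσ hs hα _ C.q.open_source _ _ C.smoothFramesOn x C.mem γ
    hγ
  refine mul_right_cancel₀ (𝒢.evalFrame_ne_zero (C.frameA x) (C.frameT x) (hσ x)) ?_
  exact (((𝒢.evalFrame _ _).map_smul _ _).symm.trans (h2.trans h3.symm)).trans
    ((𝒢.evalFrame _ _).map_smul _ _)

/-! ### Change of the section -/

lemma log_abs_eq_sub {f c : ℝ} (hf : 0 < f) (hc : c ≠ 0) :
    Real.log |c| = Real.log |f * c| - Real.log f := by
  rw [abs_mul, abs_of_pos hf, Real.log_mul hf.ne' (abs_ne_zero.2 hc), add_sub_cancel_left]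

/-- `logCoord` uses arbitrary frames and need not be smooth; its difference from a coefficient in
smooth frames does not depend on the section. -/
lemma logCoord_eq {σ : ∀ x, 𝒢.TransverseDensityFibre x} (hσ : ∀ x, σ x ≠ 0)
    (a : ∀ x, Module.Basis (Fin r) ℝ (𝒢.algebroid x))
    (v : ∀ x : M, Module.Basis (Fin n) ℝ (TangentSpace (𝓡 n) x)) (x : M) :
    𝒢.logCoord σ x = logCoeff σ a v x - Real.log (𝒢.frameFactor a v x) := by
  rw [logCoeff, logCoord, 𝒢.evalFrame_eq_frameFactor_mul a v]
  exact log_abs_eq_sub (𝒢.frameFactor_pos a v x) (𝒢.coord_ne_zero (hσ x))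

lemma contMDiff_logCoord_sub {σ σ' : ∀ x, 𝒢.TransverseDensityFibre x} (hσ : ∀ x, σ x ≠ 0)
    (hs : 𝒢.IsSmoothDensity σ) (hσ' : ∀ x, σ' x ≠ 0) (hs' : 𝒢.IsSmoothDensity σ') :
    ContMDiff (𝓡 n) 𝓘(ℝ, ℝ) ∞ (fun x => 𝒢.logCoord σ' x - 𝒢.logCoord σ x) := by
  intro x
  obtain ⟨C⟩ := 𝒢.nonempty_adaptedChart x
  have h : (fun x => 𝒢.logCoord σ' x - 𝒢.logCoord σ x) =
      fun x => logCoeff σ' C.frameA C.frameT x - logCoeff σ C.frameA C.frameT x := by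
    funext y
    rw [logCoord_eq hσ C.frameA C.frameT, logCoord_eq hσ' C.frameA C.frameT, sub_sub_sub_cancel_right]
  rw [h]
  exact (AdaptedChart.contMDiffAt_logCoeff hσ' hs' C.q.open_source C.smoothFramesOn C.mem).sub
    (AdaptedChart.contMDiffAt_logCoeff hσ hs C.q.open_source C.smoothFramesOn C.mem)

/-- The modular forms of two sections differ by the differential of the logarithm of their
quotient. -/
lemma modularForm_change {σ σ' : ∀ x, 𝒢.TransverseDensityFibre x} (hσ : ∀ x, σ x ≠ 0)
    (hs : 𝒢.IsSmoothDensity σ) {f : M → ℝ} (hf : ContMDiff (𝓡 n) 𝓘(ℝ, ℝ) ∞ f)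
    (hσf : ∀ x, 𝒢.logCoord σ' x = 𝒢.logCoord σ x + f x) (x : M) :
    𝒢.modularForm σ' x = 𝒢.modularForm σ x + 𝒢.anchorDeriv f x := by
  refine LinearMap.ext fun a => ?_
  have hF := (contMDiffAt_modularCocycle_unit hσ hs x).mdifferentiableAt (n := ∞) (by simp)
  have hfd : ∀ y, MDifferentiableAt (𝓡 n) 𝓘(ℝ, ℝ) f y := fun y =>
    (hf y).mdifferentiableAt (by simp)
  have hsrc : MDifferentiableAt (𝓡 (n + r)) 𝓘(ℝ, ℝ) (fun g => f (𝒢.src g)) (𝒢.unit x) :=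
    MDifferentiableAt.comp (g := f) (𝒢.unit x) (hfd _) 𝒢.mdifferentiable_src.mdifferentiableAt
  have htgt : MDifferentiableAt (𝓡 (n + r)) 𝓘(ℝ, ℝ) (fun g => f (𝒢.tgt g)) (𝒢.unit x) :=
    MDifferentiableAt.comp (g := f) (𝒢.unit x) (hfd _) 𝒢.mdifferentiable_tgt.mdifferentiableAt
  have h1 : (mfderiv (𝓡 (n + r)) 𝓘(ℝ, ℝ) (fun g => f (𝒢.src g)) (𝒢.unit x) a.1 : ℝ) = 0 :=
    (mfderiv_comp_apply' (hfd x) 𝒢.mdifferentiable_src.mdifferentiableAt (𝒢.src_unit x) _).trans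
      ((congrArg (mfderiv (𝓡 n) 𝓘(ℝ, ℝ) f x) (𝒢.algebroid_mfderiv_src a)).trans (map_zero _))
  have h2 : (mfderiv (𝓡 (n + r)) 𝓘(ℝ, ℝ) (fun g => f (𝒢.tgt g)) (𝒢.unit x) a.1 : ℝ) =
      𝒢.anchorDeriv f x a :=
    mfderiv_comp_apply' (hfd x) 𝒢.mdifferentiable_tgt.mdifferentiableAt (𝒢.tgt_unit x) _
  have h3 : ∀ g, 𝒢.modularCocycle σ' g = 𝒢.modularCocycle σ g + f (𝒢.src g) - f (𝒢.tgt g) := by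
    intro g
    rw [modularCocycle, modularCocycle, hσf, hσf]
    ring
  have h4 := mfderiv_add_sub_apply hF hsrc htgt (Filter.Eventually.of_forall h3) a.1 rfl h1 h2
  have h5 : ∀ s t : ℝ, -(s + 0 - t) = -s + t := fun s t => by ring
  exact (congrArg Neg.neg h4).trans (h5 _ _)

end LieGroupoid

namespace LieGroupoid

variable {n r : ℕ} {M G : Type*}
  [TopologicalSpace M] [ChartedSpace (EuclideanSpace ℝ (Fin n)) M] [IsManifold (𝓡 n) ∞ M]
  [TopologicalSpace G] [ChartedSpace (EuclideanSpace ℝ (Fin (n + r))) G]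
  [IsManifold (𝓡 (n + r)) ∞ G] {𝒢 : LieGroupoid n r M G}

/-! ### Existence of positive sections -/

namespace AdaptedChart

variable {x₀ : M} (C : 𝒢.AdaptedChart x₀)

/-- The change of frames from a coordinate frame to an arbitrary one, in coordinates. -/
lemma frameFactor_eq (a : ∀ x, Module.Basis (Fin r) ℝ (𝒢.algebroid x))
    (v : ∀ x : M, Module.Basis (Fin n) ℝ (TangentSpace (𝓡 n) x)) {x : M} (hx : x ∈ C.q.source) :
    𝒢.frameFactor a v x =
      Real.exp (Real.log |(EuclideanSpace.basisFun (Fin n) ℝ).toBasis.det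
          (fun j => C.localField (fun x => v x j) (C.q x))|
        - Real.log |(EuclideanSpace.basisFun (Fin r) ℝ).toBasis.det
          (fun i => C.localSection (fun x => a x i) (C.q x))|)
      * 𝒢.frameFactor C.frameA C.frameT x := by
  have h1 := 𝒢.evalFrame_change (a x) (C.frameA x) (v x) (C.frameT x)
    (𝒢.densityOfFrame (𝒢.algebroidFrame x) (tangentFrame n x))
  have h0 : 𝒢.coord x (𝒢.densityOfFrame (𝒢.algebroidFrame x) (tangentFrame n x)) = 1 :=
    𝒢.evalFrame_densityOfFrame _ _
  rw [𝒢.evalFrame_eq_frameFactor_mul a v, 𝒢.evalFrame_eq_frameFactor_mul C.frameA C.frameT, h0,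
    mul_one, mul_one] at h1
  have h2 : (EuclideanSpace.basisFun (Fin n) ℝ).toBasis.det
      (fun j => C.localField (fun x => v x j) (C.q x)) = (C.frameT x).det (v x) := by
    rw [frameT, dif_pos hx, Module.Basis.det_map]
    congr 1
    funext j
    exact (C.tangentEquiv_apply hx (fun x => v x j)).symm
  have h3 : (EuclideanSpace.basisFun (Fin r) ℝ).toBasis.det
      (fun i => C.localSection (fun x => a x i) (C.q x)) = (C.frameA x).det (a x) := by
    rw [frameA, dif_pos hx, Module.Basis.det_map]
    congr 1
    funext i
    exact (C.algebroidEquiv_apply hx (fun x => a x i)).symm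
  rw [h2, h3, Real.exp_sub, Real.exp_log (abs_det_pos _ _), Real.exp_log (abs_det_pos _ _), h1,
    eq_inv_of_mul_eq_one_left (abs_det_mul_abs_det_symm (a x) (C.frameA x)), div_eq_mul_inv]
  exact congrArg (· * 𝒢.frameFactor C.frameA C.frameT x) (mul_comm _ _)

lemma contMDiffAt_frameFactor_div {a : ∀ x, Module.Basis (Fin r) ℝ (𝒢.algebroid x)}
    {v : ∀ x : M, Module.Basis (Fin n) ℝ (TangentSpace (𝓡 n) x)} {U : Set M} (hU : IsOpen U)
    (hav : 𝒢.SmoothFramesOn a v U) {x : M} (hxU : x ∈ U) (hx : x ∈ C.q.source) :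
    ContMDiffAt (𝓡 n) 𝓘(ℝ, ℝ) ∞
      (fun y => 𝒢.frameFactor a v y * (𝒢.frameFactor C.frameA C.frameT y)⁻¹) x := by
  have h1 : ContDiffAt ℝ ∞ (fun y => Real.exp (Real.log |(EuclideanSpace.basisFun (Fin n)
      ℝ).toBasis.det (fun j => C.localField (fun x => v x j) y)|
        - Real.log |(EuclideanSpace.basisFun (Fin r) ℝ).toBasis.det
          (fun i => C.localSection (fun x => a x i) y)|)) (C.q x) := by
    refine ContDiffAt.exp (ContDiffAt.sub ?_ ?_)
    · refine contDiffAt_log_abs_det _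
        (fun j => C.contDiffAt_localField hU (hav.2 j) hxU hx) ?_
      have h : (fun j => C.localField (fun x => v x j) (C.q x)) =
          (v x).map (C.tangentEquiv hx) := by
        funext j
        exact (C.tangentEquiv_apply hx (fun x => v x j)).symm
      rw [h]
      exact (Module.Basis.isUnit_det _ _).ne_zero
    · refine contDiffAt_log_abs_det _
        (fun i => C.contDiffAt_localSection hU (hav.1 i) hxU hx) ?_
      have h : (fun i => C.localSection (fun x => a x i) (C.q x)) =
          (a x).map (C.algebroidEquiv hx) := by
        funext i
        exact (C.algebroidEquiv_apply hx (fun x => a x i)).symm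
      rw [h]
      exact (Module.Basis.isUnit_det _ _).ne_zero
  refine (ContMDiffAt.comp x h1.contMDiffAt (C.smooth_q.contMDiffAt hx)).congr_of_eventuallyEq ?_
  filter_upwards [C.q.open_source.mem_nhds hx] with y hy
  rw [C.frameFactor_eq a v hy, _root_.mul_assoc,
    mul_inv_cancel₀ (𝒢.frameFactor_pos C.frameA C.frameT y).ne', mul_one]
  rfl

end AdaptedChart

variable (𝒢) in
/-- The section of the transverse density bundle with coordinate `c`. -/
def densityOfCoord (c : M → ℝ) (x : M) : 𝒢.TransverseDensityFibre x :=
  c x • 𝒢.densityOfFrame (𝒢.algebroidFrame x) (tangentFrame n x)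

lemma coord_densityOfCoord (c : M → ℝ) (x : M) : 𝒢.coord x (𝒢.densityOfCoord c x) = c x := by
  rw [densityOfCoord, map_smul, coord, 𝒢.evalFrame_densityOfFrame, smul_eq_mul, mul_one]

lemma isStrictlyPositive_iff {σ : ∀ x, 𝒢.TransverseDensityFibre x} :
    𝒢.IsStrictlyPositive σ ↔ ∀ x, 0 < 𝒢.coord x (σ x) := by
  refine ⟨fun h x => h x _ _, fun h x a v => ?_⟩
  rw [𝒢.evalFrame_change a (𝒢.algebroidFrame x) v (tangentFrame n x)]
  exact mul_pos (mul_pos (abs_det_pos _ _) (abs_det_pos _ _)) (h x)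

lemma IsStrictlyPositive.ne_zero {σ : ∀ x, 𝒢.TransverseDensityFibre x}
    (h : 𝒢.IsStrictlyPositive σ) (x : M) : σ x ≠ 0 := by
  intro h0
  have h1 := isStrictlyPositive_iff.1 h x
  rw [h0, map_zero] at h1
  exact lt_irrefl _ h1

variable (𝒢) in
/-- Positive smooth sections of the transverse density bundle exist, because positivity is a convex
condition that is solvable locally. -/
theorem exists_smooth_strictlyPositive [T2Space M] [SecondCountableTopology M] :
    ∃ σ : ∀ x, 𝒢.TransverseDensityFibre x, 𝒢.IsSmoothDensity σ ∧ 𝒢.IsStrictlyPositive σ := by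
  have : LocallyCompactSpace M := ChartedSpace.locallyCompactSpace (EuclideanSpace ℝ (Fin n)) M
  let C : ∀ x, 𝒢.AdaptedChart x := fun x => (𝒢.nonempty_adaptedChart x).some
  obtain ⟨ρ, hρ⟩ := SmoothPartitionOfUnity.exists_isSubordinate (𝓡 n) isClosed_univ
    (fun x => (C x).q.source) (fun x => (C x).q.open_source)
    (fun x _ => Set.mem_iUnion.2 ⟨x, (C x).mem⟩)
  -- the sum of the densities with coefficient `1` in the frames of the charts, weighted by `ρ`
  set c : M → ℝ := fun x =>
    ∑ᶠ i, ρ i x • (𝒢.frameFactor (C i).frameA (C i).frameT x)⁻¹ with hc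
  refine ⟨𝒢.densityOfCoord c, fun U hU a v hav x hxU => ?_, isStrictlyPositive_iff.2 fun x => ?_⟩
  · have h1 : (fun x => 𝒢.evalFrame (a x) (v x) (𝒢.densityOfCoord c x)) = fun x =>
        ∑ᶠ i, ρ i x • (𝒢.frameFactor a v x * (𝒢.frameFactor (C i).frameA (C i).frameT x)⁻¹) := by
      funext y
      rw [𝒢.evalFrame_eq_frameFactor_mul a v, coord_densityOfCoord, hc, ← smul_eq_mul, smul_finsum]
      refine finsum_congr fun i => ?_
      exact mul_left_comm _ _ _
    rw [h1]
    refine (ρ.contMDiffAt_finsum fun i hi => ?_).contMDiffWithinAt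
    exact (C i).contMDiffAt_frameFactor_div hU hav hxU (hρ i hi)
  · rw [coord_densityOfCoord]
    exact ρ.finsum_smul_mem_convex (t := Set.Ioi (0 : ℝ))
      (g := fun i x => (𝒢.frameFactor (C i).frameA (C i).frameT x)⁻¹) (Set.mem_univ x)
      (fun i _ => inv_pos.2 (𝒢.frameFactor_pos _ _ x)) (convex_Ioi 0)

end LieGroupoid

lemma eq_mul_iff_log {D c c' : ℝ} (hD : 0 < D) (hc : 0 < c) (hc' : 0 < c') :
    c' = D * c ↔ Real.log D + Real.log |c| - Real.log |c'| = 0 := by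
  rw [abs_of_pos hc, abs_of_pos hc', ← Real.log_mul hD.ne' hc.ne', sub_eq_zero]
  exact ⟨fun h => by rw [h], fun h => (Real.log_injOn_pos (mul_pos hD hc) hc' h).symm⟩

lemma log_abs_exp_mul (t : ℝ) {c : ℝ} (hc : c ≠ 0) :
    Real.log |Real.exp t * c| = Real.log |c| + t := by
  rw [Real.log_abs, Real.log_abs, Real.log_mul (Real.exp_pos t).ne' hc, Real.log_exp, add_comm]

namespace LieGroupoid

variable {n r : ℕ} {M G : Type*}
  [TopologicalSpace M] [ChartedSpace (EuclideanSpace ℝ (Fin n)) M] [IsManifold (𝓡 n) ∞ M]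
  [TopologicalSpace G] [ChartedSpace (EuclideanSpace ℝ (Fin (n + r))) G]
  [IsManifold (𝓡 (n + r)) ∞ G] {𝒢 : LieGroupoid n r M G}

/-! ### Invariance of sections with vanishing modular form -/

/-- Right translation identifies `A_{t(g)}` with the tangent space of the source fibre at `g`. -/
lemma exists_rightTranslation_eq {g : G} {X : Euc (n + r)}
    (hX : (mfderiv (𝓡 (n + r)) (𝓡 n) 𝒢.src g X : Euc n) = 0) :
    ∃ a : 𝒢.algebroid (𝒢.tgt g), (𝒢.rightTranslation g a : Euc (n + r)) = X := by
  let K := LinearMap.ker (mfderiv (𝓡 (n + r)) (𝓡 n) 𝒢.src g).toLinearMap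
  let L : 𝒢.algebroid (𝒢.tgt g) →ₗ[ℝ] K :=
    (𝒢.rightTranslation g).codRestrict K (𝒢.mfderiv_src_rightTranslation g)
  have : FiniteDimensional ℝ (TangentSpace (𝓡 (n + r)) g) :=
    inferInstanceAs (FiniteDimensional ℝ (Euc (n + r)))
  have : FiniteDimensional ℝ (TangentSpace (𝓡 (n + r)) (𝒢.unit (𝒢.tgt g))) :=
    inferInstanceAs (FiniteDimensional ℝ (Euc (n + r)))
  have h1 : Function.Injective L := fun a b h =>
    𝒢.rightTranslation_injective g (congrArg Subtype.val h)
  have h2 : Module.finrank ℝ (𝒢.algebroid (𝒢.tgt g)) = Module.finrank ℝ K :=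
    (𝒢.finrank_ker_mfderiv_src (𝒢.unit (𝒢.tgt g))).trans (𝒢.finrank_ker_mfderiv_src g).symm
  obtain ⟨a, ha⟩ := (LinearMap.injective_iff_surjective_of_finrank_eq_finrank h2).1 h1
    ⟨X, LinearMap.mem_ker.2 hX⟩
  exact ⟨a, congrArg Subtype.val ha⟩

variable {σ : ∀ x, 𝒢.TransverseDensityFibre x}

/-- If the modular form vanishes, so does the modular cocycle near the units. -/
lemma eventually_modularCocycle_eq_zero (hσ : ∀ x, σ x ≠ 0) (hs : 𝒢.IsSmoothDensity σ)
    (h0 : ∀ x, 𝒢.modularForm σ x = 0) (x : M) :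
    ∀ᶠ g in nhds (𝒢.unit x), 𝒢.modularCocycle σ g = 0 := by
  obtain ⟨C⟩ := 𝒢.nonempty_adaptedChart x
  have hux := C.unit_mem x C.mem
  have hFu := contMDiffAt_modularCocycle_unit hσ hs x
  have hFnear : ∀ᶠ g in nhds (𝒢.unit x), g ∈ C.p.source ∧
      MDifferentiableAt (𝓡 (n + r)) 𝓘(ℝ, ℝ) (𝒢.modularCocycle σ) g := by
    have h1 := hFu.of_le (m := 1) (WithTop.coe_le_coe.2 le_top : (1 : ℕ∞ω) ≤ ∞)
    filter_upwards [(contMDiffAt_iff_contMDiffAt_nhds (by simp)).1 h1,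
      C.p.open_source.mem_nhds hux] with g hg hg' using ⟨hg', hg.mdifferentiableAt (by simp)⟩
  have hz := C.zero_mem_target (C.q.map_source C.mem)
  have hsymm : C.p.symm (0, C.q x) = 𝒢.unit x := by
    rw [C.symm_zero (C.q.map_source C.mem), C.q.left_inv C.mem]
  have h2 : ∀ᶠ z in nhds ((0 : Euc r), C.q x), z ∈ C.p.target ∧
      MDifferentiableAt (𝓡 (n + r)) 𝓘(ℝ, ℝ) (𝒢.modularCocycle σ) (C.p.symm z) := by
    have h3 := C.p.continuousAt_symm hz
    rw [← hsymm] at hFnear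
    filter_upwards [C.p.open_target.mem_nhds hz, h3.eventually hFnear] with z h4 h5
      using ⟨h4, h5.2⟩
  obtain ⟨ε, hε, hball⟩ := Metric.eventually_nhds_iff_ball.1 h2
  rw [← ball_prod_same] at hball
  -- on a product of balls the cocycle is constant in the fibre direction, and zero at the units
  have h3 : ∀ z ∈ Metric.ball (0 : Euc r) ε ×ˢ Metric.ball (C.q x) ε,
      𝒢.modularCocycle σ (C.p.symm z) = 0 := by
    rintro ⟨u, y⟩ ⟨hu, hy⟩
    have h4 : ∀ u ∈ Metric.ball (0 : Euc r) ε,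
        HasFDerivAt (fun u : Euc r => 𝒢.modularCocycle σ (C.p.symm (u, y))) (0 : Euc r →L[ℝ] ℝ)
          u := by
      intro u hu
      obtain ⟨hzt, hd⟩ := hball (u, y) ⟨hu, hy⟩
      have hg := C.p.map_target hzt
      have h5 : DifferentiableAt ℝ (fun z => 𝒢.modularCocycle σ (C.p.symm z)) (u, y) :=
        mdifferentiableAt_iff_differentiableAt.1 (MDifferentiableAt.comp
          (g := 𝒢.modularCocycle σ) (u, y) hd (C.mdifferentiableAt_symm hzt))
      have h6 := HasFDerivAt.comp (g := fun z => 𝒢.modularCocycle σ (C.p.symm z)) u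
        h5.hasFDerivAt (hasFDerivAt_prodMk_left (𝕜 := ℝ) u y)
      refine h6.congr_fderiv (ContinuousLinearMap.ext fun w => ?_)
      -- the vector `(w, 0)` is tangent to the source fibre
      set g := C.p.symm (u, y) with hgdef
      have hpg : C.p g = (u, y) := C.p.right_inv hzt
      obtain ⟨X, hX⟩ : ∃ X : Euc (n + r), C.dp g X = (w, 0) := by
        let X : Euc (n + r) :=
          mfderiv 𝓘(ℝ, Euc r × Euc n) (𝓡 (n + r)) C.p.symm (u, y) ((w, 0) : Euc r × Euc n)
        refine ⟨X, ?_⟩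
        refine (mfderiv_comp_apply' (C.mdifferentiableAt_p hg) (C.mdifferentiableAt_symm hzt) rfl
          ((w, 0) : Euc r × Euc n)).symm.trans ?_
        refine (mfderiv_eq_of_eventuallyEq (f' := fun z => z) (by
          filter_upwards [C.p.open_target.mem_nhds hzt] with z hz' using C.p.right_inv hz') _).trans
          ?_
        rw [mfderiv_eq_fderiv]
        exact congrArg (fun L : Euc r × Euc n →L[ℝ] Euc r × Euc n => L (w, 0)) (fderiv_fun_id (𝕜 := ℝ))
      have hXs := C.snd_dp hg X
      rw [hX] at hXs
      have hX0 : (mfderiv (𝓡 (n + r)) (𝓡 n) 𝒢.src g X : Euc n) = 0 :=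
        (C.tangentEquiv (C.src_mem g hg)).injective (hXs.symm.trans (map_zero _).symm)
      obtain ⟨a, ha⟩ := exists_rightTranslation_eq hX0
      have h7 := mfderiv_modularCocycle_rightTranslation hσ hs hd a
      have h8 := C.fderiv_comp_p_symm hg hd X
      rw [hpg, hX] at h8
      refine h8.trans ?_
      refine (congrArg (mfderiv (𝓡 (n + r)) 𝓘(ℝ, ℝ) (𝒢.modularCocycle σ) g) ha.symm).trans ?_
      refine h7.trans ?_
      rw [h0]
      exact neg_zero
    have h5 := (convex_ball (0 : Euc r) ε).is_const_of_fderivWithin_eq_zero (𝕜 := ℝ)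
      (fun u hu => (h4 u hu).differentiableAt.differentiableWithinAt)
      (fun u hu => by
        rw [fderivWithin_of_isOpen Metric.isOpen_ball hu, (h4 u hu).fderiv]) hu
        (Metric.mem_ball_self hε)
    refine h5.trans ?_
    have hy' := C.snd_mem_target (hball (u, y) ⟨hu, hy⟩).1
    change 𝒢.modularCocycle σ (C.p.symm (0, y)) = 0
    rw [C.symm_zero hy', modularCocycle_unit hσ]
  have h4 := C.p.continuousAt hux
  have h5 : Metric.ball (0 : Euc r) ε ×ˢ Metric.ball (C.q x) ε ∈ nhds (C.p (𝒢.unit x)) := by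
    rw [C.p_unit x C.mem]
    exact prod_mem_nhds (Metric.ball_mem_nhds _ hε) (Metric.ball_mem_nhds _ hε)
  filter_upwards [h4 h5, C.p.open_source.mem_nhds hux] with g hg hg'
  have h6 := h3 _ hg
  rwa [C.p.left_inv hg'] at h6

/-- If the modular form vanishes, so does the modular cocycle: `F(h) = F(h k⁻¹) + F(k) = F(k)` for `h`
near `k` in the source fibre of `k`, so `F` is constant on the connected source fibre, which contains
a unit. -/
lemma modularCocycle_eq_zero (hconn : 𝒢.IsSConnected) (hσ : ∀ x, σ x ≠ 0)
    (hs : 𝒢.IsSmoothDensity σ) (h0 : ∀ x, 𝒢.modularForm σ x = 0) (g : G) :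
    𝒢.modularCocycle σ g = 0 := by
  set S := {h : G | 𝒢.src h = 𝒢.src g} with hS
  have hpre : PreconnectedSpace S :=
    isPreconnected_iff_preconnectedSpace.1 (hconn (𝒢.src g)).isPreconnected
  have hloc : IsLocallyConstant (fun h : S => 𝒢.modularCocycle σ h.1) := by
    rw [IsLocallyConstant.iff_eventually_eq]
    rintro ⟨k, hk⟩
    have hcomp : ∀ h : S, 𝒢.src h.1 = 𝒢.tgt (𝒢.inv k) := fun h => by
      rw [𝒢.tgt_inv]; exact h.2.trans hk.symm
    have hcont : ContinuousAt (fun h : S => 𝒢.mul h.1 (𝒢.inv k)) ⟨k, hk⟩ := by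
      have h1 := (𝒢.contMDiffOn_mul.continuousOn (k, 𝒢.inv k) (hcomp ⟨k, hk⟩))
      have h2 : ContinuousAt (fun h : S => (h.1, 𝒢.inv k)) ⟨k, hk⟩ := by fun_prop
      exact h1.tendsto.comp (tendsto_nhdsWithin_iff.2 ⟨h2, Filter.Eventually.of_forall hcomp⟩)
    have h1 : 𝒢.mul k (𝒢.inv k) = 𝒢.unit (𝒢.tgt k) := 𝒢.mul_inv k
    have h2 := (eventually_modularCocycle_eq_zero hσ hs h0 (𝒢.tgt k)).and
      (𝒢.eventually_nonempty_localBisection (𝒢.tgt k))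
    rw [← h1] at h2
    filter_upwards [hcont.eventually h2] with h hh
    obtain ⟨h3, ⟨B⟩⟩ := hh
    have h4 : 𝒢.src (𝒢.mul h.1 (𝒢.inv k)) = 𝒢.tgt k := by
      rw [𝒢.src_mul _ _ (hcomp h), 𝒢.src_inv]
    have h5 : 𝒢.mul (𝒢.mul h.1 (𝒢.inv k)) k = h.1 := by
      rw [𝒢.mul_assoc _ _ _ (hcomp h) (𝒢.src_inv k), 𝒢.inv_mul, hk, ← h.2, 𝒢.mul_unit]
    have h6 := B.modularCocycle_mul (σ := σ) h4
    rw [h5, h3, zero_add] at h6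
    exact h6
  have h1 := hloc.apply_eq_of_preconnectedSpace ⟨g, rfl⟩
    ⟨𝒢.unit (𝒢.src g), 𝒢.src_unit _⟩
  exact h1.trans (modularCocycle_unit hσ _)

/-- A positive section is invariant if and only if its modular cocycle vanishes. -/
lemma isActionOf_iff_modularCocycle_eq_zero (hσ : 𝒢.IsStrictlyPositive σ) (g : G) :
    𝒢.IsActionOf g (σ (𝒢.src g)) (σ (𝒢.tgt g)) ↔ 𝒢.modularCocycle σ g = 0 := by
  have h1 := isStrictlyPositive_iff.1 hσ (𝒢.src g)
  have h2 := isStrictlyPositive_iff.1 hσ (𝒢.tgt g)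
  exact 𝒢.isActionOf_iff.trans (eq_mul_iff_log (𝒢.actionFactor_pos g) h1 h2)

lemma modularForm_eq_zero_of_modularCocycle (h : ∀ g, 𝒢.modularCocycle σ g = 0) (x : M) :
    𝒢.modularForm σ x = 0 := by
  refine LinearMap.ext fun a => ?_
  have h1 : (mfderiv (𝓡 (n + r)) 𝓘(ℝ, ℝ) (𝒢.modularCocycle σ) (𝒢.unit x) a.1 : ℝ) = 0 :=
    mfderiv_eq_zero_of_eventually_const (Filter.Eventually.of_forall h) _
  exact (congrArg Neg.neg h1).trans neg_zero

/-- Rescaling a positive section by the exponential of a function. -/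
lemma exists_rescaling (hs : 𝒢.IsSmoothDensity σ) (hpos : 𝒢.IsStrictlyPositive σ) {f : M → ℝ}
    (hf : ContMDiff (𝓡 n) 𝓘(ℝ, ℝ) ∞ f) :
    ∃ σ' : ∀ x, 𝒢.TransverseDensityFibre x, 𝒢.IsSmoothDensity σ' ∧ 𝒢.IsStrictlyPositive σ' ∧
      ∀ x, 𝒢.logCoord σ' x = 𝒢.logCoord σ x + f x := by
  have hexp : ContMDiff (𝓡 n) 𝓘(ℝ, ℝ) ∞ (fun x => Real.exp (f x)) :=
    Real.contDiff_exp.contMDiff.comp hf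
  have hcoord : ∀ x, 𝒢.coord x (Real.exp (f x) • σ x) = Real.exp (f x) * 𝒢.coord x (σ x) :=
    fun x => (𝒢.coord x).map_smul _ _
  refine ⟨fun x => Real.exp (f x) • σ x, fun U hU a v hav => ?_,
    isStrictlyPositive_iff.2 fun x => ?_, fun x => ?_⟩
  · refine (hexp.contMDiffOn.smul (hs U hU a v hav)).congr fun x _ => ?_
    exact (𝒢.evalFrame (a x) (v x)).map_smul _ _
  · rw [hcoord]
    exact mul_pos (Real.exp_pos _) (isStrictlyPositive_iff.1 hpos x)
  · rw [logCoord, hcoord, logCoord]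
    exact log_abs_exp_mul _ (isStrictlyPositive_iff.1 hpos x).ne'

end LieGroupoid

end

theorem mainTheorem3 {n r : ℕ} {M G : Type*}
    [TopologicalSpace M] [ChartedSpace (EuclideanSpace ℝ (Fin n)) M] [IsManifold (𝓡 n) ∞ M]
    [T2Space M] [SecondCountableTopology M]
    [TopologicalSpace G] [ChartedSpace (EuclideanSpace ℝ (Fin (n + r))) G]
    [IsManifold (𝓡 (n + r)) ∞ G]
    (𝒢 : LieGroupoid n r M G) (hconn : 𝒢.IsSConnected) :
    ∃ c : 𝒢.H1, 𝒢.IsModularClass c ∧ (∀ c' : 𝒢.H1, 𝒢.IsModularClass c' → c' = c) ∧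
      (c = 0 ↔ ∃ σ : ∀ x, 𝒢.TransverseDensityFibre x,
        𝒢.IsTransverseDensity σ ∧ 𝒢.IsStrictlyPositive σ) := by
  obtain ⟨σ, hs, hpos⟩ := 𝒢.exists_smooth_strictlyPositive
  have hσ := hpos.ne_zero
  let θ : 𝒢.closedForms := ⟨𝒢.modularForm σ, LieGroupoid.modularForm_mem_closedForms hσ hs⟩
  have hchange : ∀ σ' : (∀ x, 𝒢.TransverseDensityFibre x), (∀ x, σ' x ≠ 0) →
      𝒢.IsSmoothDensity σ' → 𝒢.modularForm σ' - 𝒢.modularForm σ ∈ 𝒢.exactForms := by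
    intro σ' hσ' hs'
    refine ⟨_, LieGroupoid.contMDiff_logCoord_sub hσ hs hσ' hs', fun x => ?_⟩
    refine sub_eq_of_eq_add' ?_
    exact LieGroupoid.modularForm_change hσ hs
      (LieGroupoid.contMDiff_logCoord_sub hσ hs hσ' hs') (fun y => (add_sub_cancel _ _).symm) x
  have hzero : (Submodule.Quotient.mk θ : 𝒢.H1) = 0 ↔ 𝒢.modularForm σ ∈ 𝒢.exactForms :=
    Submodule.Quotient.mk_eq_zero _
  refine ⟨Submodule.Quotient.mk θ, ⟨σ, hs, hσ, θ, rfl, fun α hα =>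
    LieGroupoid.isLieDerivative_modularForm hσ hs hα⟩, ?_, ?_⟩
  · rintro c' ⟨σ', hs', hσ', θ', rfl, hθ'⟩
    have h1 := LieGroupoid.eq_modularForm_of_isLieDerivative hσ' hs' hθ'
    refine (Submodule.Quotient.eq _).2 ?_
    change θ'.1 - 𝒢.modularForm σ ∈ 𝒢.exactForms
    rw [h1]
    exact hchange σ' hσ' hs'
  · rw [hzero]
    constructor
    · intro hexact
      obtain ⟨f, hf, hθ⟩ := neg_mem hexact
      obtain ⟨σ', hs', hpos', hlog⟩ := LieGroupoid.exists_rescaling hs hpos hf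
      have h0 : ∀ x, 𝒢.modularForm σ' x = 0 := fun x => by
        rw [LieGroupoid.modularForm_change hσ hs hf hlog x, ← hθ x]
        exact add_neg_cancel (𝒢.modularForm σ x)
      exact ⟨σ', ⟨hs', fun g => (LieGroupoid.isActionOf_iff_modularCocycle_eq_zero hpos' g).2
        (LieGroupoid.modularCocycle_eq_zero hconn hpos'.ne_zero hs' h0 g)⟩, hpos'⟩
    · rintro ⟨σ', ⟨hs', hinv⟩, hpos'⟩
      have h0 : 𝒢.modularForm σ' = 0 := funext fun x =>
        LieGroupoid.modularForm_eq_zero_of_modularCocycle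
          (fun g => (LieGroupoid.isActionOf_iff_modularCocycle_eq_zero hpos' g).1 (hinv g)) x
      have h1 := hchange σ' hpos'.ne_zero hs'
      rw [h0, zero_sub] at h1
      exact neg_mem_iff.1 h1
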